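/- Let $(\Omega,\mathcal F,\mathsf P)$ be a probability space and let $\mu$ be a stochastic measure on the Borel sets of $[0,1]^d$: each $\mu(A)$ is a real random variable (a fixed version), $\mu(A\cup B)=\mu(A)+\mu(B)$ a.s. for disjoint $A,B$, and $\mu(A_n)\to0$ in probability whenever $A_n\downarrow\emptyset$. For a simple function $g$ put $\int g\,d\mu=\sum_y y\,\mu(\{g=y\})$; a function $g$ is integrable if there are simple functions $g_n\to g$ pointwise such that $\int_A g_n\,d\mu$ converges in probability for every Borel set $A$, and $\int g\,d\mu$ is the limit in probability for $A=[0,1]^d$. Let $\chi_1=1$ and, for $n=2^j+i$ with $j\ge0$, $1\le i\le2^j$, let $\chi_n$ be the Haar function equal to $2^{j/2}$ on $\bigl((i-1)2^{-j},(2i-1)2^{-j-1}\bigr)$, to $-2^{j/2}$ on $\bigl((2i-1)2^{-j-1},i2^{-j}\bigr)$ and to $0$ outside $[(i-1)2^{-j},i2^{-j}]$, where at points of discontinuity in $(0,1)$ the value is the mean of the one-sided limits, and at $0$ and $1$ it is the one-sided limit. For a continuous $g:[0,1]^d\to\mathbb R$ let $$S_{2^k}(g,x)=\sum_{n\in\{1,\dots,2^k\}^d}\Bigl(\int_{[0,1]^d}g(t)\prod_{s=1}^d\chi_{n_s}(t_s)\,dt\Bigr)\prod_{s=1}^d\chi_{n_s}(x_s),$$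 $$I_\mu(g)=\int_{[0,1]^d}S_1(g,x)\,d\mu(x)+\sum_{k=1}^\infty\int_{[0,1]^d}\bigl(S_{2^k}(g,x)-S_{2^{k-1}}(g,x)\bigr)\,d\mu(x).$$ Let $a<b$, $Z=[a,b]$, let $l\ge0$ be an integer, $0<\alpha\le1$, and let $f:Z\times[0,1]^d\to\mathbb R$ be $l+1$ times continuously differentiable on $Z\times[0,1]^d$. Assume that for some constant $C_f$, for all $z\in Z$, $$\Bigl|\frac{\partial^{r+1}f(z,x)}{\partial z\,\partial x_{s_1}\cdots\partial x_{s_r}}\Bigr|\le C_f,\qquad x\in[0,1]^d,\ 0\le r\le l,\ s_1,\dots,s_r\in\{1,\dots,d\},$$ $$\Bigl|\frac{\partial^{l+1}f(z,x^{(1)})}{\partial z\,\partial x_{s_1}\cdots\partial x_{s_l}}-\frac{\partial^{l+1}f(z,x^{(2)})}{\partial z\,\partial x_{s_1}\cdots\partial x_{s_l}}\Bigr|\le C_f\,|x^{(1)}-x^{(2)}|^\alpha,\qquad x^{(1)},x^{(2)}\in[0,1]^d,\ s_1,\dots,s_l\in\{1,\dots,d\}.$$ If $l+\alpha>d/2$,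 let $\tilde\eta(z)=I_\mu(f(z,\cdot))$. Then for each $z\in Z$ the functions $f(z,\cdot)$ and $\frac{\partial f}{\partial z}(z,\cdot)$ are integrable with respect to $\mu$, and $\tilde\eta(z)$ and $I_\mu\bigl(\frac{\partial f}{\partial z}(z,\cdot)\bigr)$ are versions of $\int_{[0,1]^d}f(z,x)\,d\mu(x)$ and $\int_{[0,1]^d}\frac{\partial f}{\partial z}(z,x)\,d\mu(x)$. Moreover, almost surely, simultaneously for all $z\in Z$, the series defining $\tilde\eta(z)$ and $I_\mu\bigl(\frac{\partial f}{\partial z}(z,\cdot)\bigr)$ converge absolutely, the path $\tilde\eta$ is differentiable on $Z$ (one-sidedly at $a$ and $b$) with bounded derivative, and $$\frac{d\tilde\eta(z)}{dz}=\int_{[0,1]^d}\frac{\partial f(z,x)}{\partial z}\,d\mu(x),$$ where the right-hand side is taken in its version $I_\mu\bigl(\frac{\partial f}{\partial z}(z,\cdot)\bigr)$. -/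

import Mathlib

open Set Filter Topology MeasureTheory

/-- The unit cube `[0,1]^d`, with its Borel sigma-algebra inherited from `ℝ^d`. -/
abbrev Cube (d : ℕ) : Type := ↥(Set.Icc (0 : Fin d → ℝ) 1)

/-- A stochastic measure on `X`: a map from the measurable sets to real random variables on
`(Ω, P)` that is sigma-additive in probability, i.e. finitely additive (almost surely, for each
pair of disjoint sets) and continuous in probability at `∅`. For each set `A` the random variable
`μ A` is a fixed version; the values on non-measurable sets carry no information. -/
structure StochasticMeasure (X : Type*) [MeasurableSpace X] {Ω : Type*} [MeasurableSpace Ω]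
    (P : Measure Ω) where
  toFun : Set X → Ω → ℝ
  measurable' : ∀ A, MeasurableSet A → Measurable (toFun A)
  additive' : ∀ A B, MeasurableSet A → MeasurableSet B → Disjoint A B →
    toFun (A ∪ B) =ᵐ[P] fun ω => toFun A ω + toFun B ω
  continuous' : ∀ A : ℕ → Set X, (∀ n, MeasurableSet (A n)) → Antitone A → (⋂ n, A n) = ∅ →
    TendstoInMeasure P (fun n => toFun (A n)) atTop (fun _ => (0 : ℝ))

section Integral

variable {X : Type*} [MeasurableSpace X] {Ω : Type*} [MeasurableSpace Ω] {P : Measure Ω}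

/-- `∫ g dμ` for a simple function `g`: the linear combination `∑_y y μ(g = y)` of the (fixed
versions of the) values of `μ`. -/
noncomputable def StochasticMeasure.simpleIntegral (μ : StochasticMeasure X P)
    (g : SimpleFunc X ℝ) (ω : Ω) : ℝ :=
  ∑ y ∈ g.range, y * μ.toFun (g ⁻¹' {y}) ω

/-- `μ.HasIntegral g Y`: the function `g` is integrable with respect to `μ` and the random variable
`Y` is (a version of) `∫ g dμ`. There are simple functions `gₙ → g` such that `∫_A gₙ dμ` converges
in probability for every measurable set `A`, and the limit for `A = X` is `Y`. -/
def StochasticMeasure.HasIntegral (μ : StochasticMeasure X P) (g : X → ℝ) (Y : Ω → ℝ) : Prop :=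
  ∃ gs : ℕ → SimpleFunc X ℝ,
    (∀ x, Tendsto (fun n => gs n x) atTop (𝓝 (g x))) ∧
    (∀ A, MeasurableSet A → ∃ YA : Ω → ℝ, AEMeasurable YA P ∧
      TendstoInMeasure P (fun n => μ.simpleIntegral ((gs n).restrict A)) atTop YA) ∧
    TendstoInMeasure P (fun n => μ.simpleIntegral (gs n)) atTop Y ∧ AEMeasurable Y P

end Integral

section Haar

/-- Right limit `χₙ(x+)` of the Haar function with number `n = 2^j + i`, `1 ≤ i ≤ 2^j`, or `n = 1`:
for `n ≥ 2` the value is `2^(j/2)` on the left half of the dyadic interval from `(i-1)/2^j`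
to `i/2^j`, it is `-2^(j/2)` on the right half, and `0` elsewhere. -/
noncomputable def haarRight (n : ℕ) (x : ℝ) : ℝ :=
  let j : ℕ := Nat.log 2 (n - 1)
  let i : ℝ := (n : ℝ) - 2 ^ j
  if n = 1 then 1
  else if (i - 1) / 2 ^ j ≤ x ∧ x < (2 * i - 1) / 2 ^ (j + 1) then √(2 ^ j)
  else if (2 * i - 1) / 2 ^ (j + 1) ≤ x ∧ x < i / 2 ^ j then -√(2 ^ j)
  else 0

/-- Left limit `χₙ(x-)` of the Haar function with number `n`. -/
noncomputable def haarLeft (n : ℕ) (x : ℝ) : ℝ :=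
  let j : ℕ := Nat.log 2 (n - 1)
  let i : ℝ := (n : ℝ) - 2 ^ j
  if n = 1 then 1
  else if (i - 1) / 2 ^ j < x ∧ x ≤ (2 * i - 1) / 2 ^ (j + 1) then √(2 ^ j)
  else if (2 * i - 1) / 2 ^ (j + 1) < x ∧ x ≤ i / 2 ^ j then -√(2 ^ j)
  else 0

/-- The Haar function `χₙ` on `[0,1]`, `n ≥ 1`: the mean of its one-sided limits inside `(0,1)`,
and its one-sided limits at `0` and `1`. -/
noncomputable def haar (n : ℕ) (x : ℝ) : ℝ :=
  if x = 0 then haarRight n x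
  else if x = 1 then haarLeft n x
  else (haarLeft n x + haarRight n x) / 2

variable {d : ℕ}

/-- The multivariate Haar function `χ_{n₁}(x₁) ⋯ χ_{n_d}(x_d)`. -/
noncomputable def haarMulti (n : Fin d → ℕ) (x : Fin d → ℝ) : ℝ := ∏ s, haar (n s) (x s)

/-- Fourier-Haar coefficient of `g : [0,1]^d → ℝ`. -/
noncomputable def haarCoeff (n : Fin d → ℕ) (g : (Fin d → ℝ) → ℝ) : ℝ :=
  ∫ x in Set.Icc (0 : Fin d → ℝ) 1, g x * haarMulti n x

/-- The index set `{1, …, 2^k}^d`. -/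
def haarIndex (d k : ℕ) : Finset (Fin d → ℕ) := Fintype.piFinset fun _ => Finset.Icc 1 (2 ^ k)

/-- The Fourier-Haar sum `S_{2^k}(g, x)`. -/
noncomputable def haarSum (k : ℕ) (g : (Fin d → ℝ) → ℝ) (x : Fin d → ℝ) : ℝ :=
  ∑ n ∈ haarIndex d k, haarCoeff n g * haarMulti n x

theorem measurable_haar (n : ℕ) : Measurable (haar n) := by
  have hR : Measurable (haarRight n) := by
    unfold haarRight
    refine Measurable.ite (MeasurableSet.const _) measurable_const ?_
    refine Measurable.ite measurableSet_Ico measurable_const ?_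
    exact Measurable.ite measurableSet_Ico measurable_const measurable_const
  have hL : Measurable (haarLeft n) := by
    unfold haarLeft
    refine Measurable.ite (MeasurableSet.const _) measurable_const ?_
    refine Measurable.ite measurableSet_Ioc measurable_const ?_
    exact Measurable.ite measurableSet_Ioc measurable_const measurable_const
  unfold haar
  refine Measurable.ite (measurableSet_singleton (0 : ℝ)) hR ?_
  exact Measurable.ite (measurableSet_singleton (1 : ℝ)) hL ((hL.add hR).div_const 2)

theorem finite_range_haar (n : ℕ) : (Set.range (haar n)).Finite := by
  have hT : ({1, √(2 ^ Nat.log 2 (n - 1)), -√(2 ^ Nat.log 2 (n - 1)), 0} : Set ℝ).Finite :=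
    Set.toFinite _
  have hR : ∀ x, haarRight n x ∈
      ({1, √(2 ^ Nat.log 2 (n - 1)), -√(2 ^ Nat.log 2 (n - 1)), 0} : Set ℝ) := by
    intro x; unfold haarRight; dsimp only; split_ifs <;> simp
  have hL : ∀ x, haarLeft n x ∈
      ({1, √(2 ^ Nat.log 2 (n - 1)), -√(2 ^ Nat.log 2 (n - 1)), 0} : Set ℝ) := by
    intro x; unfold haarLeft; dsimp only; split_ifs <;> simp
  refine (hT.union (hT.image2 (fun u v => (u + v) / 2) hT)).subset ?_
  rintro _ ⟨x, rfl⟩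
  unfold haar
  split_ifs
  · exact Or.inl (hR x)
  · exact Or.inl (hL x)
  · exact Or.inr ⟨_, hL x, _, hR x, rfl⟩

theorem measurable_haarMulti (n : Fin d → ℕ) : Measurable (haarMulti n) :=
  Finset.measurable_prod _ fun s _ => (measurable_haar (n s)).comp (measurable_pi_apply s)

theorem measurable_haarSum (k : ℕ) (g : (Fin d → ℝ) → ℝ) : Measurable (haarSum k g) :=
  Finset.measurable_sum _ fun n _ => (measurable_haarMulti n).const_mul _

theorem finite_range_haarMulti (n : Fin d → ℕ) : (Set.range (haarMulti n)).Finite := by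
  refine ((Set.Finite.pi fun s => finite_range_haar (n s)).image
    (fun v : Fin d → ℝ => ∏ s, v s)).subset ?_
  rintro _ ⟨x, rfl⟩
  exact ⟨fun s => haar (n s) (x s), fun s _ => ⟨x s, rfl⟩, rfl⟩

theorem finite_range_haarSum (k : ℕ) (g : (Fin d → ℝ) → ℝ) : (Set.range (haarSum k g)).Finite := by
  refine ((Set.Finite.pi fun n : haarIndex d k => finite_range_haarMulti n.1).image
    (fun v : haarIndex d k → ℝ => ∑ n, haarCoeff n.1 g * v n)).subset ?_
  rintro _ ⟨x, rfl⟩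
  refine ⟨fun n => haarMulti n.1 x, fun n _ => ⟨x, rfl⟩, ?_⟩
  exact Finset.sum_coe_sort (haarIndex d k) fun n => haarCoeff n g * haarMulti n x

/-- The Fourier-Haar sum `S_{2^k}(g, ·)` as a simple function on the cube. -/
noncomputable def haarSimple (k : ℕ) (g : (Fin d → ℝ) → ℝ) : SimpleFunc (Cube d) ℝ where
  toFun x := haarSum k g x.1
  measurableSet_fiber' y :=
    ((measurable_haarSum k g).comp measurable_subtype_coe) (measurableSet_singleton y)
  finite_range' := (finite_range_haarSum k g).subset (by rintro _ ⟨x, rfl⟩; exact ⟨x.1, rfl⟩)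

variable {Ω : Type*} [MeasurableSpace Ω] {P : Measure Ω}

/-- `∫ (S_{2^(k+1)}(g, x) - S_{2^k}(g, x)) dμ(x)`, `k ≥ 0`. -/
noncomputable def haarTerm (μ : StochasticMeasure (Cube d) P) (g : (Fin d → ℝ) → ℝ) (k : ℕ)
    (ω : Ω) : ℝ :=
  μ.simpleIntegral (haarSimple (k + 1) g - haarSimple k g) ω

/-- The Fourier-Haar version of the integral `∫ g dμ`: the sum of the series
`∫ S₁(g) dμ + ∑_{k ≥ 1} ∫ (S_{2^k}(g) - S_{2^(k-1)}(g)) dμ`. -/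
noncomputable def haarVersion (μ : StochasticMeasure (Cube d) P) (g : (Fin d → ℝ) → ℝ)
    (ω : Ω) : ℝ :=
  μ.simpleIntegral (haarSimple 0 g) ω + ∑' k : ℕ, haarTerm μ g k ω

end Haar

section Derivatives

variable {d : ℕ}

/-- `∂g/∂x_s` on `[0,1]^d`, one-sided on the faces. -/
noncomputable def partialX (s : Fin d) (g : (Fin d → ℝ) → ℝ) (x : Fin d → ℝ) : ℝ :=
  derivWithin (fun t => g (Function.update x s t)) (Set.Icc 0 1) (x s)

/-- `∂^r g / ∂x_{s₁} ⋯ ∂x_{s_r}` for the list `[s₁, …, s_r]`. -/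
noncomputable def iterPartialX (s : List (Fin d)) (g : (Fin d → ℝ) → ℝ) : (Fin d → ℝ) → ℝ :=
  s.foldr partialX g

/-- `∂f/∂z` on `[a,b] × [0,1]^d`, one-sided for `z = a` and `z = b`. -/
noncomputable def partialZ (a b : ℝ) (f : ℝ → (Fin d → ℝ) → ℝ) (z : ℝ) (x : Fin d → ℝ) : ℝ :=
  derivWithin (fun t => f t x) (Set.Icc a b) z

end Derivatives

/-!
The proof rests on two facts, one about stochastic measures and one about Haar sums.

*Square summability.* Let `φ j` be countably many simple functions such that `∑ |φ j|` is bounded.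
Then almost surely `∑ (∫ φ j dμ) ^ 2 < ∞` (`ae_summable_sq_simpleIntegral`). This needs that the
values of `μ` are bounded in probability (`exists_measureReal_toFun_le`): if they were not, there
would be finer and finer finite partitions with many cells of large measure, and a random choice of
few of these cells at each stage would produce disjoint sets whose measures do not tend to zero.
Inequalities of Paley-Zygmund type for random signs then give, first, that the integrals of
uniformly bounded simple functions are bounded in probability (`measureReal_weighted_sum_le`) and,
second, the bound for the square function (`measureReal_sum_sq_le`).

*Haar sums.* The sum `S_{2^k}(g, x)` is an average of `g` over dyadic boxes at distance at most
`2 ^ (-k)` from `x` (`haarSum_eq_integral`). It is constant on the cells of level `k`, which are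
products of dyadic points and open dyadic intervals. A function of Hölder smoothness `β = l + α` is
near each point a polynomial of degree `l` up to an error of order `β`
(`HolderClass.isPolyApprox`). Telescoping the polynomials that belong to the cells of levels
`m ≤ k`, the increment `S_{2^(k+1)}(g) - S_{2^k}(g)` becomes a combination of increments for
Lagrange polynomials localized to cells of level `m`, with coefficients of order `2 ^ (-m β)`, and
of indicators of cells of level `k + 1`, with coefficients of order `2 ^ (-k β)`
(`exists_haarSum_decomposition`). The localized increments are of order `2 ^ (m - k)`, and at each
point only one cell of each level contributes, so with suitable geometric weights these countably
many functions, which do not depend on `g`, satisfy the hypothesis of square summability. There are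
about `2 ^ (m d)` cells of level `m`, and the Cauchy-Schwarz inequality yields, because of
`β > d / 2`, one almost surely summable sequence that dominates the terms of the Haar series of all
functions in the class (`ae_exists_haarTerm_le`).

Applied to `μ` and to its restrictions `A ↦ μ (A ∩ B)`, this gives integrability and identifies the
sum of the Haar series with the integral (`hasIntegral_haarVersion`). Each term of the series is a
bounded linear functional of the integrand with respect to the uniform norm, so it can be
differentiated in the parameter; the derivatives `∂f/∂z` belong to one smoothness class for all
`z`, hence the differentiated series is dominated and the series may be differentiated term by term
(`hasDerivWithinAt_tsum_of_convex`).
-/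


/-! ### Finite additivity and simple integrals -/

namespace StochasticMeasure

variable {X : Type*} [MeasurableSpace X] {Ω : Type*} [MeasurableSpace Ω] {P : Measure Ω}

theorem toFun_empty (μ : StochasticMeasure X P) : μ.toFun ∅ =ᵐ[P] 0 := by
  filter_upwards [μ.additive' ∅ ∅ .empty .empty (disjoint_empty _)] with ω hω
  simpa using hω

theorem toFun_preimage_finset (μ : StochasticMeasure X P) {ι : Type*} (c : X → ι)
    (hc : ∀ i, MeasurableSet (c ⁻¹' {i})) (T : Finset ι) :
    MeasurableSet (c ⁻¹' (T : Set ι)) ∧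
      μ.toFun (c ⁻¹' (T : Set ι)) =ᵐ[P] fun ω => ∑ i ∈ T, μ.toFun (c ⁻¹' {i}) ω := by
  classical
  induction T using Finset.induction_on with
  | empty => simpa [EventuallyEq] using μ.toFun_empty
  | insert i T hi ih =>
    have hset : c ⁻¹' ((insert i T : Finset ι) : Set ι) = c ⁻¹' {i} ∪ c ⁻¹' (T : Set ι) := by
      ext x; simp
    refine ⟨hset ▸ (hc i).union ih.1, ?_⟩
    rw [hset]
    have hd : Disjoint (c ⁻¹' {i}) (c ⁻¹' (T : Set ι)) := by
      refine Disjoint.preimage _ ?_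
      simpa using hi
    filter_upwards [μ.additive' _ _ (hc i) ih.1 hd, ih.2] with ω h1 h2
    rw [h1, h2, Finset.sum_insert hi]

/-- Outside one null set, simultaneously for all simple functions that are constant on the cells
of a given finite partition, the simple integral is the sum of the values on the cells weighted
with the measures of the cells. -/
theorem ae_simpleIntegral_eq_sum (μ : StochasticMeasure X P) {ι : Type*} [Fintype ι] (c : X → ι)
    (hc : ∀ i, MeasurableSet (c ⁻¹' {i})) :
    ∀ᵐ ω ∂P, ∀ (h : SimpleFunc X ℝ) (v : ι → ℝ), (∀ x, h x = v (c x)) →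
      μ.simpleIntegral h ω = ∑ i, v i * μ.toFun (c ⁻¹' {i}) ω := by
  classical
  have key : ∀ᵐ ω ∂P, ∀ T : Finset ι,
      μ.toFun (c ⁻¹' (T : Set ι)) ω = ∑ i ∈ T, μ.toFun (c ⁻¹' {i}) ω :=
    ae_all_iff.2 fun T => (μ.toFun_preimage_finset c hc T).2
  filter_upwards [key] with ω hω h v hv
  have hempty : μ.toFun ∅ ω = 0 := by simpa using hω ∅
  have hpre : ∀ y, h ⁻¹' {y} = c ⁻¹' ((Finset.univ.filter fun i => v i = y : Finset ι) : Set ι) := by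
    intro y; ext x; simp [hv]
  unfold simpleIntegral
  have h1 : ∀ y ∈ h.range, y * μ.toFun (h ⁻¹' {y}) ω =
      ∑ i, if v i = y then v i * μ.toFun (c ⁻¹' {i}) ω else 0 := by
    intro y _
    rw [hpre, hω, Finset.sum_filter, Finset.mul_sum]
    refine Finset.sum_congr rfl fun i _ => ?_
    split_ifs with h
    · rw [h]
    · simp
  rw [Finset.sum_congr rfl h1, Finset.sum_comm]
  refine Finset.sum_congr rfl fun i _ => ?_
  rw [Finset.sum_ite_eq]
  split_ifs with hi
  · rfl
  · -- a value that is not attained belongs to an empty cell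
    have : c ⁻¹' {i} = ∅ := by
      ext x
      simp only [mem_preimage, mem_singleton_iff, mem_empty_iff_false, iff_false]
      intro hx
      apply hi
      rw [SimpleFunc.mem_range]
      exact ⟨x, by rw [hv, hx]⟩
    rw [this, hempty, mul_zero]

theorem measurable_simpleIntegral (μ : StochasticMeasure X P) (h : SimpleFunc X ℝ) :
    Measurable (μ.simpleIntegral h) := by
  unfold simpleIntegral
  exact Finset.measurable_sum _ fun y _ =>
    (μ.measurable' _ (h.measurableSet_fiber y)).const_mul y

/-- Linearity of the simple integral, outside one null set for all coefficients. -/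
theorem ae_simpleIntegral_linear (μ : StochasticMeasure X P) {J : Type*} [Fintype J]
    (φ : J → SimpleFunc X ℝ) :
    ∀ᵐ ω ∂P, ∀ (h : SimpleFunc X ℝ) (a : J → ℝ), (∀ x, h x = ∑ j, a j * φ j x) →
      μ.simpleIntegral h ω = ∑ j, a j * μ.simpleIntegral (φ j) ω := by
  classical
  let c : X → ((j : J) → (φ j).range) := fun x j => ⟨φ j x, (φ j).mem_range_self x⟩
  have hc : ∀ i, MeasurableSet (c ⁻¹' {i}) := by
    intro i
    have : c ⁻¹' {i} = ⋂ j, φ j ⁻¹' {(i j : ℝ)} := by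
      ext x
      simp only [mem_preimage, mem_singleton_iff, mem_iInter, c, funext_iff, Subtype.ext_iff]
    rw [this]
    exact MeasurableSet.iInter fun j => (φ j).measurableSet_fiber _
  filter_upwards [μ.ae_simpleIntegral_eq_sum c hc] with ω hω h a ha
  rw [hω h (fun i => ∑ j, a j * (i j : ℝ)) ha]
  have : ∀ j, μ.simpleIntegral (φ j) ω = ∑ i : (j : J) → (φ j).range,
      (i j : ℝ) * μ.toFun (c ⁻¹' {i}) ω := fun j => hω (φ j) (fun i => (i j : ℝ)) fun x => rfl
  simp_rw [this, Finset.mul_sum, Finset.sum_mul]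
  rw [Finset.sum_comm]
  simp_rw [mul_assoc]

/-- The stochastic measure `B ↦ μ (B ∩ A)`. -/
noncomputable def restrictTo (μ : StochasticMeasure X P) (A : Set X) (hA : MeasurableSet A) :
    StochasticMeasure X P where
  toFun B := μ.toFun (B ∩ A)
  measurable' B hB := μ.measurable' _ (hB.inter hA)
  additive' B C hB hC hd := by
    rw [union_inter_distrib_right]
    exact μ.additive' _ _ (hB.inter hA) (hC.inter hA)
      (hd.mono inter_subset_left inter_subset_left)
  continuous' B hB hm hi := by
    refine μ.continuous' (fun n => B n ∩ A) (fun n => (hB n).inter hA)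
      (fun m n h => inter_subset_inter_left _ (hm h)) ?_
    rw [← iInter_inter, hi, empty_inter]

theorem simpleIntegral_restrict (μ : StochasticMeasure X P) {A : Set X} (hA : MeasurableSet A)
    (h : SimpleFunc X ℝ) :
    μ.simpleIntegral (h.restrict A) =ᵐ[P] (μ.restrictTo A hA).simpleIntegral h := by
  classical
  filter_upwards [μ.toFun_empty] with ω h0
  have hpre : ∀ y : ℝ, y ≠ 0 → (h.restrict A) ⁻¹' {y} = h ⁻¹' {y} ∩ A := by
    intro y hy
    rw [SimpleFunc.restrict_preimage_singleton _ hA hy, inter_comm]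
  have hout : ∀ (g : SimpleFunc X ℝ) (y : ℝ), y ∉ g.range → g ⁻¹' {y} = ∅ := by
    intro g y hy
    rwa [SimpleFunc.preimage_eq_empty_iff]
  unfold simpleIntegral restrictTo
  rw [Finset.sum_subset (Finset.subset_union_left (s₂ := h.range)),
    Finset.sum_subset (Finset.subset_union_right (s₁ := (h.restrict A).range) (s₂ := h.range))
      (f := fun y => y * μ.toFun (h ⁻¹' {y} ∩ A) ω)]
  · refine Finset.sum_congr rfl fun y _ => ?_
    rcases eq_or_ne y 0 with rfl | hy
    · simp
    · rw [hpre y hy]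
  · intro y _ hy
    rw [hout _ y hy, empty_inter, h0, Pi.zero_apply, mul_zero]
  · intro y _ hy
    rw [hout _ y hy, h0, Pi.zero_apply, mul_zero]

/-- The values of a stochastic measure on disjoint sets tend to zero in probability. -/
theorem tendsto_of_disjoint (μ : StochasticMeasure X P) (H : ℕ → Set X)
    (hH : ∀ n, MeasurableSet (H n)) (hd : Pairwise (Function.onFun Disjoint H)) :
    TendstoInMeasure P (fun n => μ.toFun (H n)) atTop (fun _ => (0 : ℝ)) := by
  have hTm : ∀ n, MeasurableSet (⋃ m ≥ n, H m) := fun n =>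
    MeasurableSet.iUnion fun m => MeasurableSet.iUnion fun _ => hH m
  have hT : TendstoInMeasure P (fun n => μ.toFun (⋃ m ≥ n, H m)) atTop (fun _ => (0 : ℝ)) := by
    refine μ.continuous' _ hTm ?_ ?_
    · intro a b hab
      exact iUnion₂_subset fun m hm =>
        subset_iUnion₂ (s := fun m (_ : m ≥ a) => H m) m (hab.trans hm)
    · ext x
      simp only [mem_iInter, mem_iUnion, mem_empty_iff_false, iff_false, not_forall]
      by_contra! hx
      obtain ⟨m, _, hm⟩ := hx 0
      obtain ⟨m', h', hm'⟩ := hx (m + 1)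
      exact disjoint_left.1 (hd (show m ≠ m' by omega)) hm hm'
  rw [tendstoInMeasure_iff_norm] at hT ⊢
  intro ε hε
  have h1 := hT (ε / 2) (by positivity)
  have h2 := h1.add (h1.comp (tendsto_add_atTop_nat 1))
  rw [add_zero] at h2
  refine tendsto_of_tendsto_of_tendsto_of_le_of_le tendsto_const_nhds h2 (fun _ => zero_le) ?_
  intro n
  refine le_trans (measure_mono_ae ?_) (measure_union_le _ _)
  have hset : (⋃ m ≥ n, H m) = H n ∪ ⋃ m ≥ n + 1, H m := by
    ext x
    simp only [mem_iUnion, mem_union, exists_prop]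
    constructor
    · rintro ⟨m, hm, hx⟩
      rcases eq_or_lt_of_le hm with rfl | hlt
      · exact Or.inl hx
      · exact Or.inr ⟨m, hlt, hx⟩
    · rintro (hx | ⟨m, hm, hx⟩)
      · exact ⟨n, le_rfl, hx⟩
      · exact ⟨m, by omega, hx⟩
  have hdisj : Disjoint (H n) (⋃ m ≥ n + 1, H m) := by
    simp only [disjoint_iUnion_right]
    intro m hm
    exact hd (by omega)
  filter_upwards [μ.additive' _ _ (hH n) (hTm (n + 1)) hdisj] with ω hω hle
  rw [← hset] at hω
  by_contra hnot
  obtain ⟨ha, hb⟩ := not_or.1 hnot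
  replace ha : ¬ ε / 2 ≤ ‖μ.toFun (⋃ m ≥ n, H m) ω - 0‖ := ha
  replace hb : ¬ ε / 2 ≤ ‖μ.toFun (⋃ m ≥ n + 1, H m) ω - 0‖ := hb
  replace hle : ε ≤ ‖μ.toFun (H n) ω - 0‖ := hle
  simp only [sub_zero, Real.norm_eq_abs, le_abs, not_or, not_le] at ha hb hle
  rcases hle with h | h <;> linarith

end StochasticMeasure

/-! ### Partitions with many large cells -/

namespace StochasticMeasure

theorem exists_measureReal_lt {Ω : Type*} [MeasurableSpace Ω] {P : Measure Ω}
    [IsProbabilityMeasure P] {Y : Ω → ℝ} (hY : Measurable Y) {ε : ℝ} (hε : 0 < ε) :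
    ∃ s : ℝ, 0 ≤ s ∧ P.real {ω | s < Y ω} < ε := by
  have h := tendsto_measure_iInter_atTop (μ := P) (s := fun n : ℕ => {ω | (n : ℝ) < Y ω})
    (fun n => (measurableSet_lt measurable_const hY).nullMeasurableSet)
    (fun m n hmn ω (hω : (n : ℝ) < Y ω) => lt_of_le_of_lt (by exact_mod_cast hmn) hω)
    ⟨0, measure_ne_top _ _⟩
  have hempty : ⋂ n : ℕ, {ω | (n : ℝ) < Y ω} = ∅ := by
    ext ω
    simp only [mem_iInter, mem_ofPred_eq, mem_empty_iff_false, iff_false, not_forall, not_lt]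
    exact exists_nat_ge (Y ω)
  rw [hempty, measure_empty] at h
  have h' := (ENNReal.tendsto_toReal ENNReal.zero_ne_top).comp h
  obtain ⟨n, hn⟩ := (h'.eventually (gt_mem_nhds (by simpa using hε))).exists
  exact ⟨n, n.cast_nonneg, hn⟩

/-- If every cell `i` is split in two cells whose values add up to `y i`, then, up to halving the
threshold, no large cell is lost, and one is gained when the values on the halves `(i, true)` have
a sum that is too large compared with the values `y i`. -/
theorem card_filter_split {ι : Type*} [Fintype ι] (x : ι × Bool → ℝ) {s T : ℝ} (hs : 0 ≤ s)
    (hT : 0 ≤ T) (q : Prop) [Decidable q] (hq : q → ∑ i, |x (i, true) + x (i, false)| ≤ s ∧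
      Fintype.card ι * (s + 2 * T) < |∑ i, x (i, true)|) :
    (Finset.univ.filter fun i => 2 * T < |x (i, true) + x (i, false)|).card +
      (if q then 1 else 0) ≤ (Finset.univ.filter fun p => T < |x p|).card := by
  classical
  rw [Finset.card_filter, Finset.card_filter, Fintype.sum_prod_type]
  simp only [Fintype.sum_bool]
  have hle : ∀ i, (if 2 * T < |x (i, true) + x (i, false)| then 1 else 0) ≤
      (if T < |x (i, true)| then 1 else 0) + (if T < |x (i, false)| then 1 else 0) := by
    intro i
    have := abs_add_le (x (i, true)) (x (i, false))
    split_ifs <;> first | omega | (exfalso; linarith)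
  split_ifs with h
  · obtain ⟨h1, h2⟩ := hq h
    have h3 : ∑ _i : ι, (s + 2 * T) < ∑ i, |x (i, true)| := by
      rw [Finset.sum_const, Finset.card_univ, nsmul_eq_mul]
      exact h2.trans_le (Finset.abs_sum_le_sum_abs _ _)
    obtain ⟨i, -, hi⟩ := Finset.exists_lt_of_sum_lt h3
    have h4 : |x (i, true) + x (i, false)| ≤ s :=
      (Finset.single_le_sum (f := fun i => |x (i, true) + x (i, false)|)
        (fun _ _ => abs_nonneg _) (Finset.mem_univ i)).trans h1
    refine Nat.succ_le_of_lt (Finset.sum_lt_sum (fun i _ => hle i) ⟨i, Finset.mem_univ i, ?_⟩)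
    have h5 := abs_sub_abs_le_abs_sub (x (i, true)) (x (i, true) + x (i, false))
    have h6 : |x (i, true) - (x (i, true) + x (i, false))| = |x (i, false)| := by
      rw [← abs_neg]; congr 1; ring
    rw [h6] at h5
    have h7 := abs_nonneg (x (i, true) + x (i, false))
    rw [if_pos (show T < |x (i, true)| by linarith), if_pos (show T < |x (i, false)| by linarith)]
    split_ifs <;> norm_num
  · simpa using Finset.sum_le_sum fun i _ => hle i

variable {X : Type*} [MeasurableSpace X] {Ω : Type*} [MeasurableSpace Ω] {P : Measure Ω}

open Classical in
/-- The number of cells `i` of the partition `c` with `|μ (c = i)| > T`. -/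
noncomputable def largeCells (μ : StochasticMeasure X P) {ι : Type*} [Fintype ι] (c : X → ι)
    (T : ℝ) (ω : Ω) : ℕ :=
  (Finset.univ.filter fun i => T < |μ.toFun (c ⁻¹' {i}) ω|).card

theorem measurable_largeCells (μ : StochasticMeasure X P) {ι : Type*} [Fintype ι] (c : X → ι)
    (hc : ∀ i, MeasurableSet (c ⁻¹' {i})) (T : ℝ) : Measurable (μ.largeCells c T) := by
  classical
  unfold largeCells
  simp_rw [Finset.card_filter]
  exact Finset.measurable_sum _ fun i _ => Measurable.ite
    (measurableSet_lt measurable_const (μ.measurable' _ (hc i)).abs) measurable_const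
    measurable_const

variable [IsProbabilityMeasure P]

/-- One refinement step for a stochastic measure with unbounded range: with probability at least
`δ / 2`, a suitable further cut increases the number of large cells. -/
theorem exists_cut (μ : StochasticMeasure X P) {δ : ℝ} (hδ : 0 < δ)
    (hunb : ∀ t : ℝ, ∃ B, MeasurableSet B ∧ δ < P.real {ω | t < |μ.toFun B ω|})
    {ι : Type} [Fintype ι] (c : X → ι) (hc : ∀ i, MeasurableSet (c ⁻¹' {i})) {T : ℝ} (hT : 0 ≤ T) :
    ∃ c' : X → ι × Bool, (∀ i, MeasurableSet (c' ⁻¹' {i})) ∧ (∀ x, (c' x).1 = c x) ∧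
      ∃ F : Set Ω, MeasurableSet F ∧ δ / 2 ≤ P.real F ∧
        ∀ᵐ ω ∂P, (μ.largeCells c (2 * T) ω : ℝ) + F.indicator 1 ω ≤ μ.largeCells c' T ω := by
  classical
  have hYm : Measurable fun ω => ∑ i, |μ.toFun (c ⁻¹' {i}) ω| :=
    Finset.measurable_sum _ fun i _ => (μ.measurable' _ (hc i)).abs
  obtain ⟨s, hs, hsP⟩ := exists_measureReal_lt (P := P) hYm (half_pos hδ)
  -- `s` bounds the values on the present cells, so a set with a value above `card * (s + 2 * T)`
  -- cuts some cell into two large parts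
  obtain ⟨B, hB, hBP⟩ := hunb (Fintype.card ι * (s + 2 * T))
  let c' : X → ι × Bool := fun x => (c x, decide (x ∈ B))
  have e1 : ∀ i, c' ⁻¹' {(i, true)} = c ⁻¹' {i} ∩ B := by intro i; ext x; simp [c']
  have e2 : ∀ i, c' ⁻¹' {(i, false)} = c ⁻¹' {i} \ B := by intro i; ext x; simp [c']
  have hc' : ∀ i, MeasurableSet (c' ⁻¹' {i}) := by
    rintro ⟨i, _ | _⟩
    · rw [e2]; exact (hc i).diff hB
    · rw [e1]; exact (hc i).inter hB
  have hF1 : MeasurableSet {ω | Fintype.card ι * (s + 2 * T) < |μ.toFun B ω|} :=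
    measurableSet_lt measurable_const (μ.measurable' _ hB).abs
  have hF2 : MeasurableSet {ω | s < ∑ i, |μ.toFun (c ⁻¹' {i}) ω|} :=
    measurableSet_lt measurable_const hYm
  refine ⟨c', hc', fun x => rfl, _, hF1.diff hF2, ?_, ?_⟩
  · have h1 := measureReal_mono (μ := P) (show {ω | Fintype.card ι * (s + 2 * T) < |μ.toFun B ω|} ⊆
      ({ω | Fintype.card ι * (s + 2 * T) < |μ.toFun B ω|} \
        {ω | s < ∑ i, |μ.toFun (c ⁻¹' {i}) ω|}) ∪ {ω | s < ∑ i, |μ.toFun (c ⁻¹' {i}) ω|} by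
        intro ω hω
        by_cases h : ω ∈ {ω | s < ∑ i, |μ.toFun (c ⁻¹' {i}) ω|}
        · exact Or.inr h
        · exact Or.inl ⟨hω, h⟩)
    have h2 := measureReal_union_le (μ := P) ({ω | Fintype.card ι * (s + 2 * T) < |μ.toFun B ω|} \
        {ω | s < ∑ i, |μ.toFun (c ⁻¹' {i}) ω|}) {ω | s < ∑ i, |μ.toFun (c ⁻¹' {i}) ω|}
    linarith
  · have a1 : ∀ᵐ ω ∂P, ∀ i, μ.toFun (c ⁻¹' {i}) ω =
        μ.toFun (c' ⁻¹' {(i, true)}) ω + μ.toFun (c' ⁻¹' {(i, false)}) ω := by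
      refine ae_all_iff.2 fun i => ?_
      have := μ.additive' _ _ (hc' (i, true)) (hc' (i, false))
        (by rw [e1, e2]; exact disjoint_sdiff_right.mono_left inter_subset_right)
      rwa [e1, e2, inter_union_sdiff, ← e1, ← e2] at this
    have a2 := (μ.toFun_preimage_finset c' hc' (Finset.univ.filter fun p => p.2 = true)).2
    have hBe : c' ⁻¹' ((Finset.univ.filter fun p : ι × Bool => p.2 = true : Finset _) :
        Set (ι × Bool)) = B := by ext x; simp [c']
    rw [hBe] at a2
    filter_upwards [a1, a2] with ω h1 h2
    have h2' : μ.toFun B ω = ∑ i, μ.toFun (c' ⁻¹' {(i, true)}) ω := by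
      rw [h2, Finset.sum_filter, Fintype.sum_prod_type]
      simp
    have := card_filter_split (fun p => μ.toFun (c' ⁻¹' {p}) ω) (s := s) (T := T) hs hT
      (ω ∈ {ω | Fintype.card ι * (s + 2 * T) < |μ.toFun B ω|} \
        {ω | s < ∑ i, |μ.toFun (c ⁻¹' {i}) ω|}) (by
        rintro ⟨ha, hb⟩
        simp only [mem_ofPred_eq, not_lt] at ha hb
        simp_rw [← h1, ← h2']
        exact ⟨hb, ha⟩)
    simp_rw [← h1] at this
    unfold largeCells
    rw [indicator_apply, Pi.one_apply]
    have h3 := (Nat.cast_le (α := ℝ)).2 this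
    rw [Nat.cast_add, Nat.cast_ite, Nat.cast_one, Nat.cast_zero] at h3
    convert h3

/-- Iteration of `exists_cut`: a lower bound `Φ ≤ m` for the number of large cells has mean at least
`m * δ / 2`. As a cut may halve the values, the earlier cuts use twice the threshold. -/
theorem exists_refinement (μ : StochasticMeasure X P) {δ : ℝ} (hδ : 0 < δ)
    (hunb : ∀ t : ℝ, ∃ B, MeasurableSet B ∧ δ < P.real {ω | t < |μ.toFun B ω|}) (m : ℕ) :
    ∀ (T : ℝ), 0 ≤ T → ∀ (ι : Type) [Fintype ι] (c : X → ι),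
      (∀ i, MeasurableSet (c ⁻¹' {i})) →
      ∃ (ι' : Type) (_ : Fintype ι') (c' : X → ι') (π : ι' → ι),
        (∀ i, MeasurableSet (c' ⁻¹' {i})) ∧ (∀ x, π (c' x) = c x) ∧
        ∃ Φ : Ω → ℝ, Measurable Φ ∧ (∀ ω, 0 ≤ Φ ω ∧ Φ ω ≤ m) ∧ m * (δ / 2) ≤ ∫ ω, Φ ω ∂P ∧
          ∀ᵐ ω ∂P, Φ ω ≤ μ.largeCells c' T ω := by
  induction m with
  | zero =>
    intro T hT ι _ c hc
    exact ⟨ι, inferInstance, c, id, hc, fun x => rfl, fun _ => 0, measurable_const,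
      fun _ => by simp, by simp, ae_of_all _ fun ω => Nat.cast_nonneg _⟩
  | succ m ih =>
    intro T hT ι _ c hc
    obtain ⟨ι', _, c', π, hc', hπ, Φ, hΦm, hΦb, hΦi, hΦ⟩ := ih (2 * T) (by positivity) ι c hc
    obtain ⟨c'', hc'', hfst, F, hF, hFP, hFc⟩ := μ.exists_cut hδ hunb c' hc' hT
    refine ⟨ι' × Bool, inferInstance, c'', fun p => π p.1, hc'', fun x => by simp only [hfst, hπ],
      fun ω => Φ ω + F.indicator 1 ω, hΦm.add (measurable_one.indicator hF), fun ω => ?_, ?_, ?_⟩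
    · have h1 : 0 ≤ F.indicator (1 : Ω → ℝ) ω := indicator_nonneg (fun _ _ => zero_le_one) _
      have h2 : F.indicator (1 : Ω → ℝ) ω ≤ 1 := indicator_le_self' (fun _ _ => zero_le_one) ω
      have := hΦb ω
      push_cast
      constructor <;> linarith
    · have hi : Integrable Φ P := Integrable.of_bound hΦm.aestronglyMeasurable m
        (ae_of_all _ fun ω => by
          rw [Real.norm_eq_abs, abs_of_nonneg (hΦb ω).1]; exact (hΦb ω).2)
      have hi' : Integrable (fun ω => F.indicator (1 : Ω → ℝ) ω) P :=
        (integrable_const (1 : ℝ)).indicator hF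
      show _ ≤ ∫ ω, (Φ ω + F.indicator 1 ω) ∂P
      rw [integral_add hi hi', integral_indicator_one hF]
      push_cast
      linarith
    · filter_upwards [hΦ, hFc] with ω h1 h2
      linarith

/-- A stochastic measure with unbounded range has finite partitions that, with a probability
bounded away from zero, have arbitrarily many large cells. -/
theorem exists_refinement_largeCells (μ : StochasticMeasure X P) {δ : ℝ} (hδ : 0 < δ)
    (hunb : ∀ t : ℝ, ∃ B, MeasurableSet B ∧ δ < P.real {ω | t < |μ.toFun B ω|}) (K : ℕ) {T : ℝ}
    (hT : 0 ≤ T) (ι : Type) [Fintype ι] (c : X → ι) (hc : ∀ i, MeasurableSet (c ⁻¹' {i})) :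
    ∃ (ι' : Type) (_ : Fintype ι') (c' : X → ι') (π : ι' → ι),
      (∀ i, MeasurableSet (c' ⁻¹' {i})) ∧ (∀ x, π (c' x) = c x) ∧
      δ / 4 ≤ P.real {ω | K ≤ μ.largeCells c' T ω} := by
  -- the count has mean at least `m * δ / 2` and is at most `m`, so it exceeds `K ≤ m * δ / 4`
  -- with probability at least `δ / 4`
  obtain ⟨m, hm⟩ := exists_nat_gt (4 * K / δ)
  have hm0 : (0 : ℝ) < m := lt_of_le_of_lt (by positivity) hm
  have hKm : (K : ℝ) ≤ m * (δ / 4) := by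
    rw [div_lt_iff₀ hδ] at hm; linarith
  obtain ⟨ι', _, c', π, hc', hπ, Φ, hΦm, hΦb, hΦi, hΦ⟩ := μ.exists_refinement hδ hunb m T hT ι c hc
  refine ⟨ι', inferInstance, c', π, hc', hπ, ?_⟩
  have hE : MeasurableSet {ω | K ≤ μ.largeCells c' T ω} :=
    measurableSet_le measurable_const (μ.measurable_largeCells c' hc' T)
  have hi : Integrable Φ P := Integrable.of_bound hΦm.aestronglyMeasurable m
    (ae_of_all _ fun ω => by rw [Real.norm_eq_abs, abs_of_nonneg (hΦb ω).1]; exact (hΦb ω).2)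
  have hi' : Integrable (fun ω => {ω | K ≤ μ.largeCells c' T ω}.indicator (1 : Ω → ℝ) ω) P :=
    (integrable_const (1 : ℝ)).indicator hE
  have hle : ∫ ω, Φ ω ∂P ≤
      ∫ ω, ((K : ℝ) + m * {ω | K ≤ μ.largeCells c' T ω}.indicator 1 ω) ∂P := by
    refine integral_mono_ae hi ((integrable_const _).add (hi'.const_mul _)) ?_
    filter_upwards [hΦ] with ω hω
    by_cases h : ω ∈ {ω | K ≤ μ.largeCells c' T ω}
    · simp only [h, indicator_of_mem, Pi.one_apply, mul_one]
      have := (hΦb ω).2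
      have : (0 : ℝ) ≤ K := Nat.cast_nonneg _
      linarith
    · simp only [h, not_false_eq_true, indicator_of_notMem, mul_zero, add_zero]
      have h' : μ.largeCells c' T ω ≤ K := (not_le.1 h).le
      exact hω.trans (by exact_mod_cast h')
  rw [integral_add (integrable_const _) (hi'.const_mul _), integral_const_mul,
    integral_indicator_one hE, integral_const] at hle
  simp only [probReal_univ, smul_eq_mul, one_mul] at hle
  have : m * (δ / 4) ≤ m * P.real {ω | K ≤ μ.largeCells c' T ω} := by linarith
  exact le_of_mul_le_mul_left this hm0

/-- A refining sequence of partitions with prescribed numbers of large cells. -/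
theorem exists_partitions (μ : StochasticMeasure X P) {δ : ℝ} (hδ : 0 < δ)
    (hunb : ∀ t : ℝ, ∃ B, MeasurableSet B ∧ δ < P.real {ω | t < |μ.toFun B ω|}) (K : ℕ → ℕ)
    {T : ℝ} (hT : 0 ≤ T) :
    ∃ (ι : ℕ → Type) (_ : ∀ n, Fintype (ι n)) (c : ∀ n, X → ι n),
      (∀ n i, MeasurableSet (c n ⁻¹' {i})) ∧
      (∀ m n, m < n → ∃ π : ι n → ι m, ∀ x, π (c n x) = c m x) ∧
      ∀ n, δ / 4 ≤ P.real {ω | K n ≤ μ.largeCells (c n) T ω} := by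
  let S := Σ' (ι : Type) (_ : Fintype ι), {c : X → ι // ∀ i, MeasurableSet (c ⁻¹' {i})}
  have step : ∀ (n : ℕ) (s : S), ∃ s' : S, (∃ π : s'.1 → s.1, ∀ x, π (s'.2.2.1 x) = s.2.2.1 x) ∧
      δ / 4 ≤ P.real {ω | K n ≤ @largeCells _ _ _ _ _ μ s'.1 s'.2.1 s'.2.2.1 T ω} := by
    rintro n ⟨ι, _, c, hc⟩
    obtain ⟨ι', h', c', π, hc', hπ, hP⟩ := μ.exists_refinement_largeCells hδ hunb (K n) hT ι c hc
    exact ⟨⟨ι', h', c', hc'⟩, ⟨π, hπ⟩, hP⟩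
  choose next hnext hP using step
  let g : ℕ → S := fun n => Nat.rec ⟨Unit, inferInstance, fun _ => (), fun _ =>
      measurable_const (measurableSet_singleton _)⟩
    (fun n s => next n s) n
  have hg : ∀ n, g (n + 1) = next n (g n) := fun n => rfl
  have hπ : ∀ m k, ∃ π : (g (m + k)).1 → (g m).1, ∀ x, π ((g (m + k)).2.2.1 x) = (g m).2.2.1 x := by
    intro m k
    induction k with
    | zero => exact ⟨id, fun x => rfl⟩
    | succ k ih =>
      obtain ⟨π, hπ⟩ := ih
      obtain ⟨π', hπ'⟩ := hnext (m + k) (g (m + k))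
      exact ⟨fun i => π (π' i), fun x => by rw [← hπ, ← hπ']; rfl⟩
  refine ⟨fun n => (g (n + 1)).1, fun n => (g (n + 1)).2.1, fun n => (g (n + 1)).2.2.1,
    fun n => (g (n + 1)).2.2.2, fun m n hmn => ?_, fun n => hP n (g n)⟩
  obtain ⟨k, rfl⟩ := Nat.exists_eq_add_of_lt hmn
  have := hπ (m + 1) (k + 1)
  rwa [show m + 1 + (k + 1) = m + k + 1 + 1 by ring] at this

end StochasticMeasure

section

open ProbabilityTheory

/-! ### Random selection of cells -/

section Selection

/-- The law on `{-1, 0, 1}` that gives mass `η` to each of `1` and `-1`. -/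
noncomputable def signLaw (η : ENNReal) : Measure ℤ :=
  (1 - 2 * η) • Measure.dirac 0 + η • (Measure.dirac 1 + Measure.dirac (-1))

theorem isProbabilityMeasure_signLaw {η : ENNReal} (hη : 2 * η ≤ 1) :
    IsProbabilityMeasure (signLaw η) := by
  constructor
  simp only [signLaw, Measure.coe_add, Measure.coe_smul, Pi.add_apply, Pi.smul_apply,
    measure_univ, smul_eq_mul, mul_one]
  rw [show η * (1 + 1) = 2 * η by ring, tsub_add_cancel_of_le hη]

theorem signLaw_map_neg (η : ENNReal) : (signLaw η).map (fun v => -v) = signLaw η := by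
  have hm : Measurable fun v : ℤ => -v := measurable_neg
  simp only [signLaw, Measure.map_add _ _ hm, Measure.map_smul, Measure.map_dirac, neg_zero,
    neg_neg]
  rw [add_comm (Measure.dirac (-1))]

theorem signLaw_one (η : ENNReal) : signLaw η {1} = η := by
  simp [signLaw]

theorem signLaw_zero (η : ENNReal) : signLaw η {1, -1}ᶜ = 1 - 2 * η := by
  simp [signLaw]

/-- If a measure preserving map `φ` preserves `D` and moves every point of `D \ A` to `A`, then
`A` fills at least half of `D`. -/
theorem measure_le_two_mul_of_flip {Ξ : Type*} [MeasurableSpace Ξ] {ρ : Measure Ξ} {φ : Ξ → Ξ}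
    (hφ : MeasurePreserving φ ρ ρ) {D A : Set Ξ} (hD : MeasurableSet D) (hA : MeasurableSet A)
    (hDφ : ∀ ξ ∈ D, φ ξ ∈ D) (h : ∀ ξ ∈ D, ξ ∈ A ∨ φ ξ ∈ A) : ρ D ≤ 2 * ρ (D ∩ A) := by
  calc ρ D ≤ ρ (D ∩ A ∪ φ ⁻¹' (D ∩ A)) := measure_mono fun ξ hξ =>
        (h ξ hξ).imp (fun h => ⟨hξ, h⟩) fun h => ⟨hDφ ξ hξ, h⟩
    _ ≤ ρ (D ∩ A) + ρ (φ ⁻¹' (D ∩ A)) := measure_union_le _ _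
    _ = 2 * ρ (D ∩ A) := by
        rw [hφ.measure_preimage (hD.inter hA).nullMeasurableSet]; ring

variable {ι : ℕ → Type} (η : ℕ → ENNReal)

/-- Independent random variables with values in `{-1, 0, 1}`, one for each cell of each partition
of a sequence. -/
noncomputable def selectionMeasure (ι : ℕ → Type) (η : ℕ → ENNReal) :
    Measure ((Σ n, ι n) → ℤ) :=
  Measure.infinitePi fun p => signLaw (η p.1)

/-- The cells of the partition number `n` that meet no cell selected at an earlier stage. -/
def availableCells (π : ∀ m n, m < n → ι n → ι m) (n : ℕ) (ξ : (Σ n, ι n) → ℤ) : Set (ι n) :=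
  {i | ∀ m (hm : m < n), ξ ⟨m, π m n hm i⟩ ≠ 1}

/-- The selected cells of the partition number `n`. -/
def selectedCells (π : ∀ m n, m < n → ι n → ι m) (n : ℕ) (ξ : (Σ n, ι n) → ℤ) : Set (ι n) :=
  {i | i ∈ availableCells π n ξ ∧ ξ ⟨n, i⟩ = 1}

variable {η}

theorem isProbabilityMeasure_selectionMeasure (hη : ∀ n, 2 * η n ≤ 1) :
    IsProbabilityMeasure (selectionMeasure ι η) := by
  have : ∀ p : Σ n, ι n, IsProbabilityMeasure (signLaw (η p.1)) :=
    fun p => isProbabilityMeasure_signLaw (hη p.1)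
  unfold selectionMeasure
  infer_instance

theorem selectionMeasure_eq_one (hη : ∀ n, 2 * η n ≤ 1) (p : Σ n, ι n) :
    selectionMeasure ι η {ξ | ξ p = 1} = η p.1 := by
  have : ∀ p : Σ n, ι n, IsProbabilityMeasure (signLaw (η p.1)) :=
    fun p => isProbabilityMeasure_signLaw (hη p.1)
  rw [← signLaw_one (η p.1)]
  exact (measurePreserving_eval_infinitePi (fun p : Σ n, ι n => signLaw (η p.1)) p).measure_preimage
    (measurableSet_singleton 1).nullMeasurableSet

open Classical in
/-- The change of the sign at a single cell preserves the law of the selection. -/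
theorem measurePreserving_flip (hη : ∀ n, 2 * η n ≤ 1) (p : Σ n, ι n) :
    MeasurePreserving (fun ξ : (Σ n, ι n) → ℤ => Function.update ξ p (-ξ p))
      (selectionMeasure ι η) (selectionMeasure ι η) := by
  have hP : ∀ p : Σ n, ι n, IsProbabilityMeasure (signLaw (η p.1)) :=
    fun p => isProbabilityMeasure_signLaw (hη p.1)
  have hf : ∀ q : Σ n, ι n, Measurable fun v : ℤ => if q = p then -v else v :=
    fun q => measurable_of_countable _
  have he : (fun ξ : (Σ n, ι n) → ℤ => Function.update ξ p (-ξ p)) =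
      fun ξ q => (fun v : ℤ => if q = p then -v else v) (ξ q) := by
    ext ξ q
    by_cases h : q = p
    · subst h; simp
    · simp [h]
  refine ⟨?_, ?_⟩
  · rw [he]; exact measurable_pi_lambda _ fun q => (hf q).comp (measurable_pi_apply q)
  · rw [he]
    unfold selectionMeasure
    rw [Measure.infinitePi_map_pi _ hf]
    congr 1
    ext1 q
    by_cases h : q = p
    · simp only [h, if_true]; exact signLaw_map_neg _
    · simp only [h, if_false]; exact Measure.map_id

variable [∀ n, Fintype (ι n)]

/-- The values of the selection on the cells of the partition number `n` are independent of the
set of available cells. -/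
theorem selectionMeasure_inter (hη : ∀ n, 2 * η n ≤ 1) (π : ∀ m n, m < n → ι n → ι m) (n : ℕ)
    (C : Set (Set (ι n))) (J : Finset (ι n)) :
    selectionMeasure ι η ({ξ | availableCells π n ξ ∈ C} ∩
        {ξ | ∀ i ∈ J, ξ ⟨n, i⟩ ∉ ({1, -1} : Set ℤ)}) =
      selectionMeasure ι η {ξ | availableCells π n ξ ∈ C} * (1 - 2 * η n) ^ J.card := by
  classical
  have hP : ∀ p : Σ n, ι n, IsProbabilityMeasure (signLaw (η p.1)) :=
    fun p => isProbabilityMeasure_signLaw (hη p.1)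
  let S : Finset (Σ n, ι n) := (Finset.range n).sigma fun m => Finset.univ
  let T : Finset (Σ n, ι n) := J.map ⟨fun i => ⟨n, i⟩, sigma_mk_injective⟩
  have hST : Disjoint S T := by
    rw [Finset.disjoint_left]
    rintro ⟨m, i⟩ h1 h2
    simp only [S, T, Finset.mem_sigma, Finset.mem_range, Finset.mem_map,
      Function.Embedding.coeFn_mk] at h1 h2
    obtain ⟨j, -, hj⟩ := h2
    have := congrArg Sigma.fst hj
    simp only at this
    omega
  have hind := (iIndepFun_infinitePi (P := fun p : Σ n, ι n => signLaw (η p.1))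
    (X := fun _ v => v) fun _ => measurable_id).indepFun_finset S T hST
    fun p => measurable_pi_apply p
  let A : Set (S → ℤ) := {ζ | {i | ∀ m (hm : m < n), ζ ⟨⟨m, π m n hm i⟩, by simp [S, hm]⟩ ≠ 1} ∈ C}
  let B : Set (T → ℤ) := {ζ | ∀ i (hi : i ∈ J), ζ ⟨⟨n, i⟩, by simp [T, hi]⟩ ∉ ({1, -1} : Set ℤ)}
  have h := hind.measure_inter_preimage_eq_mul A B (to_countable _).measurableSet
    (to_countable _).measurableSet
  refine h.trans ?_
  congr 1
  have hB : (fun (a : (Σ n, ι n) → ℤ) (i : T) => a i) ⁻¹' B =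
      Set.pi T fun _ => ({1, -1} : Set ℤ)ᶜ := by
    ext ξ
    simp [B, T]
  rw [hB, Measure.infinitePi_pi _ fun _ _ => (to_countable _).measurableSet]
  simp only [signLaw_zero, T, Finset.prod_map, Function.Embedding.coeFn_mk, Finset.prod_const]

end Selection

end

section

open ProbabilityTheory

section Selection

variable {ι : ℕ → Type} [∀ n, Fintype (ι n)] {η : ℕ → ENNReal}

open Classical in
/-- The sum of `x` over the selected cells. -/
noncomputable def selectedSum (π : ∀ m n, m < n → ι n → ι m) (n : ℕ) (x : ι n → ℝ)
    (ξ : (Σ n, ι n) → ℤ) : ℝ :=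
  ∑ i, if i ∈ selectedCells π n ξ then x i else 0

theorem measurableSet_availableCells (π : ∀ m n, m < n → ι n → ι m) (n : ℕ) (C : Set (Set (ι n))) :
    MeasurableSet {ξ | availableCells π n ξ ∈ C} := by
  have : Measurable fun ξ : (Σ n, ι n) → ℤ =>
      fun p : (Σ m : Fin n, ι m) => ξ ⟨p.1, p.2⟩ := by fun_prop
  have h2 := this ((to_countable ({ζ : (Σ m : Fin n, ι m) → ℤ |
    {i | ∀ m (hm : m < n), ζ ⟨⟨m, hm⟩, π m n hm i⟩ ≠ 1} ∈ C})).measurableSet)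
  exact h2

theorem measurableSet_mem_selectedCells (π : ∀ m n, m < n → ι n → ι m) (n : ℕ) (i : ι n) :
    MeasurableSet {ξ : (Σ n, ι n) → ℤ | i ∈ selectedCells π n ξ} :=
  (measurableSet_availableCells π n {s | i ∈ s}).inter
    (measurable_pi_apply (X := fun _ : Σ n, ι n => ℤ) ⟨n, i⟩ (measurableSet_singleton 1))

theorem measurable_selectedSum (π : ∀ m n, m < n → ι n → ι m) (n : ℕ) (x : ι n → ℝ) :
    Measurable (selectedSum π n x) :=
  Finset.measurable_sum _ fun i _ =>
    Measurable.ite (measurableSet_mem_selectedCells π n i) measurable_const measurable_const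

/-- With probability at least one half, at least half of the cells in `L` are available, when the
selection probabilities are small. -/
theorem half_le_available (hη : ∀ n, 2 * η n ≤ 1) (hsum : ∀ n, ∑ m ∈ Finset.range n, η m ≤ 1 / 4)
    (π : ∀ m n, m < n → ι n → ι m) (n : ℕ) (L : Finset (ι n)) {k : ℕ} (hk : 2 * k ≤ L.card) :
    selectionMeasure ι η {ξ | (↑L ∩ availableCells π n ξ).ncard < k} ≤ 1 / 2 := by
  classical
  have := isProbabilityMeasure_selectionMeasure (ι := ι) hη
  set ρ := selectionMeasure ι η
  have hmeas : ∀ i, MeasurableSet {ξ : (Σ n, ι n) → ℤ | i ∉ availableCells π n ξ} := fun i =>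
    measurableSet_availableCells π n {s | i ∉ s}
  have h1 : ∀ i, ρ {ξ | i ∉ availableCells π n ξ} ≤ 1 / 4 := by
    intro i
    have hsub : {ξ : (Σ n, ι n) → ℤ | i ∉ availableCells π n ξ} ⊆
        ⋃ m ∈ Finset.range n, {ξ | ∃ hm : m < n, ξ ⟨m, π m n hm i⟩ = 1} := by
      intro ξ hξ
      simp only [availableCells, ne_eq, mem_ofPred_eq, not_forall, not_not] at hξ
      obtain ⟨m, hm, h⟩ := hξ
      simp only [mem_iUnion]
      exact ⟨m, Finset.mem_range.2 hm, hm, h⟩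
    refine ((measure_mono hsub).trans (measure_biUnion_finset_le _ _)).trans
      ((Finset.sum_le_sum fun m hm => ?_).trans (hsum n))
    rw [← selectionMeasure_eq_one hη ⟨m, π m n (Finset.mem_range.1 hm) i⟩]
    exact measure_mono fun ξ ⟨_, h⟩ => h
  rcases Nat.eq_zero_or_pos k with rfl | hk0
  · simp
  -- Markov's inequality for the number of cells of `L` that are not available
  have h2 : (L.card : ENNReal) / 2 * ρ {ξ | (↑L ∩ availableCells π n ξ).ncard < k} ≤
      L.card * (1 / 4) := by
    calc (L.card : ENNReal) / 2 * ρ {ξ | (↑L ∩ availableCells π n ξ).ncard < k}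
        ≤ (L.card : ENNReal) / 2 * ρ {ξ | (L.card : ENNReal) / 2 ≤
            ∑ i ∈ L, {ξ | i ∉ availableCells π n ξ}.indicator (fun _ => (1 : ENNReal)) ξ} := by
          refine mul_le_mul_right (measure_mono fun ξ hξ => ?_) _
          have e1 : (↑L ∩ availableCells π n ξ : Set (ι n)) =
              ((L.filter fun i => i ∈ availableCells π n ξ : Finset _) : Set (ι n)) := by
            ext i; simp
          have e2 : ∑ i ∈ L, {ξ | i ∉ availableCells π n ξ}.indicator (fun _ => (1 : ENNReal)) ξ =
              ((L.filter fun i => i ∉ availableCells π n ξ).card : ENNReal) := by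
            simp [indicator_apply, Finset.sum_ite]
          have hξ' : (L.filter fun i => i ∈ availableCells π n ξ).card < k := by
            have : (↑L ∩ availableCells π n ξ).ncard < k := hξ
            rwa [e1, ncard_coe_finset] at this
          show (L.card : ENNReal) / 2 ≤ ∑ i ∈ L, {ξ | i ∉ availableCells π n ξ}.indicator
            (fun _ => (1 : ENNReal)) ξ
          rw [e2]
          have h3 := L.card_filter_add_card_filter_not (fun i => i ∈ availableCells π n ξ)
          refine ENNReal.div_le_of_le_mul ?_
          have : L.card ≤ (L.filter fun i => i ∉ availableCells π n ξ).card * 2 := by omega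
          exact_mod_cast this
      _ ≤ ∫⁻ ξ, ∑ i ∈ L, {ξ | i ∉ availableCells π n ξ}.indicator (fun _ => (1 : ENNReal)) ξ ∂ρ :=
          mul_meas_ge_le_lintegral (Finset.measurable_sum _ fun i _ =>
            measurable_const.indicator (hmeas i)) _
      _ = ∑ i ∈ L, ρ {ξ | i ∉ availableCells π n ξ} := by
          rw [lintegral_finsetSum _ fun i _ => measurable_const.indicator (hmeas i)]
          simp [lintegral_indicator_const (hmeas _)]
      _ ≤ L.card * (1 / 4) := by
          rw [← nsmul_eq_mul]
          exact Finset.sum_le_card_nsmul _ _ _ fun i _ => h1 i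
  have hL0 : (L.card : ENNReal) ≠ 0 := by
    have : L.card ≠ 0 := by omega
    exact_mod_cast this
  have hLt : (L.card : ENNReal) ≠ ⊤ := ENNReal.natCast_ne_top _
  have h3 : (L.card : ENNReal) * (1 / 4) = L.card / 2 * (1 / 2) := by
    rw [← ENNReal.toReal_eq_toReal_iff' (by finiteness) (by finiteness)]
    simp only [ENNReal.toReal_mul, ENNReal.toReal_div, ENNReal.toReal_natCast,
      ENNReal.toReal_ofNat, ENNReal.toReal_one]
    ring
  rw [h3] at h2
  exact (ENNReal.mul_le_mul_iff_right (by simpa using hL0) (by finiteness)).1 h2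

/-- If many of the numbers `x i` are large, then with probability at least `1/8` the sum over the
selected cells is large: it is likely that some cell with large `x i` is available and active, and
then the change of sign at this cell changes the sum by `x i`. -/
theorem one_eighth_le_selectedSum (hη : ∀ n, 2 * η n ≤ 1)
    (hsum : ∀ n, ∑ m ∈ Finset.range n, η m ≤ 1 / 4) (π : ∀ m n, m < n → ι n → ι m) (n : ℕ)
    (x : ι n → ℝ) (L : Finset (ι n)) (hL : ∀ i ∈ L, 2 < |x i|) {k : ℕ} (hk : 2 * k ≤ L.card)
    (hkη : (1 - 2 * η n) ^ k ≤ 1 / 4) :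
    1 / 8 ≤ selectionMeasure ι η {ξ | 1 ≤ |selectedSum π n x ξ|} := by
  classical
  have := isProbabilityMeasure_selectionMeasure (ι := ι) hη
  have hhalf := half_le_available hη hsum π n L hk
  set ρ := selectionMeasure ι η with hρ
  set A := {ξ | 1 ≤ |selectedSum π n x ξ|} with hA
  have hAm : MeasurableSet A := measurableSet_le measurable_const (measurable_selectedSum π n x).abs
  let D : ι n → Set ((Σ n, ι n) → ℤ) := fun i =>
    {ξ | i ∈ availableCells π n ξ ∧ ξ ⟨n, i⟩ ∈ ({1, -1} : Set ℤ)}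
  have hDm : ∀ i, MeasurableSet (D i) := fun i =>
    (measurableSet_availableCells π n {s | i ∈ s}).inter
      (measurable_pi_apply (X := fun _ : Σ n, ι n => ℤ) ⟨n, i⟩ (to_countable _).measurableSet)
  have havail : ∀ (ξ : (Σ n, ι n) → ℤ) i v,
      availableCells π n (Function.update ξ ⟨n, i⟩ v) = availableCells π n ξ := by
    intro ξ i v
    ext j
    refine forall₂_congr fun m hm => ?_
    rw [Function.update_of_ne]
    intro h
    have := congrArg Sigma.fst h
    simp only at this
    omega
  -- flipping the sign at an active cell with large `x i`
  have hflip : ∀ i ∈ L, ∀ ξ ∈ D i, ξ ∈ A ∨ Function.update ξ ⟨n, i⟩ (-ξ ⟨n, i⟩) ∈ A := by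
    intro i hi ξ hξ
    have hsel : ∀ (ζ : (Σ n, ι n) → ℤ), selectedSum π n x ζ =
        (∑ j ∈ Finset.univ.erase i, if j ∈ selectedCells π n ζ then x j else 0) +
          if i ∈ selectedCells π n ζ then x i else 0 := fun ζ =>
      (Finset.sum_erase_add _ _ (Finset.mem_univ i)).symm
    have hrest : (∑ j ∈ Finset.univ.erase i, if j ∈ selectedCells π n
        (Function.update ξ ⟨n, i⟩ (-ξ ⟨n, i⟩)) then x j else 0) =
        ∑ j ∈ Finset.univ.erase i, if j ∈ selectedCells π n ξ then x j else 0 := by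
      refine Finset.sum_congr rfl fun j hj => ?_
      have : j ∈ selectedCells π n (Function.update ξ ⟨n, i⟩ (-ξ ⟨n, i⟩)) ↔
          j ∈ selectedCells π n ξ := by
        simp only [selectedCells, mem_ofPred_eq, havail]
        rw [Function.update_of_ne]
        intro h
        exact (Finset.mem_erase.1 hj).1 (sigma_mk_injective h)
      simp only [this]
    have hx := hL i hi
    obtain ⟨hav, h1⟩ := hξ
    have key : ∀ R : ℝ, 1 ≤ |R + x i| ∨ 1 ≤ |R + 0| := by
      intro R
      by_contra! h
      have h2 := abs_sub (R + x i) (R + 0)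
      rw [show R + x i - (R + 0) = x i by ring] at h2
      linarith [h.1, h.2]
    have hmem : ∀ ζ, ζ ∈ A ↔ 1 ≤ |selectedSum π n x ζ| := fun ζ => Iff.rfl
    rw [hmem, hmem, hsel, hsel (Function.update _ _ _), hrest]
    rcases h1 with h1 | h1
    · rw [if_pos ⟨hav, h1⟩, if_neg]
      · exact key _
      · rintro ⟨-, h⟩
        rw [Function.update_self, h1] at h
        norm_num at h
    · have h1 : ξ ⟨n, i⟩ = -1 := h1
      rw [if_neg, if_pos]
      · exact (key _).symm
      · refine ⟨by rwa [havail], ?_⟩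
        rw [Function.update_self, h1]; norm_num
      · rintro ⟨-, h⟩
        rw [h1] at h
        norm_num at h
  -- the events `D i` are made disjoint one after another, which keeps them invariant under the flip
  have hU : ∀ s ⊆ L, ρ (⋃ i ∈ s, D i) ≤ 2 * ρ ((⋃ i ∈ s, D i) ∩ A) := by
    intro s
    induction s using Finset.induction_on with
    | empty => simp
    | insert i s hi ih =>
      intro hs
      have hsm : MeasurableSet (⋃ j ∈ s, D j) := Finset.measurableSet_biUnion _ fun j _ => hDm j
      have hrw : (⋃ j ∈ insert i s, D j) = (⋃ j ∈ s, D j) ∪ (D i \ ⋃ j ∈ s, D j) := by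
        rw [Finset.set_biUnion_insert, union_comm, union_sdiff_self]
      have hinv : ∀ ξ j, Function.update ξ ⟨n, i⟩ (-ξ ⟨n, i⟩) ∈ D j ↔ ξ ∈ D j := by
        intro ξ j
        simp only [D, mem_ofPred_eq, havail]
        by_cases hij : j = i
        · subst hij
          rw [Function.update_self]
          simp only [mem_insert_iff, mem_singleton_iff]
          constructor <;> rintro ⟨h, h1⟩ <;> refine ⟨h, ?_⟩ <;> omega
        · rw [Function.update_of_ne fun h => hij (sigma_mk_injective h)]
      have h1 := measure_le_two_mul_of_flip (measurePreserving_flip hη ⟨n, i⟩)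
        ((hDm i).diff hsm) hAm
        (by
          rintro ξ ⟨h1, h2⟩
          refine ⟨(hinv ξ i).2 h1, ?_⟩
          simp only [mem_iUnion, not_exists] at h2 ⊢
          exact fun j hj h => h2 j hj ((hinv ξ j).1 h))
        (by
          rintro ξ ⟨h1, -⟩
          have := hflip i (hs (Finset.mem_insert_self _ _)) ξ h1
          convert this)
      rw [hrw, measure_union disjoint_sdiff_right ((hDm i).diff hsm), union_inter_distrib_right,
        measure_union (disjoint_sdiff_right.mono inter_subset_left inter_subset_left)
          (((hDm i).diff hsm).inter hAm), mul_add]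
      exact add_le_add (ih fun j hj => hs (Finset.mem_insert_of_mem hj)) h1
  -- some large cell is available and active with probability at least `1/4`
  have hD : ρ (⋃ i ∈ L, D i)ᶜ ≤ 1 / 2 + 1 / 4 := by
    have hsub : (⋃ i ∈ L, D i)ᶜ ⊆ {ξ | (↑L ∩ availableCells π n ξ).ncard < k} ∪
        ⋃ J ∈ L.powerset.filter fun J => k ≤ J.card,
          ({ξ | availableCells π n ξ ∈ {s : Set (ι n) | ↑L ∩ s = ↑J}} ∩
            {ξ | ∀ i ∈ J, ξ ⟨n, i⟩ ∉ ({1, -1} : Set ℤ)}) := by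
      intro ξ hξ
      simp only [mem_compl_iff, mem_iUnion, not_exists] at hξ
      rcases lt_or_ge (↑L ∩ availableCells π n ξ).ncard k with h | h
      · exact Or.inl h
      · refine Or.inr ?_
        have e1 : (↑L ∩ availableCells π n ξ : Set (ι n)) =
            ((L.filter fun i => i ∈ availableCells π n ξ : Finset _) : Set (ι n)) := by
          ext i; simp
        simp only [mem_iUnion]
        refine ⟨L.filter fun i => i ∈ availableCells π n ξ, ?_, e1, ?_⟩
        · rw [e1, ncard_coe_finset] at h
          simp [h]
        · intro i hi hmem
          rw [Finset.mem_filter] at hi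
          exact hξ i hi.1 ⟨hi.2, hmem⟩
    refine (measure_mono hsub).trans ((measure_union_le _ _).trans (add_le_add hhalf ?_))
    calc ρ (⋃ J ∈ L.powerset.filter fun J => k ≤ J.card,
          ({ξ | availableCells π n ξ ∈ {s : Set (ι n) | ↑L ∩ s = ↑J}} ∩
            {ξ | ∀ i ∈ J, ξ ⟨n, i⟩ ∉ ({1, -1} : Set ℤ)}))
        ≤ ∑ J ∈ L.powerset.filter fun J => k ≤ J.card,
          ρ ({ξ | availableCells π n ξ ∈ {s : Set (ι n) | ↑L ∩ s = ↑J}} ∩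
            {ξ | ∀ i ∈ J, ξ ⟨n, i⟩ ∉ ({1, -1} : Set ℤ)}) := measure_biUnion_finset_le _ _
      _ ≤ ∑ J ∈ L.powerset.filter fun J => k ≤ J.card,
          ρ {ξ | availableCells π n ξ ∈ {s : Set (ι n) | ↑L ∩ s = ↑J}} * (1 / 4) := by
          refine Finset.sum_le_sum fun J hJ => ?_
          rw [hρ, selectionMeasure_inter hη]
          gcongr
          refine le_trans (pow_le_pow_right_of_le_one' ?_ (Finset.mem_filter.1 hJ).2) hkη
          exact tsub_le_self
      _ = ρ (⋃ J ∈ L.powerset.filter fun J => k ≤ J.card,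
            {ξ | availableCells π n ξ ∈ {s : Set (ι n) | ↑L ∩ s = ↑J}}) * (1 / 4) := by
          rw [← Finset.sum_mul, measure_biUnion_finset]
          · intro J _ J' _ hne
            refine disjoint_left.2 fun ξ h1 h2 => hne ?_
            have h1 : (↑L ∩ availableCells π n ξ : Set (ι n)) = ↑J := h1
            have h2 : (↑L ∩ availableCells π n ξ : Set (ι n)) = ↑J' := h2
            exact Finset.coe_injective (h1.symm.trans h2)
          · exact fun J _ => measurableSet_availableCells π n _
      _ ≤ 1 / 4 := by
          refine (mul_le_mul_left prob_le_one _).trans ?_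
          rw [one_mul]
  have hUm : MeasurableSet (⋃ i ∈ L, D i) := Finset.measurableSet_biUnion _ fun j _ => hDm j
  have h4 : 1 / 4 ≤ ρ (⋃ i ∈ L, D i) := by
    have := prob_add_prob_compl (μ := ρ) hUm
    have h5 : (1 : ENNReal) ≤ ρ (⋃ i ∈ L, D i) + (1 / 2 + 1 / 4) := by
      exact this.symm.le.trans (add_le_add le_rfl hD)
    have h6 : (1 : ENNReal) = 1 / 4 + (1 / 2 + 1 / 4) := by
      rw [← ENNReal.toReal_eq_toReal_iff' (by finiteness) (by finiteness),
        ENNReal.toReal_add (by finiteness) (by finiteness),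
        ENNReal.toReal_add (by finiteness) (by finiteness)]
      simp only [ENNReal.toReal_div, ENNReal.toReal_ofNat, ENNReal.toReal_one]
      norm_num
    have h5 := h6.symm.le.trans h5
    exact (ENNReal.add_le_add_iff_right (by finiteness)).1 h5
  have h7 := (h4.trans (hU L subset_rfl)).trans
    (mul_le_mul_right (measure_mono inter_subset_right) 2)
  have h8 : (1 / 4 : ENNReal) = 2 * (1 / 8) := by
    rw [← ENNReal.toReal_eq_toReal_iff' (by finiteness) (by finiteness)]
    simp only [ENNReal.toReal_mul, ENNReal.toReal_div, ENNReal.toReal_ofNat, ENNReal.toReal_one]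
    norm_num
  rw [h8] at h7
  exact (ENNReal.mul_le_mul_iff_right (by simp) (by simp)).1 h7

end Selection

/-! ### Boundedness in probability -/

namespace StochasticMeasure

variable {X : Type*} [MeasurableSpace X] {Ω : Type*} [MeasurableSpace Ω] {P : Measure Ω}
  [IsProbabilityMeasure P]

/-- The range of a stochastic measure is bounded in probability. Otherwise there is a refining
sequence of partitions with many large cells, and a random selection of few of these cells gives,
with positive probability, disjoint sets on which the values do not tend to zero. -/
theorem exists_measureReal_toFun_le (μ : StochasticMeasure X P) {δ : ℝ} (hδ : 0 < δ) :
    ∃ t : ℝ, ∀ B, MeasurableSet B → P.real {ω | t < |μ.toFun B ω|} ≤ δ := by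
  classical
  by_contra! hunb
  -- the selection probabilities have sum `1 / 4`
  let η : ℕ → ENNReal := fun n => (1 / 8) * (1 / 2) ^ n
  have hη8 : ∀ n, η n ≤ 1 / 8 := fun n =>
    mul_le_of_le_one_right' (pow_le_one' (by simp) n)
  have hη : ∀ n, 2 * η n ≤ 1 := by
    intro n
    refine (mul_le_mul_right (hη8 n) 2).trans ?_
    rw [one_div, ← div_eq_mul_inv]
    exact ENNReal.div_le_of_le_mul (by norm_num)
  have hsum : ∀ n, ∑ m ∈ Finset.range n, η m ≤ 1 / 4 := by
    intro n
    refine (ENNReal.sum_le_tsum _).trans ?_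
    simp only [η]
    rw [ENNReal.tsum_mul_left, ENNReal.tsum_geometric]
    simp only [one_div]
    rw [ENNReal.one_sub_inv_two, inv_inv,
      ← ENNReal.toReal_le_toReal (by finiteness) (by finiteness)]
    simp only [ENNReal.toReal_mul, ENNReal.toReal_inv, ENNReal.toReal_ofNat]
    norm_num
  -- among `k n` available cells it is likely that one is active
  have hk : ∀ n, ∃ k : ℕ, (1 - 2 * η n) ^ k ≤ 1 / 4 := by
    intro n
    have hlt : 1 - 2 * η n < 1 := by
      refine ENNReal.sub_lt_self (by simp) (by simp) ?_
      simp [η]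
    obtain ⟨k, hk⟩ := ((ENNReal.tendsto_pow_atTop_nhds_zero_of_lt_one hlt).eventually
      (gt_mem_nhds (show (0 : ENNReal) < 1 / 4 by simp))).exists
    exact ⟨k, hk.le⟩
  choose k hk using hk
  obtain ⟨ι, _, c, hc, hπ, hP⟩ := μ.exists_partitions hδ hunb (fun n => 2 * k n)
    (show (0 : ℝ) ≤ 2 by norm_num)
  choose π hπ using hπ
  have := isProbabilityMeasure_selectionMeasure (ι := ι) hη
  let ρ := selectionMeasure ι η
  let H : ((Σ n, ι n) → ℤ) → ℕ → Set X := fun ξ n => c n ⁻¹' (selectedCells π n ξ)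
  have hHfin : ∀ ξ n, H ξ n = c n ⁻¹' ((selectedCells π n ξ).toFinset : Set (ι n)) := by
    intro ξ n; simp [H]
  have hHm : ∀ ξ n, MeasurableSet (H ξ n) := fun ξ n =>
    hHfin ξ n ▸ (μ.toFun_preimage_finset (c n) (hc n) _).1
  have hHd : ∀ ξ, Pairwise (Function.onFun Disjoint (H ξ)) := by
    intro ξ
    refine (pairwise_disjoint_on _).2 fun m n hmn => disjoint_left.2 ?_
    rintro x ⟨-, h1⟩ ⟨h2, -⟩
    have := h2 m hmn
    rw [hπ m n hmn] at this
    exact this h1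
  let x : ∀ n, Ω → ι n → ℝ := fun n ω i => μ.toFun (c n ⁻¹' {i}) ω
  have hsel : ∀ ξ n, μ.toFun (H ξ n) =ᵐ[P] fun ω => selectedSum π n (x n ω) ξ := by
    intro ξ n
    rw [hHfin]
    filter_upwards [(μ.toFun_preimage_finset (c n) (hc n) (selectedCells π n ξ).toFinset).2]
      with ω hω
    rw [hω, selectedSum, ← Finset.sum_filter]
    congr 1
    ext i; simp
  let E : ℕ → Set (Ω × ((Σ n, ι n) → ℤ)) := fun n => {p | 1 ≤ |selectedSum π n (x n p.1) p.2|}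
  have hEm : ∀ n, MeasurableSet (E n) := by
    intro n
    refine measurableSet_le measurable_const (Measurable.abs ?_)
    unfold selectedSum
    exact Finset.measurable_sum _ fun i _ => Measurable.ite
      (measurable_snd (measurableSet_mem_selectedCells π n i))
      ((μ.measurable' _ (hc n i)).comp measurable_fst) measurable_const
  -- by exhaustivity, the probability of `E n` tends to zero
  have hto : Tendsto (fun n => (P.prod ρ) (E n)) atTop (𝓝 0) := by
    have h1 : ∀ n, (P.prod ρ) (E n) = ∫⁻ ξ, P ((fun ω => (ω, ξ)) ⁻¹' E n) ∂ρ := fun n =>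
      Measure.prod_apply_symm (hEm n)
    simp_rw [h1]
    rw [← lintegral_zero (μ := ρ)]
    refine tendsto_lintegral_of_dominated_convergence (fun _ => 1)
      (fun n => measurable_measure_prodMk_right (hEm n)) (fun n => ae_of_all _ fun ξ => prob_le_one)
      (by simp) (ae_of_all _ fun ξ => ?_)
    have h2 := tendstoInMeasure_iff_norm.1 (μ.tendsto_of_disjoint (H ξ) (hHm ξ) (hHd ξ)) 1 one_pos
    refine h2.congr fun n => measure_congr ?_
    filter_upwards [hsel ξ n] with ω hω
    refine propext ?_
    show 1 ≤ ‖μ.toFun (H ξ n) ω - 0‖ ↔ 1 ≤ |selectedSum π n (x n ω) ξ|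
    rw [hω, sub_zero, Real.norm_eq_abs]
  -- but it is bounded from below
  have hge : ∀ n, ENNReal.ofReal (δ / 4) * (1 / 8) ≤ (P.prod ρ) (E n) := by
    intro n
    set Q := {ω | 2 * k n ≤ μ.largeCells (c n) 2 ω} with hQ
    have hQm : MeasurableSet Q :=
      measurableSet_le measurable_const (μ.measurable_largeCells (c n) (hc n) 2)
    have h1 : ∀ ω ∈ Q, 1 / 8 ≤ ρ (Prod.mk ω ⁻¹' E n) := by
      intro ω hω
      refine one_eighth_le_selectedSum hη hsum π n (x n ω)
        (Finset.univ.filter fun i => 2 < |x n ω i|) (fun i hi => (Finset.mem_filter.1 hi).2)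
        ?_ (hk n)
      have hω : 2 * k n ≤ μ.largeCells (c n) 2 ω := hω
      unfold largeCells at hω
      convert hω
    rw [Measure.prod_apply (hEm n)]
    calc ENNReal.ofReal (δ / 4) * (1 / 8) ≤ P Q * (1 / 8) := by
          gcongr
          rw [← ofReal_measureReal]
          exact ENNReal.ofReal_le_ofReal (hP n)
      _ = ∫⁻ ω, Q.indicator (fun _ => 1 / 8) ω ∂P := by
          rw [lintegral_indicator_const hQm, mul_comm]
      _ ≤ ∫⁻ ω, ρ (Prod.mk ω ⁻¹' E n) ∂P := by
          refine lintegral_mono fun ω => ?_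
          by_cases h : ω ∈ Q
          · rw [indicator_of_mem h]; exact h1 ω h
          · rw [indicator_of_notMem h]; exact zero_le
  have := ge_of_tendsto' hto hge
  have hpos : 0 < ENNReal.ofReal (δ / 4) * (1 / 8) :=
    ENNReal.mul_pos (by simpa using hδ) (by simp)
  exact absurd this (not_le.2 hpos)

end StochasticMeasure

end

/-! ### Moments of sums of random signs -/

section Signs

variable {ι : Type*} [DecidableEq ι]

/-- Expectation of `F (S - m)`, where `S` is the sum of the `x i` over `i ∈ s` with independent
random signs of mean `a i` and `m = ∑ a i * x i` is its mean. -/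
noncomputable def signExp (a x : ι → ℝ) (s : Finset ι) (F : ℝ → ℝ) : ℝ :=
  ∑ T ∈ s.powerset, ((∏ i ∈ T, (1 + a i) / 2) * ∏ i ∈ s \ T, (1 - a i) / 2) *
    F (∑ i ∈ T, x i - ∑ i ∈ s \ T, x i - ∑ i ∈ s, a i * x i)

theorem signExp_insert (a x : ι → ℝ) {s : Finset ι} {i : ι} (hi : i ∉ s) (F : ℝ → ℝ) :
    signExp a x (insert i s) F =
      (1 + a i) / 2 * signExp a x s (fun t => F (t + (1 - a i) * x i)) +
      (1 - a i) / 2 * signExp a x s (fun t => F (t - (1 + a i) * x i)) := by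
  unfold signExp
  rw [Finset.sum_powerset_insert hi, add_comm, Finset.mul_sum, Finset.mul_sum]
  congr 1
  · refine Finset.sum_congr rfl fun T hT => ?_
    have hiT : i ∉ T := fun h => hi (Finset.mem_powerset.1 hT h)
    have h1 : insert i s \ insert i T = s \ T := by
      ext j; simp only [Finset.mem_sdiff, Finset.mem_insert]; grind
    rw [h1, Finset.prod_insert hiT, Finset.sum_insert hiT, Finset.sum_insert hi]
    rw [show x i + ∑ i ∈ T, x i - ∑ i ∈ s \ T, x i - (a i * x i + ∑ i ∈ s, a i * x i) =
      ∑ i ∈ T, x i - ∑ i ∈ s \ T, x i - ∑ i ∈ s, a i * x i + (1 - a i) * x i by ring]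
    ring
  · refine Finset.sum_congr rfl fun T hT => ?_
    have hiT : i ∉ T := fun h => hi (Finset.mem_powerset.1 hT h)
    have h1 : insert i s \ T = insert i (s \ T) := by
      ext j; simp only [Finset.mem_sdiff, Finset.mem_insert]; grind
    have h2 : i ∉ s \ T := fun h => hi (Finset.mem_sdiff.1 h).1
    rw [h1, Finset.prod_insert h2, Finset.sum_insert h2, Finset.sum_insert hi]
    rw [show ∑ i ∈ T, x i - (x i + ∑ i ∈ s \ T, x i) - (a i * x i + ∑ i ∈ s, a i * x i) =
      ∑ i ∈ T, x i - ∑ i ∈ s \ T, x i - ∑ i ∈ s, a i * x i - (1 + a i) * x i by ring]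
    ring

theorem signExp_add (a x : ι → ℝ) (s : Finset ι) (F G : ℝ → ℝ) :
    signExp a x s (fun t => F t + G t) = signExp a x s F + signExp a x s G := by
  simp only [signExp, mul_add, Finset.sum_add_distrib]

theorem signExp_const_mul (a x : ι → ℝ) (s : Finset ι) (r : ℝ) (F : ℝ → ℝ) :
    signExp a x s (fun t => r * F t) = r * signExp a x s F := by
  simp only [signExp, Finset.mul_sum]
  exact Finset.sum_congr rfl fun _ _ => by ring

theorem signWeight_nonneg {a : ι → ℝ} {s : Finset ι} (ha : ∀ i ∈ s, |a i| ≤ 1 / 2) {T : Finset ι}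
    (hT : T ⊆ s) : 0 ≤ (∏ i ∈ T, (1 + a i) / 2) * ∏ i ∈ s \ T, (1 - a i) / 2 := by
  refine mul_nonneg (Finset.prod_nonneg fun i hi => ?_) (Finset.prod_nonneg fun i hi => ?_)
  · have := abs_le.1 (ha i (hT hi)); linarith
  · have := abs_le.1 (ha i (Finset.mem_sdiff.1 hi).1); linarith

theorem signExp_mono (a x : ι → ℝ) (s : Finset ι) (ha : ∀ i ∈ s, |a i| ≤ 1 / 2) {F G : ℝ → ℝ}
    (h : ∀ t, F t ≤ G t) : signExp a x s F ≤ signExp a x s G := by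
  exact Finset.sum_le_sum fun T hT =>
    mul_le_mul_of_nonneg_left (h _) (signWeight_nonneg ha (Finset.mem_powerset.1 hT))

/-- The variance and a bound for the fourth central moment; the latter needs `|a i| ≤ 1/2`, which
makes the fourth moments of the single signs at most three times the squares of the variances. -/
theorem signExp_moments (a x : ι → ℝ) (s : Finset ι) (ha : ∀ i ∈ s, |a i| ≤ 1 / 2) :
    signExp a x s (fun _ => 1) = 1 ∧ signExp a x s (fun t => t) = 0 ∧
      signExp a x s (fun t => t ^ 2) = ∑ i ∈ s, (1 - a i ^ 2) * x i ^ 2 ∧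
      signExp a x s (fun t => t ^ 4) ≤ 3 * (∑ i ∈ s, (1 - a i ^ 2) * x i ^ 2) ^ 2 := by
  induction s using Finset.induction_on with
  | empty => simp [signExp]
  | insert i s hi ih =>
    obtain ⟨h0, h1, h2, h4⟩ := ih fun j hj => ha j (Finset.mem_insert_of_mem hj)
    have e1 : ∀ c, signExp a x s (fun t => t + c) = c := fun c => by
      rw [signExp_add a x s (fun t => t) fun _ => c, h1,
        show (fun _ : ℝ => c) = fun t => c * (fun _ => (1 : ℝ)) t by simp, signExp_const_mul, h0]
      ring
    have e2 : ∀ c, signExp a x s (fun t => (t + c) ^ 2) =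
        signExp a x s (fun t => t ^ 2) + c ^ 2 := fun c => by
      rw [show (fun t : ℝ => (t + c) ^ 2) = fun t => t ^ 2 + ((2 * c) * t + c ^ 2 * 1) by
        ext t; ring, signExp_add a x s (fun t => t ^ 2), signExp_add a x s fun t => 2 * c * t,
        signExp_const_mul, signExp_const_mul a x s _ fun _ => 1, h1, h0]
      ring
    have e4 : ∀ c, signExp a x s (fun t => (t + c) ^ 4) =
        signExp a x s (fun t => t ^ 4) + 4 * c * signExp a x s (fun t => t ^ 3) +
          6 * c ^ 2 * signExp a x s (fun t => t ^ 2) + c ^ 4 := fun c => by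
      rw [show (fun t : ℝ => (t + c) ^ 4) = fun t => t ^ 4 + (4 * c * t ^ 3 +
        (6 * c ^ 2 * t ^ 2 + (4 * c ^ 3 * t + c ^ 4 * 1))) by ext t; ring,
        signExp_add a x s (fun t => t ^ 4), signExp_add a x s fun t => 4 * c * t ^ 3,
        signExp_add a x s fun t => 6 * c ^ 2 * t ^ 2, signExp_add a x s fun t => 4 * c ^ 3 * t,
        signExp_const_mul, signExp_const_mul, signExp_const_mul,
        signExp_const_mul a x s _ fun _ => 1, h1, h0]
      ring
    rw [signExp_insert a x hi, signExp_insert a x hi, signExp_insert a x hi,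
      signExp_insert a x hi, Finset.sum_insert hi]
    simp only [sub_eq_add_neg _ ((1 + a i) * x i)]
    rw [e1, e1, e2, e2, e4, e4, h0, h2]
    set σ := ∑ i ∈ s, (1 - a i ^ 2) * x i ^ 2 with hσ
    refine ⟨by ring, by ring, by ring, ?_⟩
    have hai := ha i (Finset.mem_insert_self _ _)
    have ha2 : a i ^ 2 ≤ 1 / 4 := by
      rw [← sq_abs]; nlinarith [abs_nonneg (a i)]
    have hx4 : 0 ≤ x i ^ 4 := by positivity
    nlinarith [mul_nonneg (mul_nonneg (show 0 ≤ 1 - a i ^ 2 by linarith)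
      (show 0 ≤ 2 - 6 * a i ^ 2 by linarith)) hx4]

/-- A sum of independent random signs with means in `[-1/2, 1/2]` is with probability at least
`1/10` at least as large as its mean. -/
theorem one_tenth_le_signExp (a x : ι → ℝ) (s : Finset ι) (ha : ∀ i ∈ s, |a i| ≤ 1 / 2) :
    1 / 10 ≤ signExp a x s (fun t => if 0 ≤ t then 1 else 0) := by
  obtain ⟨h0, h1, h2, h4⟩ := signExp_moments a x s ha
  set v := ∑ i ∈ s, (1 - a i ^ 2) * x i ^ 2 with hv
  have hv0 : 0 ≤ v := Finset.sum_nonneg fun i hi => by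
    have := abs_le.1 (ha i hi)
    have : a i ^ 2 ≤ 1 := by nlinarith
    exact mul_nonneg (by linarith) (sq_nonneg _)
  rcases hv0.eq_or_lt with hv0 | hv0
  · -- the sum is almost surely equal to its mean
    have hx : ∀ i ∈ s, x i = 0 := by
      intro i hi
      have hle : ∀ i ∈ s, 3 / 4 ≤ 1 - a i ^ 2 := fun i hi => by
        have := ha i hi
        rw [← sq_abs]; nlinarith [abs_nonneg (a i)]
      have := (Finset.sum_eq_zero_iff_of_nonneg fun i hi =>
        mul_nonneg ((by norm_num : (0 : ℝ) ≤ 3 / 4).trans (hle i hi)) (sq_nonneg (x i))).1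
        hv0.symm i hi
      rcases mul_eq_zero.1 this with h | h
      · linarith [hle i hi]
      · exact pow_eq_zero_iff two_ne_zero |>.1 h
    have : signExp a x s (fun t => if 0 ≤ t then 1 else 0) = signExp a x s fun _ => 1 := by
      refine Finset.sum_congr rfl fun T hT => ?_
      rw [Finset.sum_eq_zero fun i hi => hx i (Finset.mem_powerset.1 hT hi),
        Finset.sum_eq_zero fun i hi => hx i (Finset.mem_sdiff.1 hi).1,
        Finset.sum_eq_zero fun i hi => by rw [hx i hi, mul_zero]]
      simp
    rw [this, h0]; norm_num
  · set r := √v with hr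
    have hr0 : 0 < r := Real.sqrt_pos.2 hv0
    have hrv : r ^ 2 = v := Real.sq_sqrt hv0.le
    -- the indicator of `0 ≤ u` is bounded from below by `u / 3 + 2 * u ^ 2 / 5 - u ^ 4 / 10`
    have key : signExp a x s (fun t => (1 / 3 / r) * t + ((2 / 5 / r ^ 2) * t ^ 2 +
        (-(1 / 10 / r ^ 4)) * t ^ 4)) ≤ signExp a x s (fun t => if 0 ≤ t then 1 else 0) := by
      refine signExp_mono a x s ha fun t => ?_
      obtain ⟨u, rfl⟩ : ∃ u, t = u * r := ⟨t / r, by field_simp⟩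
      have e : 1 / 3 / r * (u * r) + (2 / 5 / r ^ 2 * (u * r) ^ 2 +
          -(1 / 10 / r ^ 4) * (u * r) ^ 4) = u / 3 + 2 / 5 * u ^ 2 - u ^ 4 / 10 := by
        field_simp
        ring
      rw [e]
      split_ifs with h
      · nlinarith [sq_nonneg (u ^ 2 - 12 / 5), sq_nonneg (u - 8 / 5)]
      · have hu : u < 0 := by
          by_contra h'
          exact h (mul_nonneg (not_lt.1 h') hr0.le)
        have : 0 ≤ 1 / 3 + 2 / 5 * u - u ^ 3 / 10 := by
          nlinarith [mul_nonneg (neg_nonneg.2 hu.le) (sq_nonneg (u + 6 / 5)),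
            sq_nonneg (u + 6 / 5), sq_nonneg (u + 1)]
        nlinarith
    rw [signExp_add a x s (fun t => (1 / 3 / r) * t), signExp_const_mul,
      signExp_add a x s (fun t => (2 / 5 / r ^ 2) * t ^ 2), signExp_const_mul, signExp_const_mul,
      h1, h2, ← hrv] at key
    have h5 : 1 / 10 / r ^ 4 * signExp a x s (fun t => t ^ 4) ≤ 1 / 10 / r ^ 4 * (3 * v ^ 2) :=
      mul_le_mul_of_nonneg_left h4 (by positivity)
    have h6 : 1 / 10 / r ^ 4 * (3 * v ^ 2) = 3 / 10 := by rw [← hrv]; field_simp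
    have h7 : 2 / 5 / r ^ 2 * r ^ 2 = 2 / 5 := by field_simp
    linarith

/-- The square of a Rademacher sum is with probability at least `1/12` at least half of its mean. -/
theorem one_twelfth_le_signExp (x : ι → ℝ) (s : Finset ι) :
    1 / 12 ≤ signExp 0 x s (fun t => if (∑ i ∈ s, x i ^ 2) / 2 ≤ t ^ 2 then 1 else 0) := by
  have ha : ∀ i ∈ s, |(0 : ι → ℝ) i| ≤ 1 / 2 := by simp
  obtain ⟨h0, h1, h2, h4⟩ := signExp_moments 0 x s ha
  simp only [Pi.zero_apply, ne_eq, OfNat.ofNat_ne_zero, not_false_eq_true, zero_pow, sub_zero,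
    one_mul] at h2 h4
  set v := ∑ i ∈ s, x i ^ 2 with hv
  have hvn : 0 ≤ v := Finset.sum_nonneg fun i _ => sq_nonneg (x i)
  clear_value v
  rcases hvn.eq_or_lt with hv0 | hv0
  · rw [← hv0]
    have : (fun t : ℝ => if (0 : ℝ) / 2 ≤ t ^ 2 then (1 : ℝ) else 0) = fun _ => 1 := by
      ext t; rw [zero_div, if_pos (sq_nonneg t)]
    rw [this, h0]; norm_num
  · -- the indicator of `1/2 ≤ u` is bounded from below by `2 * u / 3 - u ^ 2 / 12 - 1 / 3`
    have key : signExp 0 x s (fun t => (2 / 3 / v) * t ^ 2 + ((-(1 / 12 / v ^ 2)) * t ^ 4 +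
        (-(1 / 3)) * 1)) ≤ signExp 0 x s (fun t => if v / 2 ≤ t ^ 2 then 1 else 0) := by
      refine signExp_mono 0 x s ha fun t => ?_
      obtain ⟨u, hu⟩ : ∃ u, t ^ 2 = u * v := ⟨t ^ 2 / v, by field_simp⟩
      have hu0 : 0 ≤ u := by
        by_contra h
        nlinarith [sq_nonneg t]
      have e : 2 / 3 / v * t ^ 2 + (-(1 / 12 / v ^ 2) * t ^ 4 + -(1 / 3) * 1) =
          2 / 3 * u - u ^ 2 / 12 - 1 / 3 := by
        rw [show t ^ 4 = (t ^ 2) ^ 2 by ring, hu]; field_simp; ring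
      rw [e]
      split_ifs with h
      · nlinarith [sq_nonneg (u - 4)]
      · have : u < 1 / 2 := by
          rw [hu] at h
          by_contra h'
          apply h; nlinarith
        nlinarith
    rw [signExp_add 0 x s (fun t => (2 / 3 / v) * t ^ 2), signExp_const_mul,
      signExp_add 0 x s (fun t => (-(1 / 12 / v ^ 2)) * t ^ 4), signExp_const_mul,
      signExp_const_mul 0 x s _ fun _ => 1, h0, h2] at key
    have h5 : 1 / 12 / v ^ 2 * signExp 0 x s (fun t => t ^ 4) ≤ 1 / 12 / v ^ 2 * (3 * v ^ 2) :=
      mul_le_mul_of_nonneg_left h4 (by positivity)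
    have h6 : 1 / 12 / v ^ 2 * (3 * v ^ 2) = 1 / 4 := by field_simp; norm_num
    have h7 : 2 / 3 / v * v = 2 / 3 := by field_simp
    linarith

end Signs

section Averaging

variable {Ω : Type*} [MeasurableSpace Ω] {P : Measure Ω} [IsProbabilityMeasure P]

/-- If every point of `E` lies in `F T` for a proportion at least `c` of the indices `T`, with
respect to a probability weight `w`, then `c * P E` is at most the largest `P (F T)`. -/
theorem mul_measureReal_le_of_weights {τ : Type*} (s : Finset τ) (w : τ → ℝ)
    (hw : ∀ T ∈ s, 0 ≤ w T) (hw1 : ∑ T ∈ s, w T = 1) {E : Set Ω} (hE : MeasurableSet E)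
    (F : τ → Set Ω) (hF : ∀ T ∈ s, MeasurableSet (F T)) {c κ : ℝ}
    (h : ∀ ω ∈ E, c ≤ ∑ T ∈ s, w T * (F T).indicator 1 ω) (hκ : ∀ T ∈ s, P.real (F T) ≤ κ) :
    c * P.real E ≤ κ := by
  have hint : ∀ T ∈ s, Integrable (fun ω => w T * (F T).indicator (1 : Ω → ℝ) ω) P := fun T hT =>
    ((integrable_const (1 : ℝ)).indicator (hF T hT)).const_mul _
  calc c * P.real E = ∫ ω, c * E.indicator (1 : Ω → ℝ) ω ∂P := by
        rw [integral_const_mul, integral_indicator_one hE]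
    _ ≤ ∫ ω, ∑ T ∈ s, w T * (F T).indicator (1 : Ω → ℝ) ω ∂P := by
        refine integral_mono (((integrable_const (1 : ℝ)).indicator hE).const_mul _)
          (integrable_finsetSum _ hint) fun ω => ?_
        by_cases hω : ω ∈ E
        · simpa [hω] using h ω hω
        · simp only [hω, not_false_eq_true, indicator_of_notMem, mul_zero]
          exact Finset.sum_nonneg fun T hT =>
            mul_nonneg (hw T hT) (indicator_nonneg (fun _ _ => zero_le_one) _)
    _ = ∑ T ∈ s, w T * P.real (F T) := by
        rw [integral_finsetSum _ hint]
        refine Finset.sum_congr rfl fun T hT => ?_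
        rw [integral_const_mul, integral_indicator_one (hF T hT)]
    _ ≤ ∑ T ∈ s, w T * κ :=
        Finset.sum_le_sum fun T hT => mul_le_mul_of_nonneg_left (hκ T hT) (hw T hT)
    _ = κ := by rw [← Finset.sum_mul, hw1, one_mul]

variable {ι : Type*} [DecidableEq ι]

/-- Bounded multipliers: if all sums `∑ ± x i` are uniformly small in probability, then so are all
sums `∑ a i * x i` with `|a i| ≤ 1/2`. -/
theorem measureReal_weighted_sum_le (s : Finset ι) (a : ι → ℝ) (ha : ∀ i ∈ s, |a i| ≤ 1 / 2)
    (x : ι → Ω → ℝ) (hx : ∀ i, Measurable (x i)) {t κ : ℝ}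
    (h : ∀ T ⊆ s, P.real {ω | t ≤ |∑ i ∈ T, x i ω - ∑ i ∈ s \ T, x i ω|} ≤ κ) :
    P.real {ω | t ≤ |∑ i ∈ s, a i * x i ω|} ≤ 10 * κ := by
  have hm1 : ∀ T : Finset ι, Measurable fun ω => ∑ i ∈ T, x i ω := fun T =>
    Finset.measurable_sum _ fun i _ => hx i
  have hm2 : Measurable fun ω => ∑ i ∈ s, a i * x i ω :=
    Finset.measurable_sum _ fun i _ => (hx i).const_mul _
  have := mul_measureReal_le_of_weights (P := P) s.powerset
    (fun T => (∏ i ∈ T, (1 + a i) / 2) * ∏ i ∈ s \ T, (1 - a i) / 2)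
    (E := {ω | t ≤ |∑ i ∈ s, a i * x i ω|})
    (F := fun T => {ω | t ≤ |∑ i ∈ T, x i ω - ∑ i ∈ s \ T, x i ω|}) (c := 1 / 10) (κ := κ)
    (fun T hT => signWeight_nonneg ha (Finset.mem_powerset.1 hT)) ?_
    (measurableSet_le measurable_const hm2.abs)
    (fun T _ => measurableSet_le measurable_const ((hm1 T).sub (hm1 _)).abs) ?_
    (fun T hT => h T (Finset.mem_powerset.1 hT))
  · linarith
  · have := (signExp_moments a (fun _ => 0) s ha).1
    simpa only [signExp, mul_one] using this
  · intro ω hω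
    have hω : t ≤ |∑ i ∈ s, a i * x i ω| := hω
    rcases le_total 0 (∑ i ∈ s, a i * x i ω) with hs | hs
    · rw [abs_of_nonneg hs] at hω
      refine (one_tenth_le_signExp a (fun i => x i ω) s ha).trans (Finset.sum_le_sum fun T hT =>
        mul_le_mul_of_nonneg_left ?_ (signWeight_nonneg ha (Finset.mem_powerset.1 hT)))
      beta_reduce
      split_ifs with h0
      · rw [indicator_of_mem, Pi.one_apply]
        exact (show t ≤ ∑ i ∈ T, x i ω - ∑ i ∈ s \ T, x i ω by linarith).trans (le_abs_self _)
      · exact indicator_nonneg (fun _ _ => zero_le_one) _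
    · rw [abs_of_nonpos hs] at hω
      refine (one_tenth_le_signExp a (fun i => -x i ω) s ha).trans (Finset.sum_le_sum fun T hT =>
        mul_le_mul_of_nonneg_left ?_ (signWeight_nonneg ha (Finset.mem_powerset.1 hT)))
      simp only [Finset.sum_neg_distrib, mul_neg]
      split_ifs with h0
      · rw [indicator_of_mem, Pi.one_apply]
        exact (show t ≤ -(∑ i ∈ T, x i ω - ∑ i ∈ s \ T, x i ω) by linarith).trans (neg_le_abs _)
      · exact indicator_nonneg (fun _ _ => zero_le_one) _

/-- If all sums `∑ ± x i` are uniformly small in probability, then so is the square function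
`(∑ x i ^ 2) ^ (1/2)`. -/
theorem measureReal_sum_sq_le (s : Finset ι) (x : ι → Ω → ℝ) (hx : ∀ i, Measurable (x i))
    {t κ : ℝ} (ht : 0 ≤ t)
    (h : ∀ T ⊆ s, P.real {ω | t ≤ |∑ i ∈ T, x i ω - ∑ i ∈ s \ T, x i ω|} ≤ κ) :
    P.real {ω | 2 * t ^ 2 ≤ ∑ i ∈ s, x i ω ^ 2} ≤ 12 * κ := by
  have ha : ∀ i ∈ s, |(0 : ι → ℝ) i| ≤ 1 / 2 := by simp
  have hm1 : ∀ T : Finset ι, Measurable fun ω => ∑ i ∈ T, x i ω := fun T =>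
    Finset.measurable_sum _ fun i _ => hx i
  have := mul_measureReal_le_of_weights (P := P) s.powerset
    (fun T => (∏ i ∈ T, (1 + (0 : ι → ℝ) i) / 2) * ∏ i ∈ s \ T, (1 - (0 : ι → ℝ) i) / 2)
    (E := {ω | 2 * t ^ 2 ≤ ∑ i ∈ s, x i ω ^ 2})
    (F := fun T => {ω | t ≤ |∑ i ∈ T, x i ω - ∑ i ∈ s \ T, x i ω|}) (c := 1 / 12) (κ := κ)
    (fun T hT => signWeight_nonneg ha (Finset.mem_powerset.1 hT)) ?_
    (measurableSet_le measurable_const (Finset.measurable_sum _ fun i _ => (hx i).pow_const 2))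
    (fun T _ => measurableSet_le measurable_const ((hm1 T).sub (hm1 _)).abs) ?_
    (fun T hT => h T (Finset.mem_powerset.1 hT))
  · linarith
  · have := (signExp_moments 0 (fun _ => 0) s ha).1
    simpa only [signExp, mul_one] using this
  · intro ω hω
    have hω : 2 * t ^ 2 ≤ ∑ i ∈ s, x i ω ^ 2 := hω
    refine (one_twelfth_le_signExp (fun i => x i ω) s).trans (Finset.sum_le_sum fun T hT =>
      mul_le_mul_of_nonneg_left ?_ (signWeight_nonneg ha (Finset.mem_powerset.1 hT)))
    simp only [Pi.zero_apply, zero_mul, Finset.sum_const_zero, sub_zero]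
    split_ifs with h0
    · rw [indicator_of_mem, Pi.one_apply]
      show t ≤ _
      rw [← abs_of_nonneg ht]
      exact sq_le_sq.1 (by linarith)
    · exact indicator_nonneg (fun _ _ => zero_le_one) _

end Averaging

/-! ### Square summability of simple integrals -/

namespace StochasticMeasure

variable {X : Type*} [MeasurableSpace X] {Ω : Type*} [MeasurableSpace Ω] {P : Measure Ω}
  [IsProbabilityMeasure P]

/-- The simple integrals of uniformly bounded simple functions are bounded in probability. -/
theorem exists_measureReal_simpleIntegral_le (μ : StochasticMeasure X P) (M : ℝ) {κ : ℝ}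
    (hκ : 0 < κ) : ∃ t : ℝ, 0 ≤ t ∧ ∀ h : SimpleFunc X ℝ, (∀ x, |h x| ≤ M) →
      P.real {ω | t ≤ |μ.simpleIntegral h ω|} ≤ κ := by
  classical
  obtain ⟨t, ht⟩ := μ.exists_measureReal_toFun_le (δ := κ / 20) (by positivity)
  -- the case `|h| ≤ 1/2`: randomization of the values of `h` to `1` and `-1`
  have main : ∀ h : SimpleFunc X ℝ, (∀ x, |h x| ≤ 1 / 2) →
      P.real {ω | 2 * |t| + 1 ≤ |μ.simpleIntegral h ω|} ≤ κ := by
    intro h hh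
    have hset : ∀ T : Finset ℝ, MeasurableSet (h ⁻¹' (T : Set ℝ)) ∧
        μ.toFun (h ⁻¹' (T : Set ℝ)) =ᵐ[P] fun ω => ∑ i ∈ T, μ.toFun (h ⁻¹' {i}) ω := fun T =>
      μ.toFun_preimage_finset h (fun y => h.measurableSet_fiber y) T
    have := measureReal_weighted_sum_le (P := P) h.range id
      (fun y hy => by
        obtain ⟨x, rfl⟩ := SimpleFunc.mem_range.1 hy
        exact hh x)
      (fun y ω => μ.toFun (h ⁻¹' {y}) ω) (fun y => μ.measurable' _ (h.measurableSet_fiber y))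
      (t := 2 * |t| + 1) (κ := κ / 10) (fun T _ => ?_)
    · have h2 : 10 * (κ / 10) = κ := by ring
      rw [h2] at this
      exact this
    · have h1 := ht _ (hset T).1
      have h2 := ht _ (hset (h.range \ T)).1
      refine le_trans ?_ (le_trans (measureReal_union_le _ _)
        (le_trans (add_le_add h1 h2) (by linarith)))
      rw [measureReal_def, measureReal_def]
      refine ENNReal.toReal_mono (measure_ne_top _ _) (measure_mono_ae ?_)
      filter_upwards [(hset T).2, (hset (h.range \ T)).2] with ω e1 e2 hle
      by_contra hnot
      obtain ⟨ha, hb⟩ := not_or.1 hnot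
      replace ha : ¬ t < |μ.toFun (h ⁻¹' (T : Set ℝ)) ω| := ha
      replace hb : ¬ t < |μ.toFun (h ⁻¹' ((h.range \ T : Finset ℝ) : Set ℝ)) ω| := hb
      replace hle : 2 * |t| + 1 ≤ |∑ i ∈ T, μ.toFun (h ⁻¹' {i}) ω -
        ∑ i ∈ h.range \ T, μ.toFun (h ⁻¹' {i}) ω| := hle
      rw [← e1, ← e2] at hle
      have := abs_sub (μ.toFun (h ⁻¹' (T : Set ℝ)) ω)
        (μ.toFun (h ⁻¹' ((h.range \ T : Finset ℝ) : Set ℝ)) ω)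
      have := le_abs_self t
      linarith
  have hM : 0 < 2 * (|M| + 1) := by positivity
  refine ⟨2 * (|M| + 1) * (2 * |t| + 1), by positivity, fun h hh => ?_⟩
  refine le_trans ?_ (main ((2 * (|M| + 1))⁻¹ • h) fun x => ?_)
  · rw [measureReal_def, measureReal_def]
    refine ENNReal.toReal_mono (measure_ne_top _ _) (measure_mono_ae ?_)
    filter_upwards [μ.ae_simpleIntegral_linear (fun _ : Unit => h)] with ω hω hle
    have hle : 2 * (|M| + 1) * (2 * |t| + 1) ≤ |μ.simpleIntegral h ω| := hle
    show _ ≤ |_|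
    rw [hω ((2 * (|M| + 1))⁻¹ • h) (fun _ => (2 * (|M| + 1))⁻¹) (fun x => by simp)]
    simp only [Finset.univ_unique, Finset.sum_singleton, abs_mul, abs_inv, abs_of_pos hM]
    rwa [inv_mul_eq_div, le_div_iff₀ hM, mul_comm]
  · rw [SimpleFunc.smul_apply, smul_eq_mul, abs_mul, abs_inv, abs_of_pos hM, inv_mul_le_iff₀ hM]
    have := hh x
    have := le_abs_self M
    linarith

theorem simpleFunc_sum_apply {J : Type*} (F : Finset J) (g : J → SimpleFunc X ℝ) (x : X) :
    (∑ j ∈ F, g j) x = ∑ j ∈ F, g j x := by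
  classical
  induction F using Finset.induction_on with
  | empty => simp
  | insert j F hj ih => rw [Finset.sum_insert hj, Finset.sum_insert hj, SimpleFunc.add_apply, ih]

/-- If `∑ |φ j|` is bounded, then the integrals of the functions `φ j` are almost surely square
summable. -/
theorem ae_summable_sq_simpleIntegral (μ : StochasticMeasure X P) {J : Type*} [Countable J]
    (φ : J → SimpleFunc X ℝ) (M : ℝ) (hM : ∀ (F : Finset J) (x : X), ∑ j ∈ F, |φ j x| ≤ M) :
    ∀ᵐ ω ∂P, Summable fun j => μ.simpleIntegral (φ j) ω ^ 2 := by
  classical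
  have key : ∀ κ : ℝ, 0 < κ → P {ω | ¬ Summable fun j => μ.simpleIntegral (φ j) ω ^ 2} ≤
      ENNReal.ofReal (12 * κ) := by
    intro κ hκ
    obtain ⟨t, ht0, ht⟩ := μ.exists_measureReal_simpleIntegral_le M hκ
    have hF : ∀ F : Finset J, P {ω | 2 * t ^ 2 ≤ ∑ j ∈ F, μ.simpleIntegral (φ j) ω ^ 2} ≤
        ENNReal.ofReal (12 * κ) := by
      intro F
      rw [← ofReal_measureReal]
      refine ENNReal.ofReal_le_ofReal (measureReal_sum_sq_le F _
        (fun j => μ.measurable_simpleIntegral (φ j)) ht0 fun T hT => ?_)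
      let h : SimpleFunc X ℝ := ∑ j ∈ F, (if j ∈ T then (1 : ℝ) else -1) • φ j
      have hh : ∀ x, h x = ∑ j ∈ F, (if j ∈ T then (1 : ℝ) else -1) * φ j x := by
        intro x
        rw [simpleFunc_sum_apply]
        rfl
      have hb : ∀ x, |h x| ≤ M := by
        intro x
        rw [hh]
        refine (Finset.abs_sum_le_sum_abs _ _).trans (le_trans (Finset.sum_le_sum fun j _ => ?_)
          (hM F x))
        rw [abs_mul]
        split_ifs <;> simp
      refine le_trans ?_ (ht h hb)
      rw [measureReal_def, measureReal_def]
      refine ENNReal.toReal_mono (measure_ne_top _ _) (measure_mono_ae ?_)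
      filter_upwards [μ.ae_simpleIntegral_linear (fun j : F => φ j)] with ω hω hle
      have hle : t ≤ |∑ j ∈ T, μ.simpleIntegral (φ j) ω - ∑ j ∈ F \ T, μ.simpleIntegral (φ j) ω| :=
        hle
      show t ≤ |_|
      rw [hω h (fun j => if (j : J) ∈ T then 1 else -1) fun x => by
        rw [hh, ← Finset.sum_coe_sort F]]
      rw [Finset.sum_coe_sort F fun j =>
        (if j ∈ T then (1 : ℝ) else -1) * μ.simpleIntegral (φ j) ω, ← Finset.sum_sdiff hT]
      convert hle using 2
      rw [add_comm, sub_eq_add_neg, ← Finset.sum_neg_distrib]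
      congr 1
      · exact Finset.sum_congr rfl fun j hj => by rw [if_pos hj, one_mul]
      · exact Finset.sum_congr rfl fun j hj => by
          rw [if_neg (Finset.mem_sdiff.1 hj).2, neg_one_mul]
    have hsub : {ω | ¬ Summable fun j => μ.simpleIntegral (φ j) ω ^ 2} ⊆
        ⋃ F : Finset J, {ω | 2 * t ^ 2 ≤ ∑ j ∈ F, μ.simpleIntegral (φ j) ω ^ 2} := by
      intro ω hω
      by_contra hnot
      simp only [mem_iUnion, not_exists, mem_ofPred_eq, not_le] at hnot
      exact hω (summable_of_sum_le (fun j => sq_nonneg _) fun F => (hnot F).le)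
    refine (measure_mono hsub).trans ?_
    rw [Directed.measure_iUnion]
    · exact iSup_le hF
    · refine directed_of_isDirected_le fun F G hFG ω hω => ?_
      exact le_trans (show 2 * t ^ 2 ≤ _ from hω)
        (Finset.sum_le_sum_of_subset_of_nonneg hFG fun _ _ _ => sq_nonneg _)
  rw [ae_iff]
  refine le_antisymm (ge_of_tendsto' (f := fun n : ℕ => ENNReal.ofReal (12 * (1 / ((n : ℝ) + 1))))
    (x := atTop) ?_ fun n => key _ (by positivity)) zero_le
  have : Tendsto (fun n : ℕ => 12 * (1 / ((n : ℝ) + 1))) atTop (𝓝 (12 * 0)) :=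
    tendsto_one_div_add_atTop_nhds_zero_nat.const_mul 12
  simpa using ENNReal.tendsto_ofReal this

end StochasticMeasure

/-! ### The Haar functions on dyadic cells -/

section HaarCells

/-- The value of the Haar function with number `n ≤ 2 ^ k` on the open dyadic interval number `p`
of length `2 ^ (-k)`. -/
noncomputable def haarVal (n k p : ℕ) : ℝ :=
  if n = 1 then 1
  else if p / 2 ^ (k - (Nat.log 2 (n - 1) + 1)) = 2 * (n - 1 - 2 ^ Nat.log 2 (n - 1)) then
    √(2 ^ Nat.log 2 (n - 1))
  else if p / 2 ^ (k - (Nat.log 2 (n - 1) + 1)) = 2 * (n - 1 - 2 ^ Nat.log 2 (n - 1)) + 1 then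
    -√(2 ^ Nat.log 2 (n - 1))
  else 0

theorem log_lt_of_le_two_pow {n k : ℕ} (hn : 2 ≤ n) (hnk : n ≤ 2 ^ k) :
    Nat.log 2 (n - 1) + 1 ≤ k ∧ 2 ^ Nat.log 2 (n - 1) ≤ n - 1 :=
  ⟨Nat.log_lt_of_lt_pow (by omega) (by omega), Nat.pow_log_le_self 2 (by omega)⟩

theorem haarRight_eq_haarVal {n k p : ℕ} (hn : 1 ≤ n) (hnk : n ≤ 2 ^ k) {x : ℝ}
    (h1 : (p : ℝ) ≤ 2 ^ k * x) (h2 : 2 ^ k * x < p + 1) : haarRight n x = haarVal n k p := by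
  unfold haarRight haarVal
  dsimp only
  by_cases hn1 : n = 1
  · simp [hn1]
  rw [if_neg hn1, if_neg hn1]
  obtain ⟨hjk, hj⟩ := log_lt_of_le_two_pow (by omega) hnk
  set j := Nat.log 2 (n - 1)
  obtain ⟨r, hr⟩ : ∃ r, n = 2 ^ j + r + 1 := ⟨n - 1 - 2 ^ j, by omega⟩
  have hr' : n - 1 - 2 ^ j = r := by omega
  obtain ⟨m, rfl⟩ := Nat.exists_eq_add_of_le hjk
  rw [Nat.add_sub_cancel_left, hr']
  have hi : (n : ℝ) - 2 ^ j = r + 1 := by rw [hr]; push_cast; ring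
  rw [hi]
  set q := p / 2 ^ m with hq
  have hq1 : q * 2 ^ m ≤ p := Nat.div_mul_le_self _ _
  have hq2 : p + 1 ≤ (q + 1) * 2 ^ m := by
    have := Nat.lt_div_mul_add (a := p) (b := 2 ^ m) (by positivity)
    rw [add_mul, one_mul]; exact this
  have hq1' : (q : ℝ) * 2 ^ m ≤ p := by exact_mod_cast hq1
  have hq2' : (p : ℝ) + 1 ≤ (q + 1) * 2 ^ m := by exact_mod_cast hq2
  have hm : (0 : ℝ) < 2 ^ m := by positivity
  have hjp : (0 : ℝ) < 2 ^ (j + 1) := by positivity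
  have e : (2 : ℝ) ^ (j + 1 + m) * x = (2 ^ (j + 1) * x) * 2 ^ m := by rw [pow_add]; ring
  rw [e] at h1 h2
  have a1 : (q : ℝ) ≤ 2 ^ (j + 1) * x := le_of_mul_le_mul_right (hq1'.trans h1) hm
  have a2 : 2 ^ (j + 1) * x < (q : ℝ) + 1 := lt_of_mul_lt_mul_right (h2.trans_le hq2') hm.le
  have c1 : ((r : ℝ) + 1 - 1) / 2 ^ j ≤ x ↔ ((2 * r : ℕ) : ℝ) ≤ 2 ^ (j + 1) * x := by
    rw [div_le_iff₀ (by positivity), pow_succ]; push_cast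
    constructor <;> intro h <;> linarith
  have c2 : x < (2 * ((r : ℝ) + 1) - 1) / 2 ^ (j + 1) ↔
      2 ^ (j + 1) * x < ((2 * r + 1 : ℕ) : ℝ) := by
    rw [lt_div_iff₀ hjp]; push_cast
    constructor <;> intro h <;> linarith
  have c3 : (2 * ((r : ℝ) + 1) - 1) / 2 ^ (j + 1) ≤ x ↔
      ((2 * r + 1 : ℕ) : ℝ) ≤ 2 ^ (j + 1) * x := by
    rw [div_le_iff₀ hjp]; push_cast
    constructor <;> intro h <;> linarith
  have c4 : x < ((r : ℝ) + 1) / 2 ^ j ↔ 2 ^ (j + 1) * x < ((2 * r + 1 + 1 : ℕ) : ℝ) := by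
    rw [lt_div_iff₀ (by positivity), pow_succ]; push_cast
    constructor <;> intro h <;> linarith
  have key : ∀ u : ℕ, ((u : ℝ) ≤ 2 ^ (j + 1) * x ∧ 2 ^ (j + 1) * x < ((u + 1 : ℕ) : ℝ)) ↔ q = u := by
    intro u
    push_cast
    constructor
    · rintro ⟨b1, b2⟩
      have l1 : (q : ℝ) < u + 1 := a1.trans_lt b2
      have l2 : (u : ℝ) < q + 1 := b1.trans_lt a2
      have l1' : q < u + 1 := by exact_mod_cast l1
      have l2' : u < q + 1 := by exact_mod_cast l2
      omega
    · rintro rfl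
      exact ⟨a1, a2⟩
  simp only [c1, c2, c3, c4, key]

theorem haarLeft_eq_haarVal {n k p : ℕ} (hn : 1 ≤ n) (hnk : n ≤ 2 ^ k) {x : ℝ}
    (h1 : (p : ℝ) < 2 ^ k * x) (h2 : 2 ^ k * x ≤ p + 1) : haarLeft n x = haarVal n k p := by
  unfold haarLeft haarVal
  dsimp only
  by_cases hn1 : n = 1
  · simp [hn1]
  rw [if_neg hn1, if_neg hn1]
  obtain ⟨hjk, hj⟩ := log_lt_of_le_two_pow (by omega) hnk
  set j := Nat.log 2 (n - 1)
  obtain ⟨r, hr⟩ : ∃ r, n = 2 ^ j + r + 1 := ⟨n - 1 - 2 ^ j, by omega⟩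
  have hr' : n - 1 - 2 ^ j = r := by omega
  obtain ⟨m, rfl⟩ := Nat.exists_eq_add_of_le hjk
  rw [Nat.add_sub_cancel_left, hr']
  have hi : (n : ℝ) - 2 ^ j = r + 1 := by rw [hr]; push_cast; ring
  rw [hi]
  set q := p / 2 ^ m with hq
  have hq1 : q * 2 ^ m ≤ p := Nat.div_mul_le_self _ _
  have hq2 : p + 1 ≤ (q + 1) * 2 ^ m := by
    have := Nat.lt_div_mul_add (a := p) (b := 2 ^ m) (by positivity)
    rw [add_mul, one_mul]; exact this
  have hq1' : (q : ℝ) * 2 ^ m ≤ p := by exact_mod_cast hq1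
  have hq2' : (p : ℝ) + 1 ≤ (q + 1) * 2 ^ m := by exact_mod_cast hq2
  have hm : (0 : ℝ) < 2 ^ m := by positivity
  have hjp : (0 : ℝ) < 2 ^ (j + 1) := by positivity
  have e : (2 : ℝ) ^ (j + 1 + m) * x = (2 ^ (j + 1) * x) * 2 ^ m := by rw [pow_add]; ring
  rw [e] at h1 h2
  have a1 : (q : ℝ) < 2 ^ (j + 1) * x := lt_of_mul_lt_mul_right (hq1'.trans_lt h1) hm.le
  have a2 : 2 ^ (j + 1) * x ≤ (q : ℝ) + 1 := le_of_mul_le_mul_right (h2.trans hq2') hm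
  have c1 : ((r : ℝ) + 1 - 1) / 2 ^ j < x ↔ ((2 * r : ℕ) : ℝ) < 2 ^ (j + 1) * x := by
    rw [div_lt_iff₀ (by positivity), pow_succ]; push_cast
    constructor <;> intro h <;> linarith
  have c2 : x ≤ (2 * ((r : ℝ) + 1) - 1) / 2 ^ (j + 1) ↔
      2 ^ (j + 1) * x ≤ ((2 * r + 1 : ℕ) : ℝ) := by
    rw [le_div_iff₀ hjp]; push_cast
    constructor <;> intro h <;> linarith
  have c3 : (2 * ((r : ℝ) + 1) - 1) / 2 ^ (j + 1) < x ↔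
      ((2 * r + 1 : ℕ) : ℝ) < 2 ^ (j + 1) * x := by
    rw [div_lt_iff₀ hjp]; push_cast
    constructor <;> intro h <;> linarith
  have c4 : x ≤ ((r : ℝ) + 1) / 2 ^ j ↔ 2 ^ (j + 1) * x ≤ ((2 * r + 1 + 1 : ℕ) : ℝ) := by
    rw [le_div_iff₀ (by positivity), pow_succ]; push_cast
    constructor <;> intro h <;> linarith
  have key : ∀ u : ℕ, ((u : ℝ) < 2 ^ (j + 1) * x ∧ 2 ^ (j + 1) * x ≤ ((u + 1 : ℕ) : ℝ)) ↔ q = u := by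
    intro u
    push_cast
    constructor
    · rintro ⟨b1, b2⟩
      have l1 : (q : ℝ) < u + 1 := a1.trans_le b2
      have l2 : (u : ℝ) < q + 1 := b1.trans_le a2
      have l1' : q < u + 1 := by exact_mod_cast l1
      have l2' : u < q + 1 := by exact_mod_cast l2
      omega
    · rintro rfl
      exact ⟨a1, a2⟩
  simp only [c1, c2, c3, c4, key]

theorem haarVal_succ {n k p : ℕ} (hn : 1 ≤ n) (hnk : n ≤ 2 ^ k) :
    haarVal n (k + 1) p = haarVal n k (p / 2) := by
  unfold haarVal
  by_cases hn1 : n = 1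
  · simp [hn1]
  obtain ⟨hjk, -⟩ := log_lt_of_le_two_pow (by omega) hnk
  rw [show k + 1 - (Nat.log 2 (n - 1) + 1) = k - (Nat.log 2 (n - 1) + 1) + 1 by omega, pow_succ,
    mul_comm, ← Nat.div_div_eq_div_mul]

theorem haarVal_top {k r p : ℕ} (hr : r < 2 ^ k) :
    haarVal (2 ^ k + r + 1) (k + 1) p =
      if p = 2 * r then √(2 ^ k) else if p = 2 * r + 1 then -√(2 ^ k) else 0 := by
  unfold haarVal
  have hlog : Nat.log 2 (2 ^ k + r + 1 - 1) = k := by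
    rw [Nat.add_sub_cancel]
    refine Nat.log_eq_of_pow_le_of_lt_pow (by omega) ?_
    rw [pow_succ]; omega
  have h2 : 0 < 2 ^ k := by positivity
  rw [if_neg (by omega), hlog, Nat.sub_self, pow_zero, Nat.div_one,
    show 2 ^ k + r + 1 - 1 - 2 ^ k = r by omega]

/-- The Haar functions with numbers up to `2 ^ k` form a complete orthogonal system on the cells of
level `k`. -/
theorem sum_haarVal_mul (k : ℕ) : ∀ p p' : ℕ, p < 2 ^ k → p' < 2 ^ k →
    ∑ n ∈ Finset.Icc 1 (2 ^ k), haarVal n k p * haarVal n k p' = if p = p' then 2 ^ k else 0 := by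
  induction k with
  | zero =>
    intro p p' hp hp'
    have h1 : p = 0 := by simpa using hp
    have h2 : p' = 0 := by simpa using hp'
    simp [h1, h2, haarVal]
  | succ k ih =>
    intro p p' hp hp'
    have hsplit : Finset.Icc 1 (2 ^ (k + 1)) = Finset.Icc 1 (2 ^ k) ∪
        (Finset.range (2 ^ k)).image (fun r => 2 ^ k + r + 1) := by
      ext n
      simp only [Finset.mem_Icc, Finset.mem_union, Finset.mem_image, Finset.mem_range, pow_succ]
      constructor
      · rintro ⟨h1, h2⟩
        rcases le_or_gt n (2 ^ k) with h | h
        · exact Or.inl ⟨h1, h⟩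
        · exact Or.inr ⟨n - 2 ^ k - 1, by omega, by omega⟩
      · rintro (⟨h1, h2⟩ | ⟨r, hr, rfl⟩)
        · exact ⟨h1, by omega⟩
        · exact ⟨by omega, by omega⟩
    have hdisj : Disjoint (Finset.Icc 1 (2 ^ k))
        ((Finset.range (2 ^ k)).image (fun r => 2 ^ k + r + 1)) := by
      rw [Finset.disjoint_left]
      intro n hn hn'
      simp only [Finset.mem_Icc, Finset.mem_image] at hn hn'
      obtain ⟨r, -, rfl⟩ := hn'
      omega
    rw [hsplit, Finset.sum_union hdisj, Finset.sum_image (by intro a _ b _ h; simpa using h)]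
    have e1 : ∑ n ∈ Finset.Icc 1 (2 ^ k), haarVal n (k + 1) p * haarVal n (k + 1) p' =
        if p / 2 = p' / 2 then 2 ^ k else 0 := by
      rw [← ih (p / 2) (p' / 2) (by rw [pow_succ] at hp; omega) (by rw [pow_succ] at hp'; omega)]
      refine Finset.sum_congr rfl fun n hn => ?_
      rw [Finset.mem_Icc] at hn
      rw [haarVal_succ hn.1 hn.2, haarVal_succ hn.1 hn.2]
    have hsq : √(2 ^ k : ℝ) * √(2 ^ k) = 2 ^ k := Real.mul_self_sqrt (by positivity)
    have e2 : ∑ r ∈ Finset.range (2 ^ k),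
        haarVal (2 ^ k + r + 1) (k + 1) p * haarVal (2 ^ k + r + 1) (k + 1) p' =
        if p / 2 = p' / 2 then (if p = p' then 2 ^ k else -2 ^ k) else 0 := by
      rw [Finset.sum_eq_single (p / 2)]
      · rw [haarVal_top (by rw [pow_succ] at hp; omega)]
        rcases Nat.even_or_odd' p with ⟨u, rfl | rfl⟩ <;>
          rcases Nat.even_or_odd' p' with ⟨v, rfl | rfl⟩
        all_goals
          rw [haarVal_top (by rw [pow_succ] at hp; omega)]
          split_ifs <;> first | omega | linarith
      · intro r hr hne
        rw [haarVal_top (Finset.mem_range.1 hr), if_neg (by omega), if_neg (by omega), zero_mul]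
      · intro h
        exact absurd (Finset.mem_range.2 (by rw [pow_succ] at hp; omega)) h
    rw [e1, e2, pow_succ]
    split_ifs <;> first | omega | ring

/-- The number of the cell of level `k` that contains `x`: even numbers belong to the dyadic
points, odd numbers to the open intervals between them. -/
noncomputable def cellIndex (k : ℕ) (x : ℝ) : ℕ := ⌊2 ^ k * x⌋₊ + ⌈2 ^ k * x⌉₊

/-- The number of the dyadic interval of level `k` to the right of the cell `c`. -/
def rightCell (k c : ℕ) : ℕ := min (c / 2) (2 ^ k - 1)

/-- The number of the dyadic interval to the left of the cell `c`. -/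
def leftCell (c : ℕ) : ℕ := (c + 1) / 2 - 1

theorem cellIndex_div_two (k : ℕ) (x : ℝ) :
    cellIndex k x / 2 = ⌊2 ^ k * x⌋₊ ∧ (cellIndex k x + 1) / 2 = ⌈2 ^ k * x⌉₊ := by
  have h1 : ⌊(2 : ℝ) ^ k * x⌋₊ ≤ ⌈(2 : ℝ) ^ k * x⌉₊ := Nat.floor_le_ceil _
  have h2 : ⌈(2 : ℝ) ^ k * x⌉₊ ≤ ⌊(2 : ℝ) ^ k * x⌋₊ + 1 := Nat.ceil_le_floor_add_one _
  unfold cellIndex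
  omega

theorem cellIndex_le {k : ℕ} {x : ℝ} (hx : x ≤ 1) : cellIndex k x ≤ 2 ^ (k + 1) := by
  have h : (2 : ℝ) ^ k * x ≤ ((2 ^ k : ℕ) : ℝ) := by
    push_cast
    exact mul_le_of_le_one_right (by positivity) hx
  have h1 : ⌊(2 : ℝ) ^ k * x⌋₊ ≤ 2 ^ k := Nat.floor_le_of_le h
  have h2 : ⌈(2 : ℝ) ^ k * x⌉₊ ≤ 2 ^ k := Nat.ceil_le.2 h
  unfold cellIndex
  rw [pow_succ]; omega

theorem rightCell_lt (k c : ℕ) : rightCell k c < 2 ^ k := by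
  have : 0 < 2 ^ k := by positivity
  unfold rightCell; omega

theorem leftCell_cellIndex_lt {k : ℕ} {x : ℝ} (hx : x ≤ 1) : leftCell (cellIndex k x) < 2 ^ k := by
  have := cellIndex_le (k := k) hx
  have h0 : 0 < 2 ^ k := by positivity
  rw [pow_succ] at this
  unfold leftCell; omega

theorem rightCell_cellIndex_mem {k : ℕ} {x : ℝ} (hx : x ∈ Icc (0 : ℝ) 1) :
    (rightCell k (cellIndex k x) : ℝ) ≤ 2 ^ k * x ∧
      2 ^ k * x ≤ rightCell k (cellIndex k x) + 1 ∧
      (x < 1 → 2 ^ k * x < rightCell k (cellIndex k x) + 1) := by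
  have hk : (0 : ℝ) < 2 ^ k := by positivity
  have h0 : 0 ≤ 2 ^ k * x := mul_nonneg hk.le hx.1
  have hk1 : 2 ^ k * x ≤ 2 ^ k := mul_le_of_le_one_right hk.le hx.2
  have hN : 1 ≤ 2 ^ k := Nat.one_le_two_pow
  have hc : ((2 ^ k - 1 : ℕ) : ℝ) = 2 ^ k - 1 := by push_cast [Nat.cast_sub hN]; ring
  have hf := Nat.floor_le h0
  have hf' := Nat.lt_floor_add_one ((2 : ℝ) ^ k * x)
  unfold rightCell
  rw [(cellIndex_div_two k x).1]
  rcases le_or_gt ⌊(2 : ℝ) ^ k * x⌋₊ (2 ^ k - 1) with h | h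
  · rw [min_eq_left h]
    exact ⟨hf, hf'.le, fun _ => hf'⟩
  · rw [min_eq_right h.le, hc]
    have h' : (2 : ℝ) ^ k ≤ ⌊(2 : ℝ) ^ k * x⌋₊ := by
      have : 2 ^ k ≤ ⌊(2 : ℝ) ^ k * x⌋₊ := by omega
      exact_mod_cast this
    refine ⟨by linarith, by linarith, fun hx1 => ?_⟩
    have : 2 ^ k * x < 2 ^ k := mul_lt_of_lt_one_right hk hx1
    linarith

theorem leftCell_cellIndex_mem {k : ℕ} {x : ℝ} (hx : x ∈ Icc (0 : ℝ) 1) :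
    (leftCell (cellIndex k x) : ℝ) ≤ 2 ^ k * x ∧ 2 ^ k * x ≤ leftCell (cellIndex k x) + 1 ∧
      (0 < x → (leftCell (cellIndex k x) : ℝ) < 2 ^ k * x) := by
  have hk : (0 : ℝ) < 2 ^ k := by positivity
  have h0 : 0 ≤ 2 ^ k * x := mul_nonneg hk.le hx.1
  unfold leftCell
  rw [(cellIndex_div_two k x).2]
  rcases hx.1.eq_or_lt with h | h
  · rw [← h]; simp
  · have hpos : 0 < 2 ^ k * x := mul_pos hk h
    have hc : 0 < ⌈(2 : ℝ) ^ k * x⌉₊ := Nat.ceil_pos.2 hpos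
    have hcast : ((⌈(2 : ℝ) ^ k * x⌉₊ - 1 : ℕ) : ℝ) = ⌈(2 : ℝ) ^ k * x⌉₊ - 1 := by
      push_cast [Nat.cast_sub hc]; ring
    have h1 := Nat.ceil_lt_add_one h0
    have h2 := Nat.le_ceil ((2 : ℝ) ^ k * x)
    rw [hcast]
    exact ⟨by linarith, by linarith, fun _ => by linarith⟩

theorem haar_eq_haarVal {n k : ℕ} (hn : 1 ≤ n) (hnk : n ≤ 2 ^ k) {x : ℝ} (hx : x ∈ Icc (0 : ℝ) 1) :
    haar n x = (haarVal n k (leftCell (cellIndex k x)) +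
      haarVal n k (rightCell k (cellIndex k x))) / 2 := by
  obtain ⟨r1, r2, r3⟩ := rightCell_cellIndex_mem (k := k) hx
  obtain ⟨l1, l2, l3⟩ := leftCell_cellIndex_mem (k := k) hx
  unfold haar
  split_ifs with h0 h1
  · subst h0
    have e1 : rightCell k (cellIndex k 0) = 0 := by simp [rightCell, cellIndex]
    have e2 : leftCell (cellIndex k 0) = 0 := by simp [leftCell, cellIndex]
    rw [haarRight_eq_haarVal hn hnk r1 (r3 one_pos), e1, e2]; ring
  · subst h1
    have hcell : cellIndex k 1 = 2 ^ k + 2 ^ k := by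
      have : (2 : ℝ) ^ k * 1 = ((2 ^ k : ℕ) : ℝ) := by push_cast; ring
      simp only [cellIndex, this, Nat.floor_natCast, Nat.ceil_natCast]
    have h2 : 0 < 2 ^ k := by positivity
    have e1 : rightCell k (cellIndex k 1) = 2 ^ k - 1 := by rw [hcell]; unfold rightCell; omega
    have e2 : leftCell (cellIndex k 1) = 2 ^ k - 1 := by rw [hcell]; unfold leftCell; omega
    rw [haarLeft_eq_haarVal hn hnk (l3 one_pos) l2, e1, e2]; ring
  · have hx0 : 0 < x := lt_of_le_of_ne hx.1 (Ne.symm h0)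
    have hx1 : x < 1 := lt_of_le_of_ne hx.2 h1
    rw [haarLeft_eq_haarVal hn hnk (l3 hx0) l2, haarRight_eq_haarVal hn hnk r1 (r3 hx1)]

end HaarCells

/-! ### Haar sums as local averages -/

section HaarKernel

variable {d : ℕ}

/-- The kernel `2 ^ k * (1_L + 1_R) / 2`, where `L` and `R` are the dyadic intervals of level `k`
to the left and to the right of the cell `c`. -/
noncomputable def cellDensity (k c : ℕ) (t : ℝ) : ℝ :=
  2 ^ k / 2 * ((Ico ((leftCell c : ℝ) / 2 ^ k) ((leftCell c + 1) / 2 ^ k)).indicator 1 t +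
    (Ico ((rightCell k c : ℝ) / 2 ^ k) ((rightCell k c + 1) / 2 ^ k)).indicator 1 t)

theorem cellDensity_nonneg (k c : ℕ) (t : ℝ) : 0 ≤ cellDensity k c t :=
  mul_nonneg (by positivity) (add_nonneg (indicator_nonneg (fun _ _ => zero_le_one) _)
    (indicator_nonneg (fun _ _ => zero_le_one) _))

theorem measurable_cellDensity (k c : ℕ) : Measurable (cellDensity k c) :=
  ((measurable_one.indicator measurableSet_Ico).add
    (measurable_one.indicator measurableSet_Ico)).const_mul _

theorem cellDensity_le (k c : ℕ) (t : ℝ) : cellDensity k c t ≤ 2 ^ k := by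
  have h : ∀ s : Set ℝ, s.indicator (1 : ℝ → ℝ) t ≤ 1 := fun s =>
    indicator_le_self' (f := (1 : ℝ → ℝ)) (fun _ _ => zero_le_one) t
  have hk : (0 : ℝ) < 2 ^ k / 2 := by positivity
  unfold cellDensity
  calc _ ≤ 2 ^ k / 2 * ((1 : ℝ) + 1) := mul_le_mul_of_nonneg_left (add_le_add (h _) (h _)) hk.le
    _ = 2 ^ k := by ring

theorem mem_Ico_dyadic_iff {k p q : ℕ} {t : ℝ} (h1 : (q : ℝ) ≤ 2 ^ k * t) (h2 : 2 ^ k * t < q + 1) :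
    t ∈ Ico ((p : ℝ) / 2 ^ k) ((p + 1) / 2 ^ k) ↔ p = q := by
  have hk : (0 : ℝ) < 2 ^ k := by positivity
  rw [mem_Ico, div_le_iff₀ hk, lt_div_iff₀ hk, mul_comm t]
  constructor
  · rintro ⟨b1, b2⟩
    have l1 : (q : ℝ) < p + 1 := h1.trans_lt b2
    have l2 : (p : ℝ) < q + 1 := b1.trans_lt h2
    have l1' : q < p + 1 := by exact_mod_cast l1
    have l2' : p < q + 1 := by exact_mod_cast l2
    omega
  · rintro rfl
    exact ⟨h1, h2⟩

/-- The one-dimensional kernel of the Haar sums, except at the dyadic points `t` of level `k`. -/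
theorem ae_sum_haar_mul_haar (k : ℕ) {x : ℝ} (hx : x ∈ Icc (0 : ℝ) 1) :
    ∀ᵐ t : ℝ, t ∈ Icc (0 : ℝ) 1 →
      ∑ n ∈ Finset.Icc 1 (2 ^ k), haar n x * haar n t = cellDensity k (cellIndex k x) t := by
  have hcount : (range fun n : ℕ => (n : ℝ) / 2 ^ k).Countable := countable_range _
  filter_upwards [hcount.ae_notMem volume] with t ht ht01
  have hk : (0 : ℝ) < 2 ^ k := by positivity
  have hne : ∀ n : ℕ, (n : ℝ) ≠ 2 ^ k * t := fun n hn =>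
    ht ⟨n, by simp only [hn]; field_simp⟩
  have ht0 : 0 < t := lt_of_le_of_ne ht01.1 fun h => hne 0 (by rw [← h]; simp)
  have ht1 : t < 1 := lt_of_le_of_ne ht01.2 fun h => hne (2 ^ k) (by rw [h]; simp)
  obtain ⟨r1, r2, r3⟩ := rightCell_cellIndex_mem (k := k) ht01
  obtain ⟨l1, l2, l3⟩ := leftCell_cellIndex_mem (k := k) ht01
  set q := rightCell k (cellIndex k t) with hq
  have hqlt : q < 2 ^ k := rightCell_lt _ _
  have hql : leftCell (cellIndex k t) = q := by
    have h2 : 2 ^ k * t < leftCell (cellIndex k t) + 1 := lt_of_le_of_ne l2 fun h =>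
      hne (leftCell (cellIndex k t) + 1) (by push_cast; exact h.symm)
    have a1 : (q : ℝ) < leftCell (cellIndex k t) + 1 := r1.trans_lt h2
    have a2 : (leftCell (cellIndex k t) : ℝ) < q + 1 := l1.trans_lt (r3 ht1)
    have a1' : q < leftCell (cellIndex k t) + 1 := by exact_mod_cast a1
    have a2' : leftCell (cellIndex k t) < q + 1 := by exact_mod_cast a2
    omega
  have hsum : ∀ n ∈ Finset.Icc 1 (2 ^ k), haar n x * haar n t =
      (haarVal n k (leftCell (cellIndex k x)) * haarVal n k q +
        haarVal n k (rightCell k (cellIndex k x)) * haarVal n k q) / 2 := by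
    intro n hn
    rw [Finset.mem_Icc] at hn
    rw [haar_eq_haarVal hn.1 hn.2 hx, haar_eq_haarVal hn.1 hn.2 ht01, hql, ← hq]
    ring
  rw [Finset.sum_congr rfl hsum, ← Finset.sum_div, Finset.sum_add_distrib,
    sum_haarVal_mul k _ _ (leftCell_cellIndex_lt hx.2) hqlt,
    sum_haarVal_mul k _ _ (rightCell_lt _ _) hqlt]
  unfold cellDensity
  simp only [indicator_apply, mem_Ico_dyadic_iff r1 (r3 ht1), Pi.one_apply]
  split_ifs <;> ring

theorem integral_indicator_dyadic {k p : ℕ} (hp : p < 2 ^ k) :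
    ∫ t in Icc (0 : ℝ) 1, (Ico ((p : ℝ) / 2 ^ k) ((p + 1) / 2 ^ k)).indicator (1 : ℝ → ℝ) t =
      (2 ^ k)⁻¹ := by
  have hk : (0 : ℝ) < 2 ^ k := by positivity
  have hp' : (p : ℝ) + 1 ≤ 2 ^ k := by exact_mod_cast hp
  rw [integral_indicator_one measurableSet_Ico, measureReal_restrict_apply measurableSet_Ico,
    inter_eq_left.2, Real.volume_real_Ico]
  · rw [max_eq_left]
    · field_simp; ring
    · rw [← sub_div]; apply div_nonneg _ hk.le; linarith
  · refine fun t ht => ⟨le_trans (by positivity) ht.1, ht.2.le.trans ?_⟩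
    rwa [div_le_one hk]

theorem integrable_indicator_dyadic (k p : ℕ) :
    Integrable (fun t => (Ico ((p : ℝ) / 2 ^ k) ((p + 1) / 2 ^ k)).indicator (1 : ℝ → ℝ) t)
      (volume.restrict (Icc (0 : ℝ) 1)) :=
  (integrable_const (1 : ℝ)).indicator measurableSet_Ico

theorem integral_cellDensity (k : ℕ) {x : ℝ} (hx : x ∈ Icc (0 : ℝ) 1) :
    ∫ t in Icc (0 : ℝ) 1, cellDensity k (cellIndex k x) t = 1 := by
  unfold cellDensity
  rw [integral_const_mul, integral_add (integrable_indicator_dyadic _ _)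
    (integrable_indicator_dyadic _ _), integral_indicator_dyadic (leftCell_cellIndex_lt hx.2),
    integral_indicator_dyadic (rightCell_lt _ _)]
  field_simp
  ring

theorem abs_sub_le_of_cellDensity_ne_zero {k : ℕ} {x t : ℝ} (hx : x ∈ Icc (0 : ℝ) 1)
    (h : cellDensity k (cellIndex k x) t ≠ 0) : |t - x| ≤ (2 ^ k)⁻¹ := by
  have hk : (0 : ℝ) < 2 ^ k := by positivity
  obtain ⟨r1, r2, r3⟩ := rightCell_cellIndex_mem (k := k) hx
  obtain ⟨l1, l2, l3⟩ := leftCell_cellIndex_mem (k := k) hx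
  have key : ∀ p : ℕ, (p : ℝ) ≤ 2 ^ k * x → 2 ^ k * x ≤ p + 1 →
      t ∈ Ico ((p : ℝ) / 2 ^ k) ((p + 1) / 2 ^ k) → |t - x| ≤ (2 ^ k)⁻¹ := by
    intro p h1 h2 ht
    rw [mem_Ico, div_le_iff₀ hk, lt_div_iff₀ hk] at ht
    rw [← one_div, le_div_iff₀ hk, ← abs_of_pos hk, ← abs_mul, abs_le]
    constructor <;> nlinarith [ht.1, ht.2]
  by_contra hcon
  apply h
  unfold cellDensity
  rw [indicator_of_notMem fun ht => hcon (key _ l1 l2 ht),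
    indicator_of_notMem fun ht => hcon (key _ r1 r2 ht)]
  simp

/-- The kernel of the Haar sum of order `2 ^ k` at the point `x` of the cube. -/
noncomputable def haarKernel (k : ℕ) (x t : Fin d → ℝ) : ℝ :=
  ∏ s, cellDensity k (cellIndex k (x s)) (t s)

theorem haarKernel_nonneg (k : ℕ) (x t : Fin d → ℝ) : 0 ≤ haarKernel k x t :=
  Finset.prod_nonneg fun _ _ => cellDensity_nonneg _ _ _

theorem measurable_haarKernel (k : ℕ) (x : Fin d → ℝ) : Measurable (haarKernel k x) :=
  Finset.measurable_prod _ fun s _ => (measurable_cellDensity _ _).comp (measurable_pi_apply s)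

theorem haarKernel_le (k : ℕ) (x t : Fin d → ℝ) : haarKernel k x t ≤ (2 ^ k) ^ d := by
  refine (Finset.prod_le_prod (fun s _ => cellDensity_nonneg _ _ _)
    fun s _ => cellDensity_le _ _ _).trans ?_
  simp

theorem volume_restrict_cube :
    (volume : Measure (Fin d → ℝ)).restrict (Icc 0 1) =
      Measure.pi fun _ : Fin d => (volume : Measure ℝ).restrict (Icc 0 1) := by
  rw [← Measure.restrict_pi_pi, ← volume_pi, ← pi_univ_Icc]
  rfl

theorem integral_haarKernel (k : ℕ) {x : Fin d → ℝ} (hx : x ∈ Icc (0 : Fin d → ℝ) 1) :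
    ∫ t in Icc (0 : Fin d → ℝ) 1, haarKernel k x t = 1 := by
  rw [volume_restrict_cube]
  unfold haarKernel
  rw [integral_fintype_prod_eq_prod (fun s t => cellDensity k (cellIndex k (x s)) t)]
  exact Finset.prod_eq_one fun s _ => integral_cellDensity k ⟨hx.1 s, hx.2 s⟩

instance isFiniteMeasure_restrict_cube :
    IsFiniteMeasure ((volume : Measure (Fin d → ℝ)).restrict (Icc 0 1)) :=
  ⟨by rw [Measure.restrict_apply_univ]; exact isCompact_Icc.measure_lt_top⟩

theorem integrable_mul_of_abs_le {α : Type*} [MeasurableSpace α] {ν : Measure α} {g h : α → ℝ}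
    (hg : Integrable g ν) (hh : Measurable h) (c : ℝ) (hc : ∀ t, |h t| ≤ c) :
    Integrable (fun t => g t * h t) ν :=
  hg.mul_bdd (c := c) hh.aestronglyMeasurable (Eventually.of_forall hc)

theorem integrable_mul_haarMulti {g : (Fin d → ℝ) → ℝ}
    (hg : IntegrableOn g (Icc (0 : Fin d → ℝ) 1)) (n : Fin d → ℕ) :
    IntegrableOn (fun t => g t * haarMulti n t) (Icc (0 : Fin d → ℝ) 1) := by
  obtain ⟨c, hc⟩ := ((finite_range_haarMulti n).image abs).bddAbove
  exact integrable_mul_of_abs_le hg (measurable_haarMulti n) c fun t =>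
    hc ⟨_, ⟨t, rfl⟩, rfl⟩

theorem integrable_mul_haarKernel {g : (Fin d → ℝ) → ℝ}
    (hg : IntegrableOn g (Icc (0 : Fin d → ℝ) 1)) (k : ℕ) (x : Fin d → ℝ) :
    IntegrableOn (fun t => g t * haarKernel k x t) (Icc (0 : Fin d → ℝ) 1) :=
  integrable_mul_of_abs_le hg (measurable_haarKernel k x) _ fun t => by
    rw [abs_of_nonneg (haarKernel_nonneg k x t)]
    exact haarKernel_le k x t

/-- Haar sums are averages with the probability density `haarKernel k x`. -/
theorem haarSum_eq_integral {g : (Fin d → ℝ) → ℝ} (hg : IntegrableOn g (Icc (0 : Fin d → ℝ) 1))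
    (k : ℕ) {x : Fin d → ℝ} (hx : x ∈ Icc (0 : Fin d → ℝ) 1) :
    haarSum k g x = ∫ t in Icc (0 : Fin d → ℝ) 1, g t * haarKernel k x t := by
  unfold haarSum haarCoeff
  simp_rw [← integral_mul_const]
  rw [← integral_finsetSum _ fun n _ => (integrable_mul_haarMulti hg n).mul_const _]
  refine integral_congr_ae ?_
  have hae : ∀ᵐ t ∂((volume : Measure (Fin d → ℝ)).restrict (Icc 0 1)), ∀ s,
      ∑ n ∈ Finset.Icc 1 (2 ^ k), haar n (x s) * haar n (t s) =
        cellDensity k (cellIndex k (x s)) (t s) := by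
    rw [volume_restrict_cube, ae_all_iff]
    intro s
    have h1 := (ae_restrict_iff' measurableSet_Icc).2
      (ae_sum_haar_mul_haar k (x := x s) ⟨hx.1 s, hx.2 s⟩)
    exact (Measure.tendsto_eval_ae_ae (i := s)
      (μ := fun _ : Fin d => (volume : Measure ℝ).restrict (Icc 0 1))).eventually h1
  filter_upwards [hae] with t ht
  unfold haarKernel haarMulti haarIndex
  simp_rw [← ht, Finset.prod_univ_sum, Finset.mul_sum, Finset.prod_mul_distrib]
  exact Finset.sum_congr rfl fun n _ => by ring

theorem norm_sub_le_of_haarKernel_ne_zero {k : ℕ} {x t : Fin d → ℝ}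
    (hx : x ∈ Icc (0 : Fin d → ℝ) 1) (h : haarKernel k x t ≠ 0) : ‖t - x‖ ≤ (2 ^ k)⁻¹ := by
  rw [pi_norm_le_iff_of_nonneg (by positivity)]
  intro s
  exact abs_sub_le_of_cellDensity_ne_zero ⟨hx.1 s, hx.2 s⟩
    (Finset.prod_ne_zero_iff.1 h s (Finset.mem_univ s))

/-- The Haar sum of order `2 ^ k` at `x` is bounded by the values of the function at distance
at most `2 ^ (-k)` from `x`. -/
theorem abs_haarSum_le {g : (Fin d → ℝ) → ℝ} (hg : ContinuousOn g (Icc (0 : Fin d → ℝ) 1))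
    {k : ℕ} {x : Fin d → ℝ} (hx : x ∈ Icc (0 : Fin d → ℝ) 1) {M : ℝ}
    (hM : ∀ t ∈ Icc (0 : Fin d → ℝ) 1, ‖t - x‖ ≤ (2 ^ k)⁻¹ → |g t| ≤ M) :
    |haarSum k g x| ≤ M := by
  rw [haarSum_eq_integral (hg.integrableOn_compact isCompact_Icc) k hx]
  have hint : Integrable (fun t => M * haarKernel k x t)
      ((volume : Measure (Fin d → ℝ)).restrict (Icc 0 1)) :=
    integrable_mul_haarKernel (integrable_const M) k x
  rw [← Real.norm_eq_abs]
  refine (norm_integral_le_of_norm_le hint ?_).trans_eq ?_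
  · refine (ae_restrict_iff' measurableSet_Icc).2 (Eventually.of_forall fun t ht => ?_)
    rw [norm_mul, Real.norm_eq_abs, Real.norm_eq_abs, abs_of_nonneg (haarKernel_nonneg k x t)]
    by_cases h : haarKernel k x t = 0
    · rw [h, mul_zero, mul_zero]
    · exact mul_le_mul_of_nonneg_right (hM t ht (norm_sub_le_of_haarKernel_ne_zero hx h))
        (haarKernel_nonneg k x t)
  · rw [integral_const_mul, integral_haarKernel k hx, mul_one]

theorem haarSum_const (k : ℕ) (v : ℝ) {x : Fin d → ℝ} (hx : x ∈ Icc (0 : Fin d → ℝ) 1) :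
    haarSum k (fun _ => v) x = v := by
  rw [haarSum_eq_integral (integrable_const v) k hx, integral_const_mul, integral_haarKernel k hx,
    mul_one]

theorem haarSum_sum {J : Type*} (F : Finset J) (c : J → ℝ) {g : J → (Fin d → ℝ) → ℝ}
    (hg : ∀ j ∈ F, ContinuousOn (g j) (Icc (0 : Fin d → ℝ) 1)) (k : ℕ) (x : Fin d → ℝ) :
    haarSum k (fun t => ∑ j ∈ F, c j * g j t) x = ∑ j ∈ F, c j * haarSum k (g j) x := by
  have hc : ∀ n : Fin d → ℕ, haarCoeff n (fun t => ∑ j ∈ F, c j * g j t) =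
      ∑ j ∈ F, c j * haarCoeff n (g j) := by
    intro n
    unfold haarCoeff
    simp_rw [Finset.sum_mul, mul_assoc]
    rw [integral_finsetSum _ fun j hj => (integrable_mul_haarMulti
      ((hg j hj).integrableOn_compact isCompact_Icc) n).const_mul (c j)]
    simp_rw [integral_const_mul]
  unfold haarSum
  simp_rw [hc, Finset.sum_mul, Finset.mul_sum]
  rw [Finset.sum_comm]
  simp_rw [mul_assoc]

theorem haarSum_sub {g h : (Fin d → ℝ) → ℝ} (hg : ContinuousOn g (Icc (0 : Fin d → ℝ) 1))
    (hh : ContinuousOn h (Icc (0 : Fin d → ℝ) 1)) (k : ℕ) (x : Fin d → ℝ) :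
    haarSum k (fun t => g t - h t) x = haarSum k g x - haarSum k h x := by
  have h2 := haarSum_sum (Finset.univ : Finset (Fin 2)) ![1, -1] (g := ![g, h])
    (by intro j _; fin_cases j <;> assumption) k x
  simpa [Fin.sum_univ_two, ← sub_eq_add_neg] using h2

theorem haarSum_const_mul (c : ℝ) (g : (Fin d → ℝ) → ℝ) (k : ℕ) (x : Fin d → ℝ) :
    haarSum k (fun t => c * g t) x = c * haarSum k g x := by
  unfold haarSum haarCoeff
  simp_rw [mul_assoc, integral_const_mul, Finset.mul_sum]
  simp_rw [mul_assoc]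

/-- Haar sums of order `2 ^ k` are constant on the cells of level `k`. -/
theorem haarSum_eq_of_cellIndex_eq (g : (Fin d → ℝ) → ℝ) {k : ℕ} {x y : Fin d → ℝ}
    (hx : x ∈ Icc (0 : Fin d → ℝ) 1) (hy : y ∈ Icc (0 : Fin d → ℝ) 1)
    (h : ∀ s, cellIndex k (x s) = cellIndex k (y s)) : haarSum k g x = haarSum k g y := by
  unfold haarSum haarMulti
  refine Finset.sum_congr rfl fun n hn => ?_
  congr 1
  refine Finset.prod_congr rfl fun s _ => ?_
  have hn' := Finset.mem_Icc.1 (Fintype.mem_piFinset.1 hn s)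
  rw [haar_eq_haarVal hn'.1 hn'.2 ⟨hx.1 s, hx.2 s⟩, haar_eq_haarVal hn'.1 hn'.2 ⟨hy.1 s, hy.2 s⟩,
    h s]

/-- The increment of the Haar sums is bounded by the oscillation of the function. -/
theorem abs_haarSum_succ_sub_le {g : (Fin d → ℝ) → ℝ}
    (hg : ContinuousOn g (Icc (0 : Fin d → ℝ) 1)) {k : ℕ} {x : Fin d → ℝ}
    (hx : x ∈ Icc (0 : Fin d → ℝ) 1) (v : ℝ) {M : ℝ}
    (hM : ∀ t ∈ Icc (0 : Fin d → ℝ) 1, ‖t - x‖ ≤ (2 ^ k)⁻¹ → |g t - v| ≤ M) :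
    |haarSum (k + 1) g x - haarSum k g x| ≤ 2 * M := by
  have hgv : ContinuousOn (fun t => g t - v) (Icc (0 : Fin d → ℝ) 1) := hg.sub continuousOn_const
  have hle : ((2 : ℝ) ^ (k + 1))⁻¹ ≤ (2 ^ k)⁻¹ :=
    inv_anti₀ (by positivity) (pow_le_pow_right₀ one_le_two (Nat.le_succ k))
  have h1 := abs_haarSum_le hgv hx (k := k + 1) (M := M) fun t ht htx => hM t ht (htx.trans hle)
  have h2 := abs_haarSum_le hgv hx (k := k) (M := M) hM
  rw [haarSum_sub hg continuousOn_const, haarSum_const _ _ hx] at h1 h2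
  rw [abs_le] at h1 h2 ⊢
  constructor <;> linarith [h1.1, h1.2, h2.1, h2.2]

theorem tendsto_haarSum {g : (Fin d → ℝ) → ℝ} (hg : ContinuousOn g (Icc (0 : Fin d → ℝ) 1))
    {x : Fin d → ℝ} (hx : x ∈ Icc (0 : Fin d → ℝ) 1) :
    Tendsto (fun k => haarSum k g x) atTop (𝓝 (g x)) := by
  rw [Metric.tendsto_atTop]
  intro ε hε
  obtain ⟨δ, hδ, hgδ⟩ := Metric.continuousOn_iff.1 hg x hx (ε / 2) (by positivity)
  obtain ⟨N, hN⟩ := exists_pow_lt_of_lt_one hδ (y := (2 : ℝ)⁻¹) (by norm_num)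
  refine ⟨N, fun k hk => ?_⟩
  have hgv : ContinuousOn (fun t => g t - g x) (Icc (0 : Fin d → ℝ) 1) :=
    hg.sub continuousOn_const
  have h := abs_haarSum_le hgv hx (k := k) (M := ε / 2) fun t ht htx => by
    have : (2 : ℝ)⁻¹ ^ k ≤ 2⁻¹ ^ N := pow_le_pow_of_le_one (by norm_num) (by norm_num) hk
    rw [← inv_pow] at htx
    have := hgδ t ht (by rw [dist_eq_norm]; linarith)
    rw [Real.dist_eq] at this
    exact this.le
  rw [haarSum_sub hg continuousOn_const, haarSum_const _ _ hx] at h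
  rw [Real.dist_eq]
  linarith

end HaarKernel

/-! ### Polynomials on the cube and tensor Lagrange interpolation -/

section TensorPolynomials

open Polynomial

variable {d : ℕ}

/-- The polynomial functions on `ℝ ^ d` of degree at most `l` in each coordinate, as the span of
the products of polynomials in single coordinates. -/
noncomputable def tensorPoly (d l : ℕ) : Submodule ℝ ((Fin d → ℝ) → ℝ) :=
  Submodule.span ℝ {w | ∃ Q : Fin d → ℝ[X], (∀ s, (Q s).natDegree ≤ l) ∧
    w = fun u => ∏ s, (Q s).eval (u s)}

theorem tensorPoly_mono {l l' : ℕ} (h : l ≤ l') : tensorPoly d l ≤ tensorPoly d l' :=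
  Submodule.span_mono fun _ ⟨Q, hQ, hw⟩ => ⟨Q, fun s => (hQ s).trans h, hw⟩

theorem const_mem_tensorPoly (l : ℕ) (v : ℝ) : (fun _ => v) ∈ tensorPoly d l := by
  have h1 : (fun _ => (1 : ℝ)) ∈ tensorPoly d l :=
    Submodule.subset_span ⟨fun _ => 1, fun s => by simp, by simp⟩
  have := (tensorPoly d l).smul_mem v h1
  simpa [Pi.smul_def] using this

theorem coord_mul_mem_tensorPoly {l : ℕ} (s : Fin d) {w : (Fin d → ℝ) → ℝ}
    (hw : w ∈ tensorPoly d l) : (fun u => u s * w u) ∈ tensorPoly d (l + 1) := by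
  induction hw using Submodule.span_induction with
  | mem w hw =>
    obtain ⟨Q, hQ, rfl⟩ := hw
    refine Submodule.subset_span ⟨fun r => (if s = r then X else 1) * Q r, fun r => ?_, ?_⟩
    · refine natDegree_mul_le.trans ?_
      have := hQ r
      split_ifs
      · rw [natDegree_X]; omega
      · rw [natDegree_one]; omega
    · funext u
      simp_rw [eval_mul, Finset.prod_mul_distrib, apply_ite (eval _), eval_X, eval_one]
      simp
  | zero => simp only [Pi.zero_apply, mul_zero]; exact const_mem_tensorPoly _ 0
  | add w w' _ _ h h' =>
    simp only [Pi.add_apply, mul_add]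
    exact (tensorPoly d (l + 1)).add_mem h h'
  | smul c w _ h =>
    simp only [Pi.smul_apply, smul_eq_mul, mul_left_comm _ c]
    exact (tensorPoly d (l + 1)).smul_mem c h

theorem comp_affine_mem_tensorPoly {l : ℕ} (y : Fin d → ℝ) (ρ : ℝ) {w : (Fin d → ℝ) → ℝ}
    (hw : w ∈ tensorPoly d l) : (fun u => w (y + ρ • u)) ∈ tensorPoly d l := by
  induction hw using Submodule.span_induction with
  | mem w hw =>
    obtain ⟨Q, hQ, rfl⟩ := hw
    refine Submodule.subset_span ⟨fun s => (Q s).comp (C (y s) + C ρ * X), fun s => ?_, ?_⟩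
    · have h1 : (C (y s) + C ρ * X : ℝ[X]).natDegree ≤ 1 := by compute_degree
      calc _ ≤ (Q s).natDegree * (C (y s) + C ρ * X : ℝ[X]).natDegree := natDegree_comp_le
        _ ≤ (Q s).natDegree * 1 := Nat.mul_le_mul_left _ h1
        _ ≤ l := by rw [mul_one]; exact hQ s
    · funext u
      simp [eval_comp]
  | zero => exact const_mem_tensorPoly _ 0
  | add w w' _ _ h h' => exact (tensorPoly d l).add_mem h h'
  | smul c w _ h => exact (tensorPoly d l).smul_mem c h

/-- The interpolation nodes `i / (l + 1)`, `0 ≤ i ≤ l`, in `[0, 1]`. -/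
noncomputable def gridNode (l : ℕ) (i : Fin (l + 1)) : ℝ := (i : ℝ) / (l + 1)

/-- The interpolation nodes in the cube. -/
noncomputable def gridPoint (l : ℕ) (γ : Fin d → Fin (l + 1)) : Fin d → ℝ :=
  fun s => gridNode l (γ s)

/-- The tensor product Lagrange polynomials of the nodes `gridPoint l`. -/
noncomputable def tensorBasis (l : ℕ) (γ : Fin d → Fin (l + 1)) (u : Fin d → ℝ) : ℝ :=
  ∏ s, (Lagrange.basis Finset.univ (gridNode l) (γ s)).eval (u s)

theorem gridNode_injective (l : ℕ) : Function.Injective (gridNode l) := by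
  intro i j h
  have hl : (0 : ℝ) < l + 1 := by positivity
  unfold gridNode at h
  rw [div_left_inj' hl.ne'] at h
  exact Fin.ext (by exact_mod_cast h)

theorem gridPoint_mem (l : ℕ) (γ : Fin d → Fin (l + 1)) :
    gridPoint l γ ∈ Icc (0 : Fin d → ℝ) 1 := by
  have hl : (0 : ℝ) < l + 1 := by positivity
  refine ⟨fun s => ?_, fun s => ?_⟩
  · show 0 ≤ gridNode l (γ s)
    unfold gridNode
    positivity
  · show gridNode l (γ s) ≤ 1
    unfold gridNode
    rw [div_le_one hl]
    have := (γ s).2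
    exact_mod_cast this.le

/-- Polynomials are determined by their values at the interpolation nodes. -/
theorem eq_sum_tensorBasis {l : ℕ} {w : (Fin d → ℝ) → ℝ} (hw : w ∈ tensorPoly d l)
    (u : Fin d → ℝ) : w u = ∑ γ, w (gridPoint l γ) * tensorBasis l γ u := by
  induction hw using Submodule.span_induction with
  | mem w hw =>
    obtain ⟨Q, hQ, rfl⟩ := hw
    have h1 : ∀ s, (Q s).eval (u s) = ∑ i : Fin (l + 1), (Q s).eval (gridNode l i) *
        (Lagrange.basis Finset.univ (gridNode l) i).eval (u s) := by
      intro s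
      have hdeg : (Q s).degree < (Finset.univ : Finset (Fin (l + 1))).card := by
        refine (degree_le_of_natDegree_le (hQ s)).trans_lt ?_
        rw [Finset.card_univ, Fintype.card_fin]
        exact_mod_cast Nat.lt_succ_self l
      conv_lhs => rw [Lagrange.eq_interpolate (gridNode_injective l).injOn hdeg]
      simp [Lagrange.interpolate_apply, eval_finsetSum]
    simp_rw [h1, Finset.prod_univ_sum, Fintype.piFinset_univ, Finset.prod_mul_distrib]
    rfl
  | zero => simp
  | add w w' _ _ h h' => simp only [Pi.add_apply, h, h', add_mul, Finset.sum_add_distrib]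
  | smul c w _ h => simp only [Pi.smul_apply, smul_eq_mul, h, Finset.mul_sum, mul_assoc]

theorem contDiff_tensorBasis (l : ℕ) (γ : Fin d → Fin (l + 1)) :
    ContDiff ℝ 1 (tensorBasis l γ) := by
  unfold tensorBasis
  refine contDiff_prod fun s _ => ?_
  simp_rw [← Polynomial.coe_aeval_eq_eval]
  exact (Polynomial.contDiff_aeval _ _).comp (contDiff_apply ℝ ℝ s)

/-- The radius `2` covers the points at distance at most `2 * 2 ^ (-m)` from the corner of a box of
level `m`, after rescaling to the unit cube. -/
theorem exists_tensorBasis_lipschitz (d l : ℕ) : ∃ L : ℝ, 0 ≤ L ∧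
    ∀ (γ : Fin d → Fin (l + 1)) (u v : Fin d → ℝ), ‖u‖ ≤ 2 → ‖v‖ ≤ 2 →
      |tensorBasis l γ u - tensorBasis l γ v| ≤ L * ‖u - v‖ := by
  have h1 : ∀ γ : Fin d → Fin (l + 1), ∃ K : NNReal,
      LipschitzOnWith K (tensorBasis l γ) (Metric.closedBall 0 2) := fun γ =>
    (contDiff_tensorBasis l γ).contDiffOn.exists_lipschitzOnWith one_ne_zero
      (convex_closedBall _ _) (isCompact_closedBall _ _)
  choose K hK using h1
  refine ⟨∑ γ, K γ, by positivity, fun γ u v hu hv => ?_⟩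
  have h2 := (hK γ).dist_le_mul u (by simpa using hu) v (by simpa using hv)
  rw [Real.dist_eq, dist_eq_norm] at h2
  refine h2.trans (mul_le_mul_of_nonneg_right ?_ (norm_nonneg _))
  exact_mod_cast Finset.single_le_sum (f := K) (fun _ _ => zero_le) (Finset.mem_univ γ)

theorem continuous_of_mem_tensorPoly {l : ℕ} {w : (Fin d → ℝ) → ℝ} (hw : w ∈ tensorPoly d l) :
    Continuous w := by
  rw [show w = fun u => ∑ γ, w (gridPoint l γ) * tensorBasis l γ u from
    funext (eq_sum_tensorBasis hw)]
  exact continuous_finsetSum _ fun γ _ => continuous_const.mul (contDiff_tensorBasis l γ).continuous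

/-- Interpolation of a polynomial from the nodes of the box with corner `y` and side `ρ`. -/
theorem eq_sum_tensorBasis_box {l : ℕ} {w : (Fin d → ℝ) → ℝ} (hw : w ∈ tensorPoly d l)
    (y : Fin d → ℝ) {ρ : ℝ} (hρ : ρ ≠ 0) (x : Fin d → ℝ) :
    w x = ∑ γ, w (y + ρ • gridPoint l γ) * tensorBasis l γ (ρ⁻¹ • (x - y)) := by
  have h := eq_sum_tensorBasis (comp_affine_mem_tensorPoly y ρ hw) (ρ⁻¹ • (x - y))
  rwa [smul_inv_smul₀ hρ, add_sub_cancel] at h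

end TensorPolynomials

/-! ### The dyadic cells of the cube -/

section Cells

variable {d : ℕ}

/-- The numbers of the cells of level `m` in the cube. -/
abbrev CellLabel (d m : ℕ) : Type := Fin d → Fin (2 ^ (m + 1) + 1)

/-- The cell of level `m` that contains a given point of the cube. -/
noncomputable def cellOf (m : ℕ) (x : Cube d) : CellLabel d m :=
  fun s => ⟨cellIndex m (x.1 s), Nat.lt_succ_of_le (cellIndex_le (x.2.2 s))⟩

theorem cellOf_eq_iff {m : ℕ} {x y : Cube d} :
    cellOf m x = cellOf m y ↔ ∀ s, cellIndex m (x.1 s) = cellIndex m (y.1 s) := by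
  simp [cellOf, funext_iff]

theorem measurable_cellIndex (m : ℕ) : Measurable (cellIndex m) :=
  (Nat.measurable_floor.comp (measurable_const_mul _)).add
    (Nat.measurable_ceil.comp (measurable_const_mul _))

theorem measurable_cellOf (m : ℕ) : Measurable (cellOf (d := d) m) := by
  refine measurable_pi_iff.2 fun s => measurable_to_countable' fun i => ?_
  have h : Measurable fun x : Cube d => cellIndex m (x.1 s) :=
    (measurable_cellIndex m).comp ((measurable_pi_apply s).comp measurable_subtype_coe)
  convert h (measurableSet_singleton (i : ℕ)) using 1
  ext x
  simp [cellOf, Fin.ext_iff]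

theorem measurableSet_cellOf (m : ℕ) (c : CellLabel d m) :
    MeasurableSet (cellOf m ⁻¹' {c}) :=
  measurable_cellOf m (measurableSet_singleton c)

/-- The cell of level `m + 1` determines the cell of level `m`. -/
theorem cellIndex_eq_of_succ (m : ℕ) {x : ℝ} (hx : 0 ≤ x) :
    cellIndex m x = cellIndex (m + 1) x / 2 / 2 + ((cellIndex (m + 1) x + 1) / 2 + 1) / 2 := by
  rw [(cellIndex_div_two (m + 1) x).1, (cellIndex_div_two (m + 1) x).2]
  have h0 : 0 ≤ 2 ^ m * x := by positivity
  have e : (2 : ℝ) ^ (m + 1) * x = 2 * (2 ^ m * x) := by rw [pow_succ]; ring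
  rw [e]
  unfold cellIndex
  set v := 2 ^ m * x
  have f1 := Nat.floor_le h0
  have f2 := Nat.lt_floor_add_one v
  have f3 := Nat.floor_le (show 0 ≤ 2 * v by positivity)
  have f4 := Nat.lt_floor_add_one (2 * v)
  have c1 := Nat.le_ceil v
  have c2 := Nat.ceil_lt_add_one h0
  have c3 := Nat.le_ceil (2 * v)
  have c4 := Nat.ceil_lt_add_one (show 0 ≤ 2 * v by positivity)
  have a1 : 2 * ⌊v⌋₊ < ⌊2 * v⌋₊ + 1 := by
    have : (2 : ℝ) * ⌊v⌋₊ < ⌊2 * v⌋₊ + 1 := by linarith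
    exact_mod_cast this
  have a2 : ⌊2 * v⌋₊ < 2 * ⌊v⌋₊ + 2 := by
    have : (⌊2 * v⌋₊ : ℝ) < 2 * ⌊v⌋₊ + 2 := by linarith
    exact_mod_cast this
  have b1 : ⌈2 * v⌉₊ < 2 * ⌈v⌉₊ + 1 := by
    have : (⌈2 * v⌉₊ : ℝ) < 2 * ⌈v⌉₊ + 1 := by linarith
    exact_mod_cast this
  have b2 : 2 * ⌈v⌉₊ < ⌈2 * v⌉₊ + 2 := by
    have : (2 : ℝ) * ⌈v⌉₊ < ⌈2 * v⌉₊ + 2 := by linarith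
    exact_mod_cast this
  omega

theorem cellOf_eq_of_le {m k : ℕ} (hmk : m ≤ k) {x y : Cube d} (h : cellOf k x = cellOf k y) :
    cellOf m x = cellOf m y := by
  induction k, hmk using Nat.le_induction with
  | base => exact h
  | succ k _ ih =>
    refine ih (cellOf_eq_iff.2 fun s => ?_)
    rw [cellIndex_eq_of_succ k (x.2.1 s), cellIndex_eq_of_succ k (y.2.1 s), cellOf_eq_iff.1 h s]

/-- The lower corner of the closed dyadic box of level `m` attached to a cell. -/
noncomputable def cellCorner (m : ℕ) (c : CellLabel d m) : Fin d → ℝ :=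
  fun s => rightCell m (c s) / 2 ^ m

theorem cellCorner_add_mem {m : ℕ} (c : CellLabel d m) {u : Fin d → ℝ}
    (hu : u ∈ Icc (0 : Fin d → ℝ) 1) :
    cellCorner m c + ((2 : ℝ) ^ m)⁻¹ • u ∈ Icc (0 : Fin d → ℝ) 1 := by
  have hm : (0 : ℝ) < 2 ^ m := by positivity
  refine ⟨fun s => ?_, fun s => ?_⟩
  · have := hu.1 s
    simp only [cellCorner, Pi.add_apply, Pi.smul_apply, smul_eq_mul, Pi.zero_apply] at this ⊢
    positivity
  · have h1 := hu.2 s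
    have h2 : (rightCell m (c s) : ℝ) + 1 ≤ 2 ^ m := by exact_mod_cast rightCell_lt m (c s)
    simp only [cellCorner, Pi.add_apply, Pi.smul_apply, smul_eq_mul, Pi.one_apply] at h1 ⊢
    rw [← div_eq_inv_mul, ← add_div, div_le_one hm]
    linarith

theorem cellCorner_mem {m : ℕ} (c : CellLabel d m) : cellCorner m c ∈ Icc (0 : Fin d → ℝ) 1 := by
  simpa using cellCorner_add_mem c (u := 0) ⟨le_rfl, zero_le_one⟩

theorem norm_sub_cellCorner_le (m : ℕ) (x : Cube d) :
    ‖x.1 - cellCorner m (cellOf m x)‖ ≤ ((2 : ℝ) ^ m)⁻¹ := by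
  have hm : (0 : ℝ) < 2 ^ m := by positivity
  rw [pi_norm_le_iff_of_nonneg (by positivity)]
  intro s
  obtain ⟨r1, r2, -⟩ := rightCell_cellIndex_mem (k := m) ⟨x.2.1 s, x.2.2 s⟩
  have e : (x.1 - cellCorner m (cellOf m x)) s =
      (2 ^ m * x.1 s - rightCell m (cellIndex m (x.1 s))) / 2 ^ m := by
    simp only [cellCorner, cellOf, Pi.sub_apply]
    field_simp
  rw [e, Real.norm_eq_abs, abs_div, abs_of_pos hm, ← one_div]
  refine div_le_div_of_nonneg_right ?_ hm.le
  rw [abs_le]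
  constructor <;> linarith

end Cells

/-! ### Multiscale decomposition of the increments of Haar sums -/

section Decomposition

variable {d : ℕ}

/-- Uniform local approximation by polynomials: near each point `y` of the cube the function `g`
coincides with a polynomial up to an error `A * ‖x - y‖ ^ β`. -/
def IsPolyApprox (l : ℕ) (β A : ℝ) (g : (Fin d → ℝ) → ℝ) : Prop :=
  ContinuousOn g (Icc 0 1) ∧ (∀ x ∈ Icc (0 : Fin d → ℝ) 1, |g x| ≤ A) ∧
    ∀ y ∈ Icc (0 : Fin d → ℝ) 1, ∃ w ∈ tensorPoly d l,
      ∀ x ∈ Icc (0 : Fin d → ℝ) 1, |g x - w x| ≤ A * ‖x - y‖ ^ β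

/-- The basis polynomial number `γ` transported to the box of the cell `c` of level `m`. -/
noncomputable def cellBasis (l m : ℕ) (c : CellLabel d m) (γ : Fin d → Fin (l + 1))
    (t : Fin d → ℝ) : ℝ :=
  tensorBasis l γ ((2 : ℝ) ^ m • (t - cellCorner m c))

theorem continuous_cellBasis (l m : ℕ) (c : CellLabel d m) (γ : Fin d → Fin (l + 1)) :
    Continuous (cellBasis l m c γ) :=
  (contDiff_tensorBasis l γ).continuous.comp
    (by fun_prop : Continuous fun t : Fin d → ℝ => (2 : ℝ) ^ m • (t - cellCorner m c))

/-- At level `m + i` a basis polynomial of a box of level `m` oscillates by the order `2 ^ (-i)`. -/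
theorem abs_haarSum_cellBasis_le {l : ℕ} {L : ℝ} (hL0 : 0 ≤ L)
    (hL : ∀ (γ : Fin d → Fin (l + 1)) (u v : Fin d → ℝ), ‖u‖ ≤ 2 → ‖v‖ ≤ 2 →
      |tensorBasis l γ u - tensorBasis l γ v| ≤ L * ‖u - v‖)
    (m i : ℕ) (γ : Fin d → Fin (l + 1)) (x : Cube d) :
    |haarSum (m + i + 1) (cellBasis l m (cellOf m x) γ) x.1 -
      haarSum (m + i) (cellBasis l m (cellOf m x) γ) x.1| ≤ 2 * (L * (2 ^ i)⁻¹) := by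
  have hm : (0 : ℝ) < 2 ^ m := by positivity
  refine abs_haarSum_succ_sub_le (continuous_cellBasis l m _ γ).continuousOn x.2
    (cellBasis l m (cellOf m x) γ x.1) fun t _ htx => ?_
  have hle : ((2 : ℝ) ^ (m + i))⁻¹ ≤ (2 ^ m)⁻¹ :=
    inv_anti₀ hm (pow_le_pow_right₀ one_le_two (Nat.le_add_right m i))
  have hxc := norm_sub_cellCorner_le m x
  have htc : ‖t - cellCorner m (cellOf m x)‖ ≤ 2 * (2 ^ m)⁻¹ := by
    calc _ = ‖(t - x.1) + (x.1 - cellCorner m (cellOf m x))‖ := by congr 1; abel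
      _ ≤ _ := norm_add_le _ _
      _ ≤ _ := by linarith
  have hinv : (0 : ℝ) < (2 ^ m)⁻¹ := by positivity
  unfold cellBasis
  refine (hL γ _ _ ?_ ?_).trans (mul_le_mul_of_nonneg_left ?_ hL0)
  · rw [norm_smul, Real.norm_of_nonneg hm.le]
    calc _ ≤ 2 ^ m * (2 * (2 ^ m)⁻¹) := mul_le_mul_of_nonneg_left htc hm.le
      _ = 2 := by field_simp
  · rw [norm_smul, Real.norm_of_nonneg hm.le]
    calc _ ≤ 2 ^ m * (2 * (2 ^ m)⁻¹) := mul_le_mul_of_nonneg_left (by linarith) hm.le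
      _ = 2 := by field_simp
  · rw [← smul_sub, norm_smul, Real.norm_of_nonneg hm.le, sub_sub_sub_cancel_right]
    calc _ ≤ 2 ^ m * (2 ^ (m + i) : ℝ)⁻¹ := mul_le_mul_of_nonneg_left htx hm.le
      _ = (2 ^ i)⁻¹ := by rw [pow_add]; field_simp

/-- Telescoping over the levels `m ≤ k`, the increment of the Haar sums of `g` is a combination of
increments for the localized basis polynomials, with a remainder that is constant on the cells of
level `k + 1`; the coefficients decay like the errors of polynomial approximation. -/
theorem exists_haarSum_decomposition {l : ℕ} {β A : ℝ} (hβ : 0 ≤ β) {g : (Fin d → ℝ) → ℝ}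
    (hg : IsPolyApprox l β A g) :
    ∃ (a : ∀ m, CellLabel d m → (Fin d → Fin (l + 1)) → ℝ) (e : ∀ k, CellLabel d (k + 1) → ℝ),
      (∀ m c γ, |a m c γ| ≤ A * (2 * 4 ^ β) * ((2 ^ m)⁻¹ : ℝ) ^ β) ∧
      (∀ k c, |e k c| ≤ A * (2 * 4 ^ β) * ((2 ^ k)⁻¹ : ℝ) ^ β) ∧
      ∀ k (x : Cube d), haarSum (k + 1) g x.1 - haarSum k g x.1 =
        (∑ m ∈ Finset.range (k + 1), ∑ γ, a m (cellOf m x) γ *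
          (haarSum (k + 1) (cellBasis l m (cellOf m x) γ) x.1 -
            haarSum k (cellBasis l m (cellOf m x) γ) x.1)) + e k (cellOf (k + 1) x) := by
  classical
  obtain ⟨hgc, hgA, hgw⟩ := hg
  have hA : 0 ≤ A := (abs_nonneg _).trans (hgA 0 ⟨le_rfl, zero_le_one⟩)
  choose! w hwT hw using hgw
  have h4 : (1 : ℝ) ≤ 4 ^ β := Real.one_le_rpow (by norm_num) hβ
  -- the approximating polynomial of level `m` near `x`, and the differences of successive levels
  let p : ℕ → Cube d → (Fin d → ℝ) → ℝ := fun m x => w (cellCorner m (cellOf m x))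
  let q : ℕ → Cube d → (Fin d → ℝ) → ℝ := fun m x t =>
    p m x t - if m = 0 then 0 else p (m - 1) x t
  have hpT : ∀ m x, p m x ∈ tensorPoly d l := fun m x => hwT _ (cellCorner_mem _)
  have hqT : ∀ m x, q m x ∈ tensorPoly d l := by
    intro m x
    by_cases hm : m = 0
    · have : q m x = p m x := by funext t; simp [q, hm]
      rw [this]; exact hpT m x
    · have : q m x = p m x - p (m - 1) x := by funext t; simp [q, hm]
      rw [this]; exact (tensorPoly d l).sub_mem (hpT _ _) (hpT _ _)
  have hpq : ∀ k x t, p k x t = ∑ m ∈ Finset.range (k + 1), q m x t := by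
    intro k x t
    induction k with
    | zero => simp [q]
    | succ k ih => rw [Finset.sum_range_succ, ← ih]; simp [q]
  have hp_congr : ∀ m x x', cellOf m x = cellOf m x' → p m x = p m x' := by
    intro m x x' h
    simp only [p, h]
  have hq_congr : ∀ m x x', cellOf m x = cellOf m x' → q m x = q m x' := by
    intro m x x' h
    funext t
    simp only [q]
    rw [hp_congr m x x' h, hp_congr (m - 1) x x' (cellOf_eq_of_le (Nat.sub_le m 1) h)]
  have hpbound : ∀ m x, ∀ t ∈ Icc (0 : Fin d → ℝ) 1, ∀ ρ : ℝ,
      ‖t - cellCorner m (cellOf m x)‖ ≤ ρ → |g t - p m x t| ≤ A * ρ ^ β := by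
    intro m x t ht ρ hρ
    exact (hw _ (cellCorner_mem _) t ht).trans
      (mul_le_mul_of_nonneg_left (Real.rpow_le_rpow (norm_nonneg _) hρ hβ) hA)
  let node : ∀ m, Cube d → (Fin d → Fin (l + 1)) → (Fin d → ℝ) := fun m x γ =>
    cellCorner m (cellOf m x) + ((2 : ℝ) ^ m)⁻¹ • gridPoint l γ
  have hnode : ∀ m x γ, ‖node m x γ - cellCorner m (cellOf m x)‖ ≤ ((2 : ℝ) ^ m)⁻¹ := by
    intro m x γ
    simp only [node, add_sub_cancel_left]
    rw [norm_smul, Real.norm_of_nonneg (by positivity)]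
    refine mul_le_of_le_one_right (by positivity) ?_
    rw [pi_norm_le_iff_of_nonneg zero_le_one]
    intro s
    rw [Real.norm_of_nonneg ((gridPoint_mem l γ).1 s)]
    exact (gridPoint_mem l γ).2 s
  have hqbound : ∀ m x γ, |q m x (node m x γ)| ≤ A * (2 * 4 ^ β) * ((2 ^ m)⁻¹ : ℝ) ^ β := by
    intro m x γ
    have hmem : node m x γ ∈ Icc (0 : Fin d → ℝ) 1 := cellCorner_add_mem _ (gridPoint_mem l γ)
    have h1 := hpbound m x _ hmem _ (hnode m x γ)
    cases m with
    | zero =>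
      have h2 := hgA _ hmem
      simp only [pow_zero, inv_one, Real.one_rpow, mul_one] at h1 ⊢
      have e : q 0 x (node 0 x γ) = p 0 x (node 0 x γ) := by simp [q]
      rw [e]
      have h3 : A * 2 ≤ A * (2 * 4 ^ β) := mul_le_mul_of_nonneg_left (by linarith) hA
      rw [abs_le] at h1 h2 ⊢
      constructor <;> linarith [h1.1, h1.2, h2.1, h2.2]
    | succ m =>
      have hρ : (0 : ℝ) ≤ (2 ^ (m + 1))⁻¹ := by positivity
      have h2 : ‖node (m + 1) x γ - cellCorner m (cellOf m x)‖ ≤ 4 * (2 ^ (m + 1))⁻¹ := by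
        have e : node (m + 1) x γ - cellCorner m (cellOf m x) =
            (node (m + 1) x γ - cellCorner (m + 1) (cellOf (m + 1) x)) -
              (x.1 - cellCorner (m + 1) (cellOf (m + 1) x)) +
              (x.1 - cellCorner m (cellOf m x)) := by abel
        have h3 := norm_sub_cellCorner_le (m + 1) x
        have h4 := norm_sub_cellCorner_le m x
        have h5 : ((2 : ℝ) ^ m)⁻¹ = 2 * (2 ^ (m + 1))⁻¹ := by rw [pow_succ]; field_simp
        rw [e]
        refine (norm_add_le _ _).trans ?_
        have := norm_sub_le (node (m + 1) x γ - cellCorner (m + 1) (cellOf (m + 1) x))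
          (x.1 - cellCorner (m + 1) (cellOf (m + 1) x))
        linarith [hnode (m + 1) x γ]
      have h3 := hpbound m x _ hmem _ h2
      rw [Real.mul_rpow (by norm_num) hρ] at h3
      have e : q (m + 1) x (node (m + 1) x γ) =
          p (m + 1) x (node (m + 1) x γ) - p m x (node (m + 1) x γ) := by simp [q]
      rw [e]
      have h6 : (0 : ℝ) ≤ ((2 ^ (m + 1))⁻¹ : ℝ) ^ β := Real.rpow_nonneg hρ β
      have h7 : A * ((2 ^ (m + 1))⁻¹ : ℝ) ^ β ≤ A * (4 ^ β * ((2 ^ (m + 1))⁻¹ : ℝ) ^ β) :=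
        mul_le_mul_of_nonneg_left (le_mul_of_one_le_left h6 h4) hA
      rw [abs_le] at h1 h3 ⊢
      constructor <;> linarith [h1.1, h1.2, h3.1, h3.2]
  have hgp : ∀ m x, ContinuousOn (fun t => g t - p m x t) (Icc (0 : Fin d → ℝ) 1) := fun m x =>
    hgc.sub (continuous_of_mem_tensorPoly (hpT m x)).continuousOn
  let err : ℕ → Cube d → ℝ := fun k x =>
    haarSum (k + 1) (fun t => g t - p k x t) x.1 - haarSum k (fun t => g t - p k x t) x.1
  have herr_congr : ∀ k x x', cellOf (k + 1) x = cellOf (k + 1) x' → err k x = err k x' := by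
    intro k x x' h
    have h' := cellOf_eq_of_le (Nat.le_succ k) h
    simp only [err]
    rw [hp_congr k x x' h', haarSum_eq_of_cellIndex_eq _ x.2 x'.2 (cellOf_eq_iff.1 h),
      haarSum_eq_of_cellIndex_eq _ x.2 x'.2 (cellOf_eq_iff.1 h')]
  have herr_bound : ∀ k x, |err k x| ≤ A * (2 * 4 ^ β) * ((2 ^ k)⁻¹ : ℝ) ^ β := by
    intro k x
    have hρ : (0 : ℝ) ≤ (2 ^ k)⁻¹ := by positivity
    have h := abs_haarSum_succ_sub_le (hgp k x) x.2 0 (M := A * (4 * (2 ^ k)⁻¹) ^ β)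
      (k := k) fun t ht htx => by
        rw [sub_zero]
        refine hpbound k x t ht _ ?_
        calc _ = ‖(t - x.1) + (x.1 - cellCorner k (cellOf k x))‖ := by congr 1; abel
          _ ≤ _ := norm_add_le _ _
          _ ≤ _ := by linarith [norm_sub_cellCorner_le k x]
    rw [Real.mul_rpow (by norm_num) hρ] at h
    exact h.trans_eq (by ring)
  -- both families depend on `x` only through its cell, so a representative of the cell defines them
  refine ⟨fun m c γ => if h : ∃ x, cellOf m x = c then q m h.choose (node m h.choose γ) else 0,
    fun k c => if h : ∃ x, cellOf (k + 1) x = c then err k h.choose else 0, ?_, ?_, ?_⟩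
  · intro m c γ
    dsimp only
    split_ifs with h
    · exact hqbound _ _ _
    · rw [abs_zero]; positivity
  · intro k c
    dsimp only
    split_ifs with h
    · exact herr_bound _ _
    · rw [abs_zero]; positivity
  · intro k x
    have ha : ∀ m γ, (if h : ∃ x', cellOf m x' = cellOf m x then
        q m h.choose (node m h.choose γ) else 0) = q m x (node m x γ) := by
      intro m γ
      have h : ∃ x', cellOf m x' = cellOf m x := ⟨x, rfl⟩
      rw [dif_pos h, hq_congr m _ x h.choose_spec]
      simp only [node, h.choose_spec]
    have he : (if h : ∃ x', cellOf (k + 1) x' = cellOf (k + 1) x then err k h.choose else 0) =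
        err k x := by
      have h : ∃ x', cellOf (k + 1) x' = cellOf (k + 1) x := ⟨x, rfl⟩
      rw [dif_pos h, herr_congr k _ x h.choose_spec]
    simp only [ha, he]
    have hpexp : p k x = fun t => ∑ j ∈ Finset.range (k + 1) ×ˢ
        (Finset.univ : Finset (Fin d → Fin (l + 1))),
        q j.1 x (node j.1 x j.2) * cellBasis l j.1 (cellOf j.1 x) j.2 t := by
      funext t
      rw [hpq, Finset.sum_product]
      refine Finset.sum_congr rfl fun m _ => ?_
      rw [eq_sum_tensorBasis_box (hqT m x) (cellCorner m (cellOf m x))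
        (ρ := ((2 : ℝ) ^ m)⁻¹) (by positivity) t, inv_inv]
      rfl
    have hDp : ∀ k', haarSum k' (p k x) x.1 = ∑ m ∈ Finset.range (k + 1), ∑ γ,
        q m x (node m x γ) * haarSum k' (cellBasis l m (cellOf m x) γ) x.1 := by
      intro k'
      rw [hpexp, haarSum_sum _ _ fun j _ => (continuous_cellBasis l _ _ _).continuousOn,
        Finset.sum_product]
    have hpc : ContinuousOn (p k x) (Icc (0 : Fin d → ℝ) 1) :=
      (continuous_of_mem_tensorPoly (hpT k x)).continuousOn
    simp only [err]
    rw [haarSum_sub hgc hpc, haarSum_sub hgc hpc, hDp, hDp]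
    simp_rw [mul_sub, Finset.sum_sub_distrib]
    ring

end Decomposition

/-! ### Almost sure bounds for the terms of the Haar series -/

section CoreBound

/-- Sums of nonnegative terms whose non-vanishing terms inject into a summable family. -/
theorem sum_le_tsum_of_injOn {J J' : Type*} (F : Finset J) (h : J → ℝ) (π : J → J') (H : J' → ℝ)
    (hH : Summable H) (hH0 : ∀ j, 0 ≤ H j) (hinj : Set.InjOn π {j | h j ≠ 0})
    (hle : ∀ j, h j ≠ 0 → h j ≤ H (π j)) : ∑ j ∈ F, h j ≤ ∑' j, H j := by
  classical
  calc ∑ j ∈ F, h j = ∑ j ∈ F with h j ≠ 0, h j := (Finset.sum_filter_ne_zero F).symm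
    _ ≤ ∑ j ∈ F with h j ≠ 0, H (π j) :=
        Finset.sum_le_sum fun j hj => hle j (Finset.mem_filter.1 hj).2
    _ = ∑ j ∈ (F.filter fun j => h j ≠ 0).image π, H j := by
        rw [Finset.sum_image]
        intro a ha b hb hab
        exact hinj (Finset.mem_filter.1 ha).2 (Finset.mem_filter.1 hb).2 hab
    _ ≤ _ := hH.sum_le_tsum _ fun j _ => hH0 j

/-- Cauchy-Schwarz for finitely many terms of a square summable family. -/
theorem sum_abs_le_sqrt_card_mul {S J : Type*} [Fintype S] (X : J → ℝ)
    (hX : Summable fun j => X j ^ 2) (j : S → J) (hj : Function.Injective j) :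
    ∑ s, |X (j s)| ≤ √(Fintype.card S) * √(∑' j, X j ^ 2) := by
  have h1 := Finset.sum_mul_sq_le_sq_mul_sq Finset.univ (fun _ : S => (1 : ℝ)) fun s => |X (j s)|
  have h2 : ∑ s, |X (j s)| ^ 2 ≤ ∑' j, X j ^ 2 := by
    have h3 := (hX.comp_injective hj).hasSum
    rw [tsum_fintype] at h3
    simp only [sq_abs]
    have := tsum_comp_le_tsum_of_inj hX (fun j => sq_nonneg _) hj
    rwa [tsum_fintype] at this
  rw [← Real.sqrt_mul (by positivity)]
  refine Real.le_sqrt_of_sq_le ?_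
  simp only [one_mul, one_pow, Finset.sum_const, Finset.card_univ, nsmul_eq_mul, mul_one] at h1
  exact h1.trans (mul_le_mul_of_nonneg_left h2 (by positivity))

/-- The decay of the coefficients against the square root of the number of cells of level `m`. -/
theorem inv_two_pow_rpow_mul_sqrt_le {β τ : ℝ} {d : ℕ} (h : τ ≤ β - d / 2) (m : ℕ) :
    ((2 ^ m)⁻¹ : ℝ) ^ β * √((2 ^ m) ^ d) ≤ ((2 : ℝ) ^ (-τ)) ^ m := by
  have h2 : (0 : ℝ) ≤ 2 := by norm_num
  have e1 : ((2 ^ m)⁻¹ : ℝ) ^ β = (2 : ℝ) ^ (-(m * β)) := by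
    rw [← Real.rpow_natCast 2 m, ← Real.rpow_neg h2, ← Real.rpow_mul h2, neg_mul]
  have e2 : √(((2 : ℝ) ^ m) ^ d) = (2 : ℝ) ^ ((m : ℝ) * (d / 2)) := by
    rw [Real.sqrt_eq_rpow, ← pow_mul, ← Real.rpow_natCast 2 (m * d), ← Real.rpow_mul h2]
    congr 1
    push_cast
    ring
  have e3 : ((2 : ℝ) ^ (-τ)) ^ m = (2 : ℝ) ^ (-τ * m) := by
    rw [← Real.rpow_natCast, ← Real.rpow_mul h2]
  rw [e1, e2, e3, ← Real.rpow_add (by norm_num)]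
  refine Real.rpow_le_rpow_of_exponent_le one_le_two ?_
  have : (m : ℝ) * τ ≤ m * (β - d / 2) := mul_le_mul_of_nonneg_left h (Nat.cast_nonneg m)
  linarith

theorem sqrt_card_cellLabel_le (d m : ℕ) :
    √(Fintype.card (CellLabel d m) : ℝ) ≤ √(3 ^ d) * √((2 ^ m) ^ d) := by
  rw [← Real.sqrt_mul (by positivity), ← mul_pow]
  refine Real.sqrt_le_sqrt ?_
  simp only [Fintype.card_pi, Fintype.card_fin, Finset.prod_const, Finset.card_univ]
  push_cast
  refine pow_le_pow_left₀ (by positivity) ?_ d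
  have : (1 : ℝ) ≤ 2 ^ m := one_le_pow₀ one_le_two
  rw [pow_succ]
  linarith

variable {d : ℕ}

/-- The index set of the functions `cellIncrement`: a cell, a basis polynomial, and the difference
between the level of the increment and the level of the cell. -/
abbrev IncrementIndex (d l : ℕ) : Type :=
  (Σ m : ℕ, CellLabel d m) × (Fin d → Fin (l + 1)) × ℕ

/-- The increments of the Haar sums of the localized basis polynomials, restricted to their cells.
The factor `2 ^ i` compensates the decay in the difference `i` of the levels, up to the geometric
factor `r ^ (m + i)`, which makes the sum over all levels converge. -/
noncomputable def cellIncrement (l : ℕ) (r : ℝ) (j : IncrementIndex d l) : SimpleFunc (Cube d) ℝ :=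
  (r ^ (j.1.1 + j.2.2) * 2 ^ j.2.2) •
    (haarSimple (j.1.1 + j.2.2 + 1) (cellBasis l j.1.1 j.1.2 j.2.1) -
      haarSimple (j.1.1 + j.2.2) (cellBasis l j.1.1 j.1.2 j.2.1)).restrict
        (cellOf j.1.1 ⁻¹' {j.1.2})

/-- The indicators of the cells of level `k + 1`, with the weights `r ^ k`. -/
noncomputable def cellIndicator (r : ℝ) (j : Σ k : ℕ, CellLabel d (k + 1)) :
    SimpleFunc (Cube d) ℝ :=
  r ^ j.1 • (SimpleFunc.const (Cube d) (1 : ℝ)).restrict (cellOf (j.1 + 1) ⁻¹' {j.2})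

open Classical in
theorem cellIncrement_apply (l : ℕ) (r : ℝ) (j : IncrementIndex d l) (x : Cube d) :
    cellIncrement l r j x = if cellOf j.1.1 x = j.1.2 then (r ^ (j.1.1 + j.2.2) * 2 ^ j.2.2) *
      (haarSum (j.1.1 + j.2.2 + 1) (cellBasis l j.1.1 j.1.2 j.2.1) x.1 -
        haarSum (j.1.1 + j.2.2) (cellBasis l j.1.1 j.1.2 j.2.1) x.1) else 0 := by
  unfold cellIncrement
  rw [SimpleFunc.coe_smul, Pi.smul_apply, SimpleFunc.restrict_apply _ (measurableSet_cellOf _ _),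
    indicator_apply]
  simp only [mem_preimage, mem_singleton_iff, smul_eq_mul, mul_ite, mul_zero]
  rfl

open Classical in
theorem cellIndicator_apply (r : ℝ) (j : Σ k : ℕ, CellLabel d (k + 1)) (x : Cube d) :
    cellIndicator r j x = if cellOf (j.1 + 1) x = j.2 then r ^ j.1 else 0 := by
  unfold cellIndicator
  rw [SimpleFunc.coe_smul, Pi.smul_apply, SimpleFunc.restrict_apply _ (measurableSet_cellOf _ _),
    indicator_apply]
  simp

theorem exists_sum_abs_cellIncrement_le (d l : ℕ) {r : ℝ} (hr0 : 0 < r) (hr1 : r < 1) :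
    ∃ M : ℝ, ∀ (F : Finset (IncrementIndex d l)) (x : Cube d),
      ∑ j ∈ F, |cellIncrement l r j x| ≤ M := by
  classical
  obtain ⟨L, hL0, hL⟩ := exists_tensorBasis_lipschitz d l
  let H : (ℕ × ℕ) × (Fin d → Fin (l + 1)) → ℝ := fun j => (r ^ j.1.1 * r ^ j.1.2) * (2 * L)
  have hs := summable_geometric_of_lt_one hr0.le hr1
  have hH : Summable H := by
    have h1 : Summable fun j : ℕ × ℕ => r ^ j.1 * r ^ j.2 :=
      hs.mul_of_nonneg hs (fun _ => by positivity) fun _ => by positivity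
    exact h1.mul_of_nonneg (g := fun _ : Fin d → Fin (l + 1) => 2 * L) (Summable.of_finite)
      (fun _ => by positivity) fun _ => by positivity
  refine ⟨∑' j, H j, fun F x => ?_⟩
  have hcell : ∀ j : IncrementIndex d l, |cellIncrement l r j x| ≠ 0 → cellOf j.1.1 x = j.1.2 := by
    intro j hj
    by_contra hne
    rw [cellIncrement_apply, if_neg hne] at hj
    simp at hj
  refine sum_le_tsum_of_injOn F _ (fun j => ((j.1.1, j.2.2), j.2.1)) H hH
    (fun j => by positivity) ?_ ?_
  · rintro ⟨⟨m, c⟩, γ, i⟩ h1 ⟨⟨m', c'⟩, γ', i'⟩ h2 heq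
    simp only [Prod.mk.injEq] at heq
    obtain ⟨⟨rfl, rfl⟩, rfl⟩ := heq
    have e1 : cellOf m x = c := hcell _ h1
    have e2 : cellOf m x = c' := hcell _ h2
    rw [← e1, ← e2]
  · rintro ⟨⟨m, c⟩, γ, i⟩ h
    have e1 : cellOf m x = c := hcell _ h
    subst e1
    rw [cellIncrement_apply, if_pos rfl, abs_mul, abs_of_pos (by positivity)]
    refine (mul_le_mul_of_nonneg_left (abs_haarSum_cellBasis_le hL0 hL m i γ x)
      (by positivity)).trans_eq ?_
    simp only [H]
    rw [pow_add]
    field_simp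

theorem exists_sum_abs_cellIndicator_le (d : ℕ) {r : ℝ} (hr0 : 0 < r) (hr1 : r < 1) :
    ∃ M : ℝ, ∀ (F : Finset (Σ k : ℕ, CellLabel d (k + 1))) (x : Cube d),
      ∑ j ∈ F, |cellIndicator r j x| ≤ M := by
  classical
  have hs := summable_geometric_of_lt_one hr0.le hr1
  refine ⟨∑' k : ℕ, r ^ k, fun F x => ?_⟩
  have hcell : ∀ j : Σ k : ℕ, CellLabel d (k + 1), |cellIndicator r j x| ≠ 0 →
      cellOf (j.1 + 1) x = j.2 := by
    intro j hj
    by_contra hne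
    rw [cellIndicator_apply, if_neg hne] at hj
    simp at hj
  refine sum_le_tsum_of_injOn F _ (fun j => j.1) _ hs (fun j => by positivity) ?_ ?_
  · rintro ⟨m, c⟩ h1 ⟨m', c'⟩ h2 heq
    obtain rfl : m = m' := heq
    have e1 : cellOf (m + 1) x = c := hcell _ h1
    have e2 : cellOf (m + 1) x = c' := hcell _ h2
    rw [← e1, ← e2]
  · rintro ⟨m, c⟩ h
    rw [cellIndicator_apply, if_pos (hcell _ h), abs_of_pos (by positivity)]

variable {Ω : Type*} [MeasurableSpace Ω] {P : Measure Ω} [IsProbabilityMeasure P]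

/-- Almost surely, the terms of the Haar series are bounded by one summable sequence for all
functions with a given order of polynomial approximation larger than `d / 2`. -/
theorem ae_exists_haarTerm_le (μ : StochasticMeasure (Cube d) P) (l : ℕ) {β : ℝ}
    (hβ : (d : ℝ) / 2 < β) :
    ∀ᵐ ω ∂P, ∃ u : ℕ → ℝ, Summable u ∧ (∀ k, 0 ≤ u k) ∧
      ∀ (A : ℝ) (g : (Fin d → ℝ) → ℝ), IsPolyApprox l β A g →
        ∀ k, |haarTerm μ g k ω| ≤ A * u k := by
  classical
  have hβ0 : 0 ≤ β := le_trans (by positivity) hβ.le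
  -- half of the gain `2 ^ (-τ)` per level is spent on the weights, the other half gives convergence
  set τ : ℝ := min (β - d / 2) 1 with hτ
  have hτ0 : 0 < τ := lt_min (by linarith) one_pos
  set r : ℝ := 2 ^ (-(τ / 2)) with hr
  have hr0 : 0 < r := Real.rpow_pos_of_pos two_pos _
  have hr1 : r < 1 := Real.rpow_lt_one_of_one_lt_of_neg one_lt_two (by linarith)
  have hrr : r * r = 2 ^ (-τ) := by
    rw [hr, ← Real.rpow_add two_pos]
    congr 1
    ring
  have hhalf : (2 : ℝ)⁻¹ ≤ r * r := by
    rw [hrr, ← Real.rpow_neg_one]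
    exact Real.rpow_le_rpow_of_exponent_le one_le_two (by linarith [min_le_right (β - d / 2) 1])
  obtain ⟨M₁, hM₁⟩ := exists_sum_abs_cellIncrement_le d l hr0 hr1
  obtain ⟨M₂, hM₂⟩ := exists_sum_abs_cellIndicator_le d hr0 hr1
  -- the finite family that carries the increment of order `k`
  let jX : ∀ k : ℕ, (m : Fin (k + 1)) → CellLabel d m × (Fin d → Fin (l + 1)) →
    IncrementIndex d l := fun k m s => (⟨m, s.1⟩, s.2, k - m)
  let fam : ∀ k : ℕ, ((Σ m : Fin (k + 1), CellLabel d m × (Fin d → Fin (l + 1))) ⊕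
      CellLabel d (k + 1)) → SimpleFunc (Cube d) ℝ := fun k =>
    Sum.elim (fun s => cellIncrement l r (jX k s.1 s.2)) fun c => cellIndicator r ⟨k, c⟩
  have hlin : ∀ᵐ ω ∂P, ∀ k, ∀ (h : SimpleFunc (Cube d) ℝ) (a : _ → ℝ),
      (∀ x, h x = ∑ j, a j * fam k j x) →
        μ.simpleIntegral h ω = ∑ j, a j * μ.simpleIntegral (fam k j) ω :=
    ae_all_iff.2 fun k => μ.ae_simpleIntegral_linear (fam k)
  filter_upwards [hlin, μ.ae_summable_sq_simpleIntegral (cellIncrement l r) M₁ hM₁,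
    μ.ae_summable_sq_simpleIntegral (cellIndicator r) M₂ hM₂] with ω hlin hX hY
  set X : IncrementIndex d l → ℝ := fun j => μ.simpleIntegral (cellIncrement l r j) ω with hXdef
  set Y : (Σ k : ℕ, CellLabel d (k + 1)) → ℝ := fun j => μ.simpleIntegral (cellIndicator r j) ω
    with hYdef
  set N : ℝ := √(Fintype.card (Fin d → Fin (l + 1)) : ℝ) with hN
  set cX : ℝ := 2 * 4 ^ β * √(3 ^ d) * N * √(∑' j, X j ^ 2) with hcX
  set cY : ℝ := 2 * 4 ^ β * √(3 ^ d) * √(2 ^ d) * √(∑' j, Y j ^ 2) with hcY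
  have hN0 : 0 ≤ N := Real.sqrt_nonneg _
  have hcX0 : 0 ≤ cX := by positivity
  have hcY0 : 0 ≤ cY := by positivity
  refine ⟨fun k => ((k : ℝ) + 1) * r ^ k * cX + r ^ k * cY, ?_, fun k => by positivity, ?_⟩
  · have h1 : Summable fun k : ℕ => (k : ℝ) * r ^ k := by
      simpa using summable_pow_mul_geometric_of_norm_lt_one 1
        (r := r) (by rwa [Real.norm_of_nonneg hr0.le])
    have h2 := summable_geometric_of_lt_one hr0.le hr1
    refine ((h1.add h2).mul_right cX |>.add (h2.mul_right cY)).congr fun k => ?_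
    ring
  intro A g hg k
  have hA : 0 ≤ A := (abs_nonneg _).trans (hg.2.1 0 ⟨le_rfl, zero_le_one⟩)
  obtain ⟨a, e, ha, he, hdec⟩ := exists_haarSum_decomposition hβ0 hg
  have hrk : 0 < r ^ k := pow_pos hr0 k
  let co : ((Σ m : Fin (k + 1), CellLabel d m × (Fin d → Fin (l + 1))) ⊕ CellLabel d (k + 1)) →
      ℝ := Sum.elim (fun s => a s.1 s.2.1 s.2.2 / (r ^ k * 2 ^ (k - (s.1 : ℕ))))
        fun c => e k c / r ^ k
  have hfam : ∀ x, (haarSimple (k + 1) g - haarSimple k g) x = ∑ j, co j * fam k j x := by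
    intro x
    have h0 : (haarSimple (k + 1) g - haarSimple k g) x = haarSum (k + 1) g x.1 - haarSum k g x.1 :=
      rfl
    rw [h0, hdec k x, Fintype.sum_sum_type, Fintype.sum_sigma]
    congr 1
    · rw [Finset.sum_range]
      refine Finset.sum_congr rfl fun m _ => ?_
      rw [Fintype.sum_prod_type, Finset.sum_comm]
      refine Finset.sum_congr rfl fun γ _ => ?_
      have hmk : (m : ℕ) + (k - m) = k := by omega
      simp only [co, fam, jX, Sum.elim_inl, cellIncrement_apply, hmk, mul_ite, mul_zero,
        Finset.sum_ite_eq, Finset.mem_univ, if_true]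
      field_simp
    · simp only [co, fam, Sum.elim_inr, cellIndicator_apply, mul_ite, mul_zero,
        Finset.sum_ite_eq, Finset.mem_univ, if_true]
      field_simp
  unfold haarTerm
  rw [hlin k _ co hfam, Fintype.sum_sum_type, Fintype.sum_sigma]
  have hXm : ∀ m : Fin (k + 1),
      |∑ s, co (Sum.inl ⟨m, s⟩) * μ.simpleIntegral (fam k (Sum.inl ⟨m, s⟩)) ω| ≤ A * (r ^ k * cX) := by
    intro m
    have hinj : Function.Injective (jX k m) := by
      rintro ⟨c, γ⟩ ⟨c', γ'⟩ h
      simpa [jX] using h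
    have hCS := sum_abs_le_sqrt_card_mul X hX (jX k m) hinj
    have hcard : √(Fintype.card (CellLabel d m × (Fin d → Fin (l + 1))) : ℝ) ≤
        √(3 ^ d) * √((2 ^ (m : ℕ)) ^ d) * N := by
      rw [Fintype.card_prod, Nat.cast_mul, Real.sqrt_mul (by positivity)]
      exact mul_le_mul_of_nonneg_right (sqrt_card_cellLabel_le d m) hN0
    set cm : ℝ := A * (2 * 4 ^ β) * ((2 ^ (m : ℕ))⁻¹ : ℝ) ^ β / (r ^ k * 2 ^ (k - (m : ℕ)))
      with hcm
    have hcm0 : 0 ≤ cm := by positivity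
    calc _ ≤ ∑ s, cm * |X (jX k m s)| := by
          refine (Finset.abs_sum_le_sum_abs _ _).trans (Finset.sum_le_sum fun s _ => ?_)
          rw [abs_mul]
          refine mul_le_mul_of_nonneg_right ?_ (abs_nonneg _)
          simp only [co, Sum.elim_inl]
          rw [abs_div, abs_of_pos (show (0 : ℝ) < r ^ k * 2 ^ (k - (m : ℕ)) by positivity)]
          exact div_le_div_of_nonneg_right (ha _ _ _) (by positivity)
      _ = cm * ∑ s, |X (jX k m s)| := by rw [Finset.mul_sum]
      _ ≤ cm * (√(3 ^ d) * √((2 ^ (m : ℕ)) ^ d) * N * √(∑' j, X j ^ 2)) :=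
          mul_le_mul_of_nonneg_left (hCS.trans (mul_le_mul_of_nonneg_right hcard
            (Real.sqrt_nonneg _))) hcm0
      _ = A * (((2 ^ (m : ℕ))⁻¹ : ℝ) ^ β * √((2 ^ (m : ℕ)) ^ d) * (2 ^ (k - (m : ℕ)))⁻¹ *
            (r ^ k)⁻¹ * cX) := by
          rw [hcm, hcX]
          field_simp
      _ ≤ A * (r ^ k * cX) := by
          refine mul_le_mul_of_nonneg_left (mul_le_mul_of_nonneg_right ?_ hcX0) hA
          have n1 := inv_two_pow_rpow_mul_sqrt_le (d := d) (min_le_left (β - d / 2) 1) (m : ℕ)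
          rw [← hτ, ← hrr] at n1
          have n2 : ((2 : ℝ) ^ (k - (m : ℕ)))⁻¹ ≤ (r * r) ^ (k - (m : ℕ)) := by
            rw [← inv_pow]
            exact pow_le_pow_left₀ (by norm_num) hhalf _
          have n3 : (r * r) ^ (m : ℕ) * (r * r) ^ (k - (m : ℕ)) = r ^ k * r ^ k := by
            rw [← pow_add, mul_pow]
            congr <;> omega
          calc _ ≤ (r * r) ^ (m : ℕ) * (r * r) ^ (k - (m : ℕ)) * (r ^ k)⁻¹ :=
                mul_le_mul_of_nonneg_right (mul_le_mul n1 n2 (by positivity) (by positivity))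
                  (by positivity)
            _ = r ^ k := by rw [n3]; field_simp
  have hYk : |∑ c, co (Sum.inr c) * μ.simpleIntegral (fam k (Sum.inr c)) ω| ≤
      A * (r ^ k * cY) := by
    have hinj : Function.Injective fun c : CellLabel d (k + 1) =>
        (⟨k, c⟩ : Σ k : ℕ, CellLabel d (k + 1)) := by
      intro c c' h
      simpa using h
    have hCS := sum_abs_le_sqrt_card_mul Y hY _ hinj
    have hcard : √(Fintype.card (CellLabel d (k + 1)) : ℝ) ≤
        √(3 ^ d) * √(2 ^ d) * √((2 ^ k) ^ d) := by
      refine (sqrt_card_cellLabel_le d (k + 1)).trans_eq ?_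
      rw [mul_assoc, ← Real.sqrt_mul (by positivity) ((2 ^ k) ^ d), ← mul_pow, pow_succ,
        mul_comm (2 ^ k : ℝ)]
    set cm : ℝ := A * (2 * 4 ^ β) * ((2 ^ k)⁻¹ : ℝ) ^ β / r ^ k with hcm
    have hcm0 : 0 ≤ cm := by positivity
    calc _ ≤ ∑ c, cm * |Y ⟨k, c⟩| := by
          refine (Finset.abs_sum_le_sum_abs _ _).trans (Finset.sum_le_sum fun s _ => ?_)
          rw [abs_mul]
          refine mul_le_mul_of_nonneg_right ?_ (abs_nonneg _)
          simp only [co, Sum.elim_inr]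
          rw [abs_div, abs_of_pos hrk]
          exact div_le_div_of_nonneg_right (he _ _) hrk.le
      _ = cm * ∑ c, |Y ⟨k, c⟩| := by rw [Finset.mul_sum]
      _ ≤ cm * (√(3 ^ d) * √(2 ^ d) * √((2 ^ k) ^ d) * √(∑' j, Y j ^ 2)) :=
          mul_le_mul_of_nonneg_left (hCS.trans (mul_le_mul_of_nonneg_right hcard
            (Real.sqrt_nonneg _))) hcm0
      _ = A * (((2 ^ k)⁻¹ : ℝ) ^ β * √((2 ^ k) ^ d) * (r ^ k)⁻¹ * cY) := by
          rw [hcm, hcY]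
          field_simp
      _ ≤ A * (r ^ k * cY) := by
          refine mul_le_mul_of_nonneg_left (mul_le_mul_of_nonneg_right ?_ hcY0) hA
          have n1 := inv_two_pow_rpow_mul_sqrt_le (d := d) (min_le_left (β - d / 2) 1) k
          rw [← hτ, ← hrr] at n1
          calc _ ≤ (r * r) ^ k * (r ^ k)⁻¹ := mul_le_mul_of_nonneg_right n1 (by positivity)
            _ = r ^ k := by rw [mul_pow]; field_simp
  refine (abs_add_le _ _).trans ?_
  have h1 : |∑ m : Fin (k + 1), ∑ s, co (Sum.inl ⟨m, s⟩) *
      μ.simpleIntegral (fam k (Sum.inl ⟨m, s⟩)) ω| ≤ ((k : ℝ) + 1) * (A * (r ^ k * cX)) := by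
    refine (Finset.abs_sum_le_sum_abs _ _).trans ((Finset.sum_le_sum fun m _ => hXm m).trans_eq ?_)
    simp
  calc _ ≤ ((k : ℝ) + 1) * (A * (r ^ k * cX)) + A * (r ^ k * cY) := add_le_add h1 hYk
    _ = _ := by ring

end CoreBound

/-! ### Taylor polynomials on the cube -/

section Taylor

variable {d : ℕ}

theorem uniqueDiffOn_cube : UniqueDiffOn ℝ (Icc (0 : Fin d → ℝ) 1) := by
  rw [← pi_univ_Icc]
  exact UniqueDiffOn.univ_pi fun _ => uniqueDiffOn_Icc zero_lt_one

theorem partialX_eq_fderivWithin {g : (Fin d → ℝ) → ℝ} {x : Fin d → ℝ}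
    (hg : DifferentiableWithinAt ℝ g (Icc 0 1) x) (hx : x ∈ Icc (0 : Fin d → ℝ) 1) (s : Fin d) :
    partialX s g x = fderivWithin ℝ g (Icc 0 1) x (Pi.single s 1) := by
  have hmap : MapsTo (Function.update x s) (Icc (0 : ℝ) 1) (Icc (0 : Fin d → ℝ) 1) := by
    intro t ht
    rw [← pi_univ_Icc]
    intro r _
    rcases eq_or_ne r s with rfl | h
    · simpa using ht
    · rw [Function.update_of_ne h]; exact ⟨hx.1 r, hx.2 r⟩
  have hup : HasDerivWithinAt (Function.update x s) (Pi.single s (1 : ℝ)) (Icc (0 : ℝ) 1) (x s) :=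
    (hasDerivAt_update x s (x s)).hasDerivWithinAt
  have hgf : HasFDerivWithinAt g (fderivWithin ℝ g (Icc 0 1) x) (Icc 0 1)
      (Function.update x s (x s)) := by
    rw [Function.update_eq_self]; exact hg.hasFDerivWithinAt
  exact (hgf.comp_hasDerivWithinAt (x s) hup hmap).derivWithin
    (uniqueDiffOn_Icc zero_lt_one _ ⟨hx.1 s, hx.2 s⟩)

theorem contDiffOn_partialX {n : ℕ} {g : (Fin d → ℝ) → ℝ}
    (hg : ContDiffOn ℝ ((n + 1 : ℕ) : WithTop ℕ∞) g (Icc 0 1)) (s : Fin d) :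
    ContDiffOn ℝ n (partialX s g) (Icc 0 1) := by
  have h1 : ContDiffOn ℝ n (fderivWithin ℝ g (Icc 0 1)) (Icc (0 : Fin d → ℝ) 1) :=
    hg.fderivWithin uniqueDiffOn_cube (by norm_cast)
  refine (h1.clm_apply contDiffOn_const).congr fun x hx => partialX_eq_fderivWithin ?_ hx s
  exact hg.differentiableOn (by norm_cast) x hx

/-- The functions on the cube with partial derivatives up to order `l` bounded by `C` and with
derivatives of order `l` that are Hölder continuous with exponent `α` and constant `C`. -/
def HolderClass (α C : ℝ) : ℕ → ((Fin d → ℝ) → ℝ) → Prop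
  | 0, g => ContinuousOn g (Icc 0 1) ∧ (∀ x ∈ Icc (0 : Fin d → ℝ) 1, |g x| ≤ C) ∧
      ∀ x ∈ Icc (0 : Fin d → ℝ) 1, ∀ y ∈ Icc (0 : Fin d → ℝ) 1, |g x - g y| ≤ C * ‖x - y‖ ^ α
  | l + 1, g => DifferentiableOn ℝ g (Icc 0 1) ∧ (∀ x ∈ Icc (0 : Fin d → ℝ) 1, |g x| ≤ C) ∧
      ∀ s, HolderClass α C l (partialX s g)

theorem holderClass_of_iterPartialX {α C : ℝ} {l : ℕ} {g : (Fin d → ℝ) → ℝ}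
    (hg : ContDiffOn ℝ l g (Icc 0 1))
    (hb : ∀ s : List (Fin d), s.length ≤ l → ∀ x ∈ Icc (0 : Fin d → ℝ) 1,
      |iterPartialX s g x| ≤ C)
    (hh : ∀ s : List (Fin d), s.length = l → ∀ x ∈ Icc (0 : Fin d → ℝ) 1,
      ∀ y ∈ Icc (0 : Fin d → ℝ) 1, |iterPartialX s g x - iterPartialX s g y| ≤ C * ‖x - y‖ ^ α) :
    HolderClass α C l g := by
  induction l generalizing g with
  | zero => exact ⟨hg.continuousOn, hb [] le_rfl, hh [] rfl⟩
  | succ l ih =>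
    have happ : ∀ (s : Fin d) (s' : List (Fin d)),
        iterPartialX s' (partialX s g) = iterPartialX (s' ++ [s]) g := by
      intro s s'
      simp [iterPartialX]
    refine ⟨hg.differentiableOn (by norm_cast), hb [] (Nat.zero_le _), fun s => ?_⟩
    refine ih (contDiffOn_partialX hg s) (fun s' hs' => ?_) fun s' hs' => ?_
    · rw [happ]
      exact hb _ (by simpa using hs')
    · rw [happ]
      exact hh _ (by simpa using hs')

theorem HolderClass.abs_le {α C : ℝ} {l : ℕ} {g : (Fin d → ℝ) → ℝ} (hg : HolderClass α C l g) :
    ∀ x ∈ Icc (0 : Fin d → ℝ) 1, |g x| ≤ C := by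
  cases l with
  | zero => exact hg.2.1
  | succ l => exact hg.2.1

theorem HolderClass.continuousOn {α C : ℝ} {l : ℕ} {g : (Fin d → ℝ) → ℝ}
    (hg : HolderClass α C l g) : ContinuousOn g (Icc 0 1) := by
  cases l with
  | zero => exact hg.1
  | succ l => exact hg.1.continuousOn

/-- The differential of order `r` of `g` at `y` on the diagonal, `v ↦ D ^ r g(y)(v, …, v)`. -/
noncomputable def taylorForm (y : Fin d → ℝ) : ℕ → ((Fin d → ℝ) → ℝ) → (Fin d → ℝ) → ℝ
  | 0, g, _ => g y
  | r + 1, g, v => ∑ s, v s * taylorForm y r (partialX s g) v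

theorem taylorForm_mem (y : Fin d → ℝ) (r : ℕ) (g : (Fin d → ℝ) → ℝ) :
    taylorForm y r g ∈ tensorPoly d r := by
  induction r generalizing g with
  | zero => exact const_mem_tensorPoly 0 (g y)
  | succ r ih =>
    have e : taylorForm y (r + 1) g =
        ∑ s, fun v : Fin d → ℝ => v s * taylorForm y r (partialX s g) v := by
      funext v
      simp [taylorForm]
    rw [e]
    exact Submodule.sum_mem _ fun s _ => coord_mul_mem_tensorPoly s (ih _)

theorem taylorForm_smul (y : Fin d → ℝ) (r : ℕ) (g : (Fin d → ℝ) → ℝ) (τ : ℝ) (v : Fin d → ℝ) :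
    taylorForm y r g (τ • v) = τ ^ r * taylorForm y r g v := by
  induction r generalizing g with
  | zero => simp [taylorForm]
  | succ r ih =>
    simp only [taylorForm, ih, Pi.smul_apply, smul_eq_mul, Finset.mul_sum]
    exact Finset.sum_congr rfl fun s _ => by ring

/-- The Taylor polynomial of degree `l` at `y`, as a function of the increment. -/
noncomputable def taylorPoly (y : Fin d → ℝ) (l : ℕ) (g : (Fin d → ℝ) → ℝ) (v : Fin d → ℝ) : ℝ :=
  ∑ r ∈ Finset.range (l + 1), (r.factorial : ℝ)⁻¹ * taylorForm y r g v

theorem taylorPoly_mem (y : Fin d → ℝ) (l : ℕ) (g : (Fin d → ℝ) → ℝ) :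
    taylorPoly y l g ∈ tensorPoly d l := by
  have e : taylorPoly y l g =
      ∑ r ∈ Finset.range (l + 1), (r.factorial : ℝ)⁻¹ • taylorForm y r g := by
    funext v
    simp [taylorPoly]
  rw [e]
  refine Submodule.sum_mem _ fun r hr => Submodule.smul_mem _ _ ?_
  exact tensorPoly_mono (Nat.lt_succ_iff.1 (Finset.mem_range.1 hr)) (taylorForm_mem y r g)

theorem hasDerivAt_taylorPoly_smul (y : Fin d → ℝ) (l : ℕ) (g : (Fin d → ℝ) → ℝ)
    (v : Fin d → ℝ) (τ : ℝ) :
    HasDerivAt (fun τ : ℝ => taylorPoly y (l + 1) g (τ • v))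
      (∑ s, v s * taylorPoly y l (partialX s g) (τ • v)) τ := by
  have h1 : (fun τ : ℝ => taylorPoly y (l + 1) g (τ • v)) = fun τ =>
      ∑ r ∈ Finset.range (l + 1 + 1), ((r.factorial : ℝ)⁻¹ * taylorForm y r g v) * τ ^ r := by
    funext τ
    unfold taylorPoly
    exact Finset.sum_congr rfl fun r _ => by rw [taylorForm_smul]; ring
  rw [h1]
  have h2 : HasDerivAt (fun τ : ℝ =>
      ∑ r ∈ Finset.range (l + 1 + 1), ((r.factorial : ℝ)⁻¹ * taylorForm y r g v) * τ ^ r)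
      (∑ r ∈ Finset.range (l + 1 + 1),
        ((r.factorial : ℝ)⁻¹ * taylorForm y r g v) * (r * τ ^ (r - 1))) τ :=
    HasDerivAt.fun_sum fun r _ => (hasDerivAt_pow r τ).const_mul _
  convert h2 using 1
  rw [Finset.sum_range_succ']
  simp only [Nat.cast_zero, zero_mul, mul_zero, add_zero]
  unfold taylorPoly
  simp_rw [Finset.mul_sum]
  rw [Finset.sum_comm]
  refine Finset.sum_congr rfl fun r _ => ?_
  have hr : ((r + 1 : ℕ) : ℝ) ≠ 0 := by positivity
  have hf : (r.factorial : ℝ) ≠ 0 := by positivity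
  simp only [taylorForm, taylorForm_smul, Nat.factorial_succ, Nat.add_sub_cancel, Finset.mul_sum,
    Finset.sum_mul]
  refine Finset.sum_congr rfl fun s _ => ?_
  rw [Nat.cast_mul]
  field_simp

theorem fderivWithin_eq_sum_partialX {g : (Fin d → ℝ) → ℝ} {x : Fin d → ℝ}
    (hg : DifferentiableWithinAt ℝ g (Icc 0 1) x) (hx : x ∈ Icc (0 : Fin d → ℝ) 1)
    (v : Fin d → ℝ) : fderivWithin ℝ g (Icc 0 1) x v = ∑ s, v s * partialX s g x := by
  conv_lhs => rw [pi_eq_sum_univ' v]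
  rw [map_sum]
  refine Finset.sum_congr rfl fun s _ => ?_
  rw [map_smul, smul_eq_mul, partialX_eq_fderivWithin hg hx]

/-- The remainder estimate: by induction on `l`, integrating the bound for the partial derivatives
along the segment from `y` to `x`. -/
theorem abs_sub_taylorPoly_le {α C : ℝ} (hα : 0 < α) {l : ℕ} {g : (Fin d → ℝ) → ℝ}
    (hg : HolderClass α C l g) {x y : Fin d → ℝ} (hx : x ∈ Icc (0 : Fin d → ℝ) 1)
    (hy : y ∈ Icc (0 : Fin d → ℝ) 1) :
    |g x - taylorPoly y l g (x - y)| ≤ C * (d : ℝ) ^ l * ‖x - y‖ ^ ((l : ℝ) + α) := by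
  have hC : 0 ≤ C := (abs_nonneg _).trans (hg.abs_le x hx)
  induction l generalizing g x with
  | zero =>
    simpa [taylorPoly, taylorForm] using hg.2.2 x hx y hy
  | succ l ih =>
    obtain ⟨hgd, -, hgs⟩ := hg
    set v := x - y with hv
    have hmem : ∀ τ ∈ Icc (0 : ℝ) 1, y + τ • v ∈ Icc (0 : Fin d → ℝ) 1 := by
      intro τ hτ
      have := (convex_Icc (0 : Fin d → ℝ) 1).add_smul_sub_mem hy hx hτ
      exact this
    have hder : ∀ τ ∈ Icc (0 : ℝ) 1,
        HasDerivWithinAt (fun τ : ℝ => g (y + τ • v) - taylorPoly y (l + 1) g (τ • v))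
          (∑ s, v s * partialX s g (y + τ • v) -
            ∑ s, v s * taylorPoly y l (partialX s g) (τ • v)) (Icc 0 1) τ := by
      intro τ hτ
      refine HasDerivWithinAt.sub ?_ (hasDerivAt_taylorPoly_smul y l g v τ).hasDerivWithinAt
      have h1 : HasDerivWithinAt (fun τ : ℝ => y + τ • v) v (Icc 0 1) τ := by
        have := ((hasDerivAt_id τ).smul_const v).const_add y
        simpa using this.hasDerivWithinAt
      rw [← fderivWithin_eq_sum_partialX (hgd _ (hmem τ hτ)) (hmem τ hτ)]
      exact (hgd _ (hmem τ hτ)).hasFDerivWithinAt.comp_hasDerivWithinAt τ h1 hmem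
    have hbound : ∀ τ ∈ Ico (0 : ℝ) 1, ‖∑ s, v s * partialX s g (y + τ • v) -
        ∑ s, v s * taylorPoly y l (partialX s g) (τ • v)‖ ≤
          C * (d : ℝ) ^ (l + 1) * ‖v‖ ^ (((l + 1 : ℕ) : ℝ) + α) := by
      intro τ hτ
      have hτ' : τ ∈ Icc (0 : ℝ) 1 := ⟨hτ.1, hτ.2.le⟩
      have hs : ∀ s ∈ (Finset.univ : Finset (Fin d)), |v s * partialX s g (y + τ • v) -
          v s * taylorPoly y l (partialX s g) (τ • v)| ≤
            ‖v‖ * (C * (d : ℝ) ^ l * ‖v‖ ^ ((l : ℝ) + α)) := by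
        intro s _
        have h1 := ih (hgs s) (hmem τ hτ')
        rw [add_sub_cancel_left] at h1
        rw [← mul_sub, abs_mul]
        refine mul_le_mul (norm_le_pi_norm v s) (h1.trans ?_) (abs_nonneg _) (norm_nonneg _)
        refine mul_le_mul_of_nonneg_left (Real.rpow_le_rpow (norm_nonneg _) ?_ (by positivity))
          (by positivity)
        rw [norm_smul, Real.norm_of_nonneg hτ.1]
        exact mul_le_of_le_one_left (norm_nonneg _) hτ.2.le
      rw [← Finset.sum_sub_distrib, Real.norm_eq_abs]
      refine (Finset.abs_sum_le_sum_abs _ _).trans ((Finset.sum_le_sum hs).trans_eq ?_)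
      rw [Finset.sum_const, Finset.card_univ, Fintype.card_fin, nsmul_eq_mul]
      have e : ((l + 1 : ℕ) : ℝ) + α = 1 + ((l : ℝ) + α) := by push_cast; ring
      rw [e, Real.rpow_one_add' (norm_nonneg v) (by positivity)]
      ring
    have h := norm_image_sub_le_of_norm_deriv_le_segment_01' hder hbound
    have h0 : g (y + (0 : ℝ) • v) - taylorPoly y (l + 1) g ((0 : ℝ) • v) = 0 := by
      have : taylorPoly y (l + 1) g ((0 : ℝ) • v) = g y := by
        unfold taylorPoly
        simp_rw [taylorForm_smul]
        rw [Finset.sum_eq_single 0]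
        · simp [taylorForm]
        · intro r _ hr
          rw [zero_pow hr]; ring
        · simp
      rw [this]; simp
    rw [h0, sub_zero, one_smul, hv, add_sub_cancel, Real.norm_eq_abs] at h
    exact h

/-- Functions of Hölder smoothness `l + α` are approximable by polynomials to the order `l + α`. -/
theorem HolderClass.isPolyApprox {α C : ℝ} (hα : 0 < α) {l : ℕ} {g : (Fin d → ℝ) → ℝ}
    (hg : HolderClass α C l g) : IsPolyApprox l (l + α) (C * (d + 1) ^ l) g := by
  have hC : 0 ≤ C := (abs_nonneg _).trans (hg.abs_le 0 ⟨le_rfl, zero_le_one⟩)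
  refine ⟨hg.continuousOn, fun x hx => (hg.abs_le x hx).trans ?_, fun y hy => ?_⟩
  · exact le_mul_of_one_le_right hC (one_le_pow₀ (by simp))
  · refine ⟨fun x => taylorPoly y l g (x - y), ?_, fun x hx => ?_⟩
    · have := comp_affine_mem_tensorPoly (-y) 1 (taylorPoly_mem y l g)
      simpa [← sub_eq_neg_add] using this
    · refine (abs_sub_taylorPoly_le hα hg hx hy).trans ?_
      gcongr
      simp

end Taylor

/-! ### Hölder classes of smooth functions -/

section HolderExamples

variable {d : ℕ}

theorem HolderClass.mono {α C C' : ℝ} (hC : C ≤ C') {l : ℕ} {g : (Fin d → ℝ) → ℝ}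
    (hg : HolderClass α C l g) : HolderClass α C' l g := by
  induction l generalizing g with
  | zero =>
    exact ⟨hg.1, fun x hx => (hg.2.1 x hx).trans hC, fun x hx y hy => (hg.2.2 x hx y hy).trans
      (mul_le_mul_of_nonneg_right hC (Real.rpow_nonneg (norm_nonneg _) _))⟩
  | succ l ih =>
    exact ⟨hg.1, fun x hx => (hg.2.1 x hx).trans hC, fun s => ih (hg.2.2 s)⟩

theorem norm_sub_le_one_of_mem_cube {x y : Fin d → ℝ} (hx : x ∈ Icc (0 : Fin d → ℝ) 1)
    (hy : y ∈ Icc (0 : Fin d → ℝ) 1) : ‖x - y‖ ≤ 1 := by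
  rw [pi_norm_le_iff_of_nonneg zero_le_one]
  intro s
  have h1 := hx.1 s
  have h2 := hx.2 s
  have h3 := hy.1 s
  have h4 := hy.2 s
  simp only [Pi.zero_apply, Pi.one_apply] at h1 h2 h3 h4
  rw [Pi.sub_apply, Real.norm_eq_abs, abs_le]
  constructor <;> linarith

theorem exists_abs_le_of_continuousOn_cube {g : (Fin d → ℝ) → ℝ}
    (hg : ContinuousOn g (Icc 0 1)) : ∃ C, ∀ x ∈ Icc (0 : Fin d → ℝ) 1, |g x| ≤ C :=
  isCompact_Icc.exists_bound_of_continuousOn hg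

/-- On the cube, the derivatives of order `l` of a `C^(l+1)` function are Lipschitz continuous, and
distances are at most `1`. -/
theorem exists_holderClass {α : ℝ} (hα' : α ≤ 1) {l : ℕ} {g : (Fin d → ℝ) → ℝ}
    (hg : ContDiffOn ℝ ((l + 1 : ℕ) : WithTop ℕ∞) g (Icc 0 1)) : ∃ C, HolderClass α C l g := by
  induction l generalizing g with
  | zero =>
    obtain ⟨C, hC⟩ := exists_abs_le_of_continuousOn_cube hg.continuousOn
    obtain ⟨K, hK⟩ := hg.exists_lipschitzOnWith (by norm_num) (convex_Icc _ _) isCompact_Icc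
    refine ⟨max C K, hg.continuousOn, fun x hx => (hC x hx).trans (le_max_left _ _),
      fun x hx y hy => ?_⟩
    have h := hK.dist_le_mul x hx y hy
    rw [Real.dist_eq, dist_eq_norm] at h
    refine h.trans (mul_le_mul (le_max_right _ _) ?_ (norm_nonneg _)
      (le_max_of_le_right K.2))
    exact Real.self_le_rpow_of_le_one (norm_nonneg _) (norm_sub_le_one_of_mem_cube hx hy) hα'
  | succ l ih =>
    obtain ⟨C, hC⟩ := exists_abs_le_of_continuousOn_cube hg.continuousOn
    choose D hD using fun s => ih (contDiffOn_partialX hg s)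
    refine ⟨|C| + ∑ s, |D s|, hg.differentiableOn (by norm_cast), fun x hx => ?_, fun s => ?_⟩
    · have : 0 ≤ ∑ s, |D s| := Finset.sum_nonneg fun s _ => abs_nonneg _
      linarith [hC x hx, le_abs_self C]
    · refine (hD s).mono ?_
      have := Finset.single_le_sum (f := fun s => |D s|) (fun s _ => abs_nonneg _)
        (Finset.mem_univ s)
      linarith [le_abs_self (D s), abs_nonneg C]

theorem norm_toLp_rpow_le (v : Fin d → ℝ) {α : ℝ} (hα : 0 < α) :
    ‖WithLp.toLp 2 v‖ ^ α ≤ √d ^ α * ‖v‖ ^ α := by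
  rw [← Real.mul_rpow (Real.sqrt_nonneg _) (norm_nonneg _)]
  refine Real.rpow_le_rpow (norm_nonneg _) ?_ hα.le
  rw [EuclideanSpace.norm_eq, ← Real.sqrt_sq (norm_nonneg v), ← Real.sqrt_mul (by positivity)]
  refine Real.sqrt_le_sqrt ?_
  calc ∑ s, ‖v s‖ ^ 2 ≤ ∑ _s : Fin d, ‖v‖ ^ 2 :=
        Finset.sum_le_sum fun s _ => pow_le_pow_left₀ (norm_nonneg _) (norm_le_pi_norm v s) 2
    _ = d * ‖v‖ ^ 2 := by simp

end HolderExamples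

/-! ### Dependence on the parameter -/

section Parameter

variable {d : ℕ} {a b : ℝ} {f : ℝ → (Fin d → ℝ) → ℝ} {l : ℕ}

theorem contDiffOn_partialZ (hab : a < b)
    (hf : ContDiffOn ℝ ((l + 1 : ℕ) : WithTop ℕ∞) (fun p : ℝ × (Fin d → ℝ) => f p.1 p.2)
      (Icc a b ×ˢ Icc (0 : Fin d → ℝ) 1)) :
    ContDiffOn ℝ l (fun p : ℝ × (Fin d → ℝ) => partialZ a b f p.1 p.2)
        (Icc a b ×ˢ Icc (0 : Fin d → ℝ) 1) ∧
      ∀ z ∈ Icc a b, ∀ x ∈ Icc (0 : Fin d → ℝ) 1,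
        HasDerivWithinAt (fun t => f t x) (partialZ a b f z x) (Icc a b) z := by
  set K : Set (ℝ × (Fin d → ℝ)) := Icc a b ×ˢ Icc (0 : Fin d → ℝ) 1 with hK
  set F : ℝ × (Fin d → ℝ) → ℝ := fun p => f p.1 p.2 with hF
  have huniq : UniqueDiffOn ℝ K := (uniqueDiffOn_Icc hab).prod uniqueDiffOn_cube
  have hder : ∀ z ∈ Icc a b, ∀ x ∈ Icc (0 : Fin d → ℝ) 1,
      HasDerivWithinAt (fun t => f t x) (fderivWithin ℝ F K (z, x) (1, 0)) (Icc a b) z := by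
    intro z hz x hx
    have h1 : HasFDerivWithinAt F (fderivWithin ℝ F K (z, x)) K (z, x) :=
      (hf.differentiableOn (by norm_cast) (z, x) ⟨hz, hx⟩).hasFDerivWithinAt
    have h2 : HasDerivWithinAt (fun t : ℝ => (t, x)) ((1 : ℝ), (0 : Fin d → ℝ)) (Icc a b) z :=
      ((hasDerivAt_id z).prodMk (hasDerivAt_const z x)).hasDerivWithinAt
    have hm : MapsTo (fun t : ℝ => (t, x)) (Icc a b) K := fun t ht => ⟨ht, hx⟩
    exact h1.comp_hasDerivWithinAt z h2 hm
  have heq : ∀ z ∈ Icc a b, ∀ x ∈ Icc (0 : Fin d → ℝ) 1,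
      partialZ a b f z x = fderivWithin ℝ F K (z, x) (1, 0) := fun z hz x hx =>
    (hder z hz x hx).derivWithin (uniqueDiffOn_Icc hab z hz)
  refine ⟨?_, fun z hz x hx => by rw [heq z hz x hx]; exact hder z hz x hx⟩
  have h1 : ContDiffOn ℝ l (fderivWithin ℝ F K) K := hf.fderivWithin huniq (by norm_cast)
  exact (h1.clm_apply contDiffOn_const).congr fun p hp => heq p.1 hp.1 p.2 hp.2

theorem contDiffOn_section {n : WithTop ℕ∞} {F : ℝ → (Fin d → ℝ) → ℝ}
    (hF : ContDiffOn ℝ n (fun p : ℝ × (Fin d → ℝ) => F p.1 p.2)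
      (Icc a b ×ˢ Icc (0 : Fin d → ℝ) 1)) {z : ℝ} (hz : z ∈ Icc a b) :
    ContDiffOn ℝ n (F z) (Icc 0 1) :=
  hF.comp (contDiff_prodMk_right z).contDiffOn fun _ hx => ⟨hz, hx⟩

/-- The difference quotients in the parameter converge uniformly on the cube. -/
theorem exists_abs_sub_sub_mul_partialZ_le (hab : a < b)
    (hf : ContDiffOn ℝ ((l + 1 : ℕ) : WithTop ℕ∞) (fun p : ℝ × (Fin d → ℝ) => f p.1 p.2)
      (Icc a b ×ˢ Icc (0 : Fin d → ℝ) 1)) {z : ℝ} (hz : z ∈ Icc a b) {ε : ℝ} (hε : 0 < ε) :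
    ∃ δ > 0, ∀ z' ∈ Icc a b, |z' - z| < δ → ∀ x ∈ Icc (0 : Fin d → ℝ) 1,
      |f z' x - f z x - (z' - z) * partialZ a b f z x| ≤ ε * |z' - z| := by
  obtain ⟨hc, hder⟩ := contDiffOn_partialZ hab hf
  have huc := (isCompact_Icc.prod isCompact_Icc).uniformContinuousOn_of_continuous hc.continuousOn
  obtain ⟨δ, hδ, hδ'⟩ := Metric.uniformContinuousOn_iff.1 huc ε hε
  refine ⟨δ, hδ, fun z' hz' hzz x hx => ?_⟩
  have hsub : uIcc z z' ⊆ Icc a b := by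
    rw [← segment_eq_uIcc]
    exact (convex_Icc a b).segment_subset hz hz'
  have h1 : ∀ t ∈ uIcc z z', HasDerivWithinAt (fun t => f t x - t * partialZ a b f z x)
      (partialZ a b f t x - partialZ a b f z x) (uIcc z z') t := by
    intro t ht
    have h2 := (hder t (hsub ht) x hx).mono hsub
    have h3 : HasDerivWithinAt (fun t : ℝ => t * partialZ a b f z x) (partialZ a b f z x)
        (uIcc z z') t := by
      simpa using (hasDerivAt_id t).hasDerivWithinAt.mul_const (partialZ a b f z x)
    exact h2.sub h3
  have h4 : ∀ t ∈ uIcc z z', ‖partialZ a b f t x - partialZ a b f z x‖ ≤ ε := by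
    intro t ht
    have h5 : dist (t, x) (z, x) < δ := by
      rw [Prod.dist_eq, dist_self, max_eq_left dist_nonneg, Real.dist_eq]
      exact (abs_sub_left_of_mem_uIcc ht).trans_lt hzz
    have h6 := hδ' (t, x) ⟨hsub ht, hx⟩ (z, x) ⟨hz, hx⟩ h5
    rw [dist_eq_norm] at h6
    exact h6.le
  have h7 := (convex_uIcc z z').norm_image_sub_le_of_norm_hasDerivWithin_le h1 h4
    left_mem_uIcc right_mem_uIcc
  rw [Real.norm_eq_abs, Real.norm_eq_abs] at h7
  refine le_trans (le_of_eq ?_) h7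
  congr 1
  ring

/-- Termwise differentiation of a series on a convex set, with one-sided derivatives at the end
points. -/
theorem hasDerivWithinAt_tsum_of_convex {s : Set ℝ} (hs : Convex ℝ s) {F F' : ℕ → ℝ → ℝ}
    {u : ℕ → ℝ} (hu : Summable u)
    (hF : ∀ k, ∀ z ∈ s, HasDerivWithinAt (F k) (F' k z) s z)
    (hb : ∀ k, ∀ z ∈ s, |F' k z| ≤ u k) (hsum : ∀ z ∈ s, Summable fun k => F k z)
    {z : ℝ} (hz : z ∈ s) :
    HasDerivWithinAt (fun t => ∑' k, F k t) (∑' k, F' k z) s z := by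
  rw [hasDerivWithinAt_iff_tendsto_slope]
  have h1 : Tendsto (fun t => ∑' k, slope (F k) z t) (𝓝[s \ {z}] z) (𝓝 (∑' k, F' k z)) := by
    refine tendsto_tsum_of_dominated_convergence hu
      (fun k => hasDerivWithinAt_iff_tendsto_slope.1 (hF k z hz)) ?_
    filter_upwards [self_mem_nhdsWithin] with t ht k
    have h2 := hs.norm_image_sub_le_of_norm_hasDerivWithin_le (hF k) (hb k) hz ht.1
    have h3 : 0 < ‖t - z‖ := norm_pos_iff.2 (sub_ne_zero.2 ht.2)
    rw [slope_def_field, norm_div, div_le_iff₀ h3]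
    exact h2
  refine h1.congr' ?_
  filter_upwards [self_mem_nhdsWithin] with t ht
  simp_rw [slope_def_field]
  rw [tsum_div_const, (hsum t ht.1).tsum_sub (hsum z hz)]

end Parameter

/-! ### The Fourier-Haar version of the integral -/

section HaarVersion

variable {d : ℕ} {Ω : Type*} [MeasurableSpace Ω] {P : Measure Ω}

theorem ae_simpleIntegral_haarSimple_eq (μ : StochasticMeasure (Cube d) P)
    (g : (Fin d → ℝ) → ℝ) : ∀ᵐ ω ∂P, ∀ n, μ.simpleIntegral (haarSimple n g) ω =
      μ.simpleIntegral (haarSimple 0 g) ω + ∑ k ∈ Finset.range n, haarTerm μ g k ω := by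
  have h1 : ∀ᵐ ω ∂P, ∀ k, μ.simpleIntegral (haarSimple (k + 1) g) ω =
      μ.simpleIntegral (haarSimple k g) ω + haarTerm μ g k ω := by
    rw [ae_all_iff]
    intro k
    filter_upwards [μ.ae_simpleIntegral_linear
      ![haarSimple k g, haarSimple (k + 1) g - haarSimple k g]] with ω hω
    have := hω (haarSimple (k + 1) g) ![1, 1] fun x => by simp [Fin.sum_univ_two]
    simpa [Fin.sum_univ_two, haarTerm] using this
  filter_upwards [h1] with ω hω n
  induction n with
  | zero => simp
  | succ n ih => rw [hω, ih, Finset.sum_range_succ, add_assoc]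

/-- Almost sure convergence of the integrals of the Haar sums; only the existence of a summable
majorant for the terms is used. -/
theorem ae_tendsto_simpleIntegral_haarSimple [IsProbabilityMeasure P]
    (μ : StochasticMeasure (Cube d) P) {l : ℕ} {β A : ℝ}
    (hβ : (d : ℝ) / 2 < β) {g : (Fin d → ℝ) → ℝ} (hg : IsPolyApprox l β A g) :
    ∀ᵐ ω ∂P, Tendsto (fun n => μ.simpleIntegral (haarSimple n g) ω) atTop
      (𝓝 (haarVersion μ g ω)) := by
  filter_upwards [ae_simpleIntegral_haarSimple_eq μ g, ae_exists_haarTerm_le μ l hβ]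
    with ω h1 ⟨u, hu, _, hle⟩
  have hs : Summable fun k => haarTerm μ g k ω :=
    Summable.of_norm_bounded (hu.mul_left A) (hle A g hg)
  exact (hs.hasSum.tendsto_sum_nat.const_add _).congr fun n => (h1 n).symm

theorem hasIntegral_haarVersion [IsProbabilityMeasure P] (μ : StochasticMeasure (Cube d) P)
    {l : ℕ} {β A : ℝ}
    (hβ : (d : ℝ) / 2 < β) {g : (Fin d → ℝ) → ℝ} (hg : IsPolyApprox l β A g) :
    μ.HasIntegral (fun x => g x.1) (haarVersion μ g) := by
  have hmeas : ∀ (ν : StochasticMeasure (Cube d) P), AEMeasurable (haarVersion ν g) P := fun ν =>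
    aemeasurable_of_tendsto_metrizable_ae atTop
      (fun n => (ν.measurable_simpleIntegral (haarSimple n g)).aemeasurable)
      (ae_tendsto_simpleIntegral_haarSimple ν hβ hg)
  have htend : ∀ (ν : StochasticMeasure (Cube d) P),
      TendstoInMeasure P (fun n => ν.simpleIntegral (haarSimple n g)) atTop (haarVersion ν g) :=
    fun ν => tendstoInMeasure_of_tendsto_ae
      (fun n => (ν.measurable_simpleIntegral (haarSimple n g)).aestronglyMeasurable)
      (ae_tendsto_simpleIntegral_haarSimple ν hβ hg)
  refine ⟨fun n => haarSimple n g, fun x => tendsto_haarSum hg.1 x.2, fun B hB => ?_, htend μ,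
    hmeas μ⟩
  exact ⟨haarVersion (μ.restrictTo B hB) g, hmeas _, (htend _).congr_left fun n =>
    (μ.simpleIntegral_restrict hB (haarSimple n g)).symm⟩

/-- A functional `T` on continuous functions on the cube that is linear and bounded with respect to
the uniform norm, expressed by one inequality. -/
def IsBoundedOnCube (T : ((Fin d → ℝ) → ℝ) → ℝ) (B : ℝ) : Prop :=
  ∀ g q h : (Fin d → ℝ) → ℝ, ContinuousOn g (Icc 0 1) → ContinuousOn q (Icc 0 1) →
    ContinuousOn h (Icc 0 1) → ∀ s M : ℝ,
      (∀ t ∈ Icc (0 : Fin d → ℝ) 1, |g t - q t - s * h t| ≤ M) →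
        |T g - T q - s * T h| ≤ B * M

theorem IsBoundedOnCube.abs_le {T : ((Fin d → ℝ) → ℝ) → ℝ} {B : ℝ} (hT : IsBoundedOnCube T B)
    {g : (Fin d → ℝ) → ℝ} (hg : ContinuousOn g (Icc 0 1)) {M : ℝ}
    (hM : ∀ t ∈ Icc (0 : Fin d → ℝ) 1, |g t| ≤ M) : |T g| ≤ B * M := by
  have := hT g g g hg hg hg 1 M fun t ht => by simpa using hM t ht
  simpa using this

/-- Integrals of simple functions that depend linearly on a continuous function, are constant on
the cells of one level and are bounded by the uniform norm. -/
theorem ae_isBoundedOnCube (μ : StochasticMeasure (Cube d) P) (m : ℕ)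
    (D : ((Fin d → ℝ) → ℝ) → SimpleFunc (Cube d) ℝ)
    (hcell : ∀ g x y, cellOf m x = cellOf m y → D g x = D g y)
    (hD : ∀ x, IsBoundedOnCube (fun g => D g x) 2) :
    ∀ᵐ ω ∂P, ∃ B, IsBoundedOnCube (fun g => μ.simpleIntegral (D g) ω) B := by
  classical
  filter_upwards [μ.ae_simpleIntegral_eq_sum (cellOf m) (measurableSet_cellOf m)] with ω hω
  refine ⟨2 * ∑ c, |μ.toFun (cellOf m ⁻¹' {c}) ω|, fun g q h hg hq hh s M hM => ?_⟩
  have hM0 : 0 ≤ M := (abs_nonneg _).trans (hM 0 ⟨le_rfl, zero_le_one⟩)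
  let v : ((Fin d → ℝ) → ℝ) → CellLabel d m → ℝ := fun g c =>
    if hx : ∃ x, cellOf m x = c then D g hx.choose else 0
  have hv : ∀ g x, D g x = v g (cellOf m x) := by
    intro g x
    have hx : ∃ x', cellOf m x' = cellOf m x := ⟨x, rfl⟩
    simp only [v]
    rw [dif_pos hx]
    exact hcell g _ _ hx.choose_spec.symm
  have hvb : ∀ c, |v g c - v q c - s * v h c| ≤ 2 * M := by
    intro c
    by_cases hx : ∃ x, cellOf m x = c
    · simp only [v]
      rw [dif_pos hx, dif_pos hx, dif_pos hx]
      exact hD _ g q h hg hq hh s M hM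
    · simp only [v]
      rw [dif_neg hx, dif_neg hx, dif_neg hx]
      simpa using hM0
  dsimp only
  rw [hω (D g) (v g) (hv g), hω (D q) (v q) (hv q), hω (D h) (v h) (hv h), Finset.mul_sum,
    ← Finset.sum_sub_distrib, ← Finset.sum_sub_distrib]
  calc _ ≤ ∑ c, (2 * M) * |μ.toFun (cellOf m ⁻¹' {c}) ω| := by
        refine (Finset.abs_sum_le_sum_abs _ _).trans (Finset.sum_le_sum fun c _ => ?_)
        rw [show v g c * μ.toFun (cellOf m ⁻¹' {c}) ω - v q c * μ.toFun (cellOf m ⁻¹' {c}) ω -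
          s * (v h c * μ.toFun (cellOf m ⁻¹' {c}) ω) =
          (v g c - v q c - s * v h c) * μ.toFun (cellOf m ⁻¹' {c}) ω by ring, abs_mul]
        exact mul_le_mul_of_nonneg_right (hvb c) (abs_nonneg _)
    _ = _ := by rw [← Finset.mul_sum]; ring

theorem haarSum_sub_sub_mul {g q h : (Fin d → ℝ) → ℝ} (hg : ContinuousOn g (Icc 0 1))
    (hq : ContinuousOn q (Icc 0 1)) (hh : ContinuousOn h (Icc 0 1)) (s : ℝ) (k : ℕ)
    (x : Fin d → ℝ) : haarSum k (fun t => g t - q t - s * h t) x =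
      haarSum k g x - haarSum k q x - s * haarSum k h x := by
  have hgq : ContinuousOn (fun t => g t - q t) (Icc (0 : Fin d → ℝ) 1) := hg.sub hq
  have hsh : ContinuousOn (fun t => s * h t) (Icc (0 : Fin d → ℝ) 1) := continuousOn_const.mul hh
  rw [haarSum_sub hgq hsh, haarSum_sub hg hq, haarSum_const_mul]

/-- Almost surely, the terms of the Haar series are bounded functionals of the integrand. -/
theorem ae_isBoundedOnCube_haarTerm (μ : StochasticMeasure (Cube d) P) :
    ∀ᵐ ω ∂P, (∃ B, IsBoundedOnCube (fun g => μ.simpleIntegral (haarSimple 0 g) ω) B) ∧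
      ∀ k, ∃ B, IsBoundedOnCube (fun g => haarTerm μ g k ω) B := by
  refine Filter.Eventually.and ?_ (ae_all_iff.2 fun k => ?_)
  · refine ae_isBoundedOnCube μ 0 (haarSimple 0) (fun g x y hxy =>
      haarSum_eq_of_cellIndex_eq g x.2 y.2 (cellOf_eq_iff.1 hxy)) ?_
    intro x g q h hg hq hh s M hM
    have hc : ContinuousOn (fun t => g t - q t - s * h t) (Icc (0 : Fin d → ℝ) 1) :=
      (hg.sub hq).sub (continuousOn_const.mul hh)
    have h1 := abs_haarSum_le hc x.2 (k := 0) fun t ht _ => hM t ht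
    rw [haarSum_sub_sub_mul hg hq hh] at h1
    have hM0 : 0 ≤ M := (abs_nonneg _).trans h1
    exact h1.trans (by linarith)
  · refine ae_isBoundedOnCube μ (k + 1) (fun g => haarSimple (k + 1) g - haarSimple k g)
      (fun g x y hxy => ?_) ?_
    · have e1 := haarSum_eq_of_cellIndex_eq g x.2 y.2 (cellOf_eq_iff.1 hxy)
      have e2 := haarSum_eq_of_cellIndex_eq g x.2 y.2
        (cellOf_eq_iff.1 (cellOf_eq_of_le (Nat.le_succ k) hxy))
      show haarSum (k + 1) g x.1 - haarSum k g x.1 = haarSum (k + 1) g y.1 - haarSum k g y.1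
      rw [e1, e2]
    · intro x g q h hg hq hh s M hM
      have hc : ContinuousOn (fun t => g t - q t - s * h t) (Icc (0 : Fin d → ℝ) 1) :=
        (hg.sub hq).sub (continuousOn_const.mul hh)
      have h1 := abs_haarSum_succ_sub_le hc x.2 (k := k) 0 (M := M) fun t ht _ => by
        rw [sub_zero]; exact hM t ht
      rw [haarSum_sub_sub_mul hg hq hh, haarSum_sub_sub_mul hg hq hh] at h1
      refine le_trans (le_of_eq ?_) h1
      show |(haarSum (k + 1) g x.1 - haarSum k g x.1) - (haarSum (k + 1) q x.1 - haarSum k q x.1) -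
        s * (haarSum (k + 1) h x.1 - haarSum k h x.1)| = _
      congr 1
      ring

theorem IsBoundedOnCube.hasDerivWithinAt {T : ((Fin d → ℝ) → ℝ) → ℝ} {B : ℝ}
    (hT : IsBoundedOnCube T B) {a b : ℝ} (hab : a < b) {l : ℕ} {f : ℝ → (Fin d → ℝ) → ℝ}
    (hf : ContDiffOn ℝ ((l + 1 : ℕ) : WithTop ℕ∞) (fun p : ℝ × (Fin d → ℝ) => f p.1 p.2)
      (Icc a b ×ˢ Icc (0 : Fin d → ℝ) 1)) {z : ℝ} (hz : z ∈ Icc a b) :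
    HasDerivWithinAt (fun t => T (f t)) (T (partialZ a b f z)) (Icc a b) z := by
  have hfz : ∀ z ∈ Icc a b, ContinuousOn (f z) (Icc 0 1) := fun z hz =>
    (contDiffOn_section hf hz).continuousOn
  have hpz : ContinuousOn (partialZ a b f z) (Icc 0 1) :=
    (contDiffOn_section (contDiffOn_partialZ hab hf).1 hz).continuousOn
  rw [hasDerivWithinAt_iff_isLittleO, Asymptotics.isLittleO_iff]
  intro c hc
  have hB : 0 < |B| + 1 := by positivity
  obtain ⟨δ, hδ, hδ'⟩ := exists_abs_sub_sub_mul_partialZ_le hab hf hz (ε := c / (|B| + 1))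
    (by positivity)
  have hball : Metric.ball z δ ∈ 𝓝[Icc a b] z :=
    mem_nhdsWithin_of_mem_nhds (Metric.ball_mem_nhds z hδ)
  filter_upwards [self_mem_nhdsWithin, hball] with t ht hzt
  rw [Metric.mem_ball, Real.dist_eq] at hzt
  have h1 := hT (f t) (f z) (partialZ a b f z) (hfz t ht) (hfz z hz) hpz (t - z) _
    (hδ' t ht hzt)
  rw [smul_eq_mul, Real.norm_eq_abs, Real.norm_eq_abs]
  refine h1.trans ?_
  calc B * (c / (|B| + 1) * |t - z|) ≤ (|B| + 1) * (c / (|B| + 1) * |t - z|) :=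
        mul_le_mul_of_nonneg_right (by linarith [le_abs_self B]) (by positivity)
    _ = c * |t - z| := by field_simp

end HaarVersion

theorem mainTheorem2 {Ω : Type*} [MeasurableSpace Ω] (P : Measure Ω) [IsProbabilityMeasure P]
    (d : ℕ) (μ : StochasticMeasure (Cube d) P)
    (a b : ℝ) (hab : a < b) (l : ℕ) (f : ℝ → (Fin d → ℝ) → ℝ)
    (hf : ContDiffOn ℝ ((l + 1 : ℕ) : WithTop ℕ∞) (fun p : ℝ × (Fin d → ℝ) => f p.1 p.2)
      (Set.Icc a b ×ˢ Set.Icc (0 : Fin d → ℝ) 1))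
    (C α : ℝ) (hα : 0 < α) (hα' : α ≤ 1)
    (hbound : ∀ s : List (Fin d), s.length ≤ l → ∀ z ∈ Set.Icc a b,
      ∀ x ∈ Set.Icc (0 : Fin d → ℝ) 1, |iterPartialX s (partialZ a b f z) x| ≤ C)
    (hholder : ∀ s : List (Fin d), s.length = l → ∀ z ∈ Set.Icc a b,
      ∀ x ∈ Set.Icc (0 : Fin d → ℝ) 1, ∀ y ∈ Set.Icc (0 : Fin d → ℝ) 1,
        |iterPartialX s (partialZ a b f z) x - iterPartialX s (partialZ a b f z) y| ≤
          C * ‖WithLp.toLp 2 (x - y)‖ ^ α)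
    (hld : (d : ℝ) / 2 < l + α) :
    (∀ z ∈ Set.Icc a b, μ.HasIntegral (fun x => f z x.1) (haarVersion μ (f z)) ∧
      μ.HasIntegral (fun x => partialZ a b f z x.1) (haarVersion μ (partialZ a b f z))) ∧
    ∀ᵐ ω ∂P,
      (∀ z ∈ Set.Icc a b, Summable (fun k => haarTerm μ (f z) k ω) ∧
        Summable (fun k => haarTerm μ (partialZ a b f z) k ω)) ∧
      (∀ z ∈ Set.Icc a b, HasDerivWithinAt (fun t => haarVersion μ (f t) ω)
        (haarVersion μ (partialZ a b f z) ω) (Set.Icc a b) z) ∧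
      ∃ M : ℝ, ∀ z ∈ Set.Icc a b, |derivWithin (fun t => haarVersion μ (f t) ω)
        (Set.Icc a b) z| ≤ M := by
  have hC : 0 ≤ C := (abs_nonneg _).trans
    (hbound [] (Nat.zero_le l) a (left_mem_Icc.2 hab.le) 0 ⟨le_rfl, zero_le_one⟩)
  have hpz : ∀ z ∈ Icc a b, ContDiffOn ℝ l (partialZ a b f z) (Icc 0 1) := fun z hz =>
    contDiffOn_section (contDiffOn_partialZ hab hf).1 hz
  -- the constant accounts for the passage from the Euclidean norm to the maximum norm
  set C' : ℝ := C * (1 + √d ^ α) with hC'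
  have hd0 : (0 : ℝ) ≤ √d ^ α := Real.rpow_nonneg (Real.sqrt_nonneg _) _
  have happrox : ∀ z ∈ Icc a b,
      IsPolyApprox l (l + α) (C' * (d + 1) ^ l) (partialZ a b f z) := by
    intro z hz
    refine HolderClass.isPolyApprox hα (holderClass_of_iterPartialX (hpz z hz)
      (fun s hs x hx => (hbound s hs z hz x hx).trans ?_) fun s hs x hx y hy =>
      (hholder s hs z hz x hx y hy).trans ?_)
    · exact le_mul_of_one_le_right hC (by linarith)
    · rw [hC', mul_assoc]
      refine mul_le_mul_of_nonneg_left ((norm_toLp_rpow_le (x - y) hα).trans ?_) hC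
      exact mul_le_mul_of_nonneg_right (by linarith) (Real.rpow_nonneg (norm_nonneg _) _)
  have happrox' : ∀ z ∈ Icc a b, ∃ A, IsPolyApprox l (l + α) A (f z) := by
    intro z hz
    obtain ⟨D, hD⟩ := exists_holderClass hα' (contDiffOn_section hf hz)
    exact ⟨_, hD.isPolyApprox hα⟩
  refine ⟨fun z hz => ⟨?_, hasIntegral_haarVersion μ hld (happrox z hz)⟩, ?_⟩
  · obtain ⟨A, hA⟩ := happrox' z hz
    exact hasIntegral_haarVersion μ hld hA
  filter_upwards [ae_exists_haarTerm_le μ l hld, ae_isBoundedOnCube_haarTerm μ]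
    with ω ⟨u, hu, hu0, hle⟩ ⟨⟨B, hB⟩, hT⟩
  set A : ℝ := C' * (d + 1) ^ l with hA
  have hsum : ∀ z ∈ Icc a b, Summable fun k => haarTerm μ (f z) k ω := by
    intro z hz
    obtain ⟨D, hD⟩ := happrox' z hz
    exact Summable.of_norm_bounded (hu.mul_left D) (hle D _ hD)
  have hsum' : ∀ z ∈ Icc a b, Summable fun k => haarTerm μ (partialZ a b f z) k ω := fun z hz =>
    Summable.of_norm_bounded (hu.mul_left A) (hle A _ (happrox z hz))
  have hderiv : ∀ z ∈ Icc a b, HasDerivWithinAt (fun t => haarVersion μ (f t) ω)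
      (haarVersion μ (partialZ a b f z) ω) (Icc a b) z := by
    intro z hz
    refine (hB.hasDerivWithinAt hab hf hz).add ?_
    refine hasDerivWithinAt_tsum_of_convex (convex_Icc a b) (hu.mul_left A)
      (F := fun k t => haarTerm μ (f t) k ω) (F' := fun k t => haarTerm μ (partialZ a b f t) k ω)
      (fun k z hz => ?_) (fun k z hz => hle A _ (happrox z hz) k) hsum hz
    obtain ⟨D, hD⟩ := hT k
    exact hD.hasDerivWithinAt hab hf hz
  refine ⟨fun z hz => ⟨hsum z hz, hsum' z hz⟩, hderiv, B * C + ∑' k, A * u k, fun z hz => ?_⟩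
  rw [(hderiv z hz).derivWithin (uniqueDiffOn_Icc hab z hz)]
  refine (abs_add_le _ _).trans (add_le_add ?_ ?_)
  · exact hB.abs_le (hpz z hz).continuousOn fun t ht => hbound [] (Nat.zero_le l) z hz t ht
  · exact tsum_of_norm_bounded (f := fun k => haarTerm μ (partialZ a b f z) k ω)
      (hu.mul_left A).hasSum (hle A _ (happrox z hz))
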